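/- Let $\Bbbk$ be an algebraically closed field of characteristic $0$ and let $p\ge 1$. Let $\mathrm Y=\mathrm Y_p(\mathfrak{gl}_2)$ be the Yangian of level $p$: the associative unital $\Bbbk$-algebra with generators $t_{ij}^{(1)},\dots,t_{ij}^{(p)}$ $(i,j\in\{1,2\})$ and relations $$[t^{(r)}_{ij},t^{(s)}_{kl}]=\sum_{a=1}^{\min(r,s)}\bigl(t^{(a-1)}_{kj}t^{(r+s-a)}_{il}-t^{(r+s-a)}_{kj}t^{(a-1)}_{il}\bigr),$$ where $t^{(0)}_{ij}=\delta_{ij}$ and $t^{(r)}_{ij}=0$ for $r>p$. Put $T_{ij}(u)=\delta_{ij}u^p+\sum_{r=1}^p t_{ij}^{(r)}u^{p-r}$ and $D(u)=T_{11}(u)T_{22}(u-1)-T_{21}(u)T_{12}(u-1)=u^{2p}+d_1u^{2p-1}+\dots+d_{2p}$. Let $\Gamma\subset\mathrm Y$ be the commutative subalgebra generated by $t_{22}^{(1)},\dots,t_{22}^{(p)},d_1,\dots,d_{2p}$, and let $\mathrm{Sp}\,\Gamma$ be its set of maximal ideals. For a $\mathrm Y$-module $V$ and $\mathbf m\in\mathrm{Sp}\,\Gamma$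 put $V(\mathbf m)=\{x\in V: \mathbf m^n x=0 \text{ for some } n\ge 0\}$. A weight module is a finitely generated $\mathrm Y$-module $V$ with $V=\bigoplus_{\mathbf m\in\mathrm{Sp}\,\Gamma}V(\mathbf m)$ and $\mathbf m V(\mathbf m)=0$ for all $\mathbf m$; its support is $\{\mathbf m: V(\mathbf m)\neq 0\}$. Let $\Delta$ be the smallest equivalence relation on $\mathrm{Sp}\,\Gamma$ such that $\mathbf m\mathrel{\Delta}\mathbf n$ whenever, for some $a\in\mathrm Y$, the left $\Gamma$-module $\Gamma/\mathbf n$ is a subquotient of $\Gamma a\Gamma/\Gamma a\mathbf m$. Let $\beta\in\Bbbk^p$, $\gamma\in\Bbbk^{2p}$, $\ell=(\beta,\gamma)$, and suppose that $\ell$ is generic: $\beta_i-\beta_j\notin\mathbb Z$ for all $i\ne j$. Let $D(\ell)$ be the $\Delta$-class of the maximal ideal of $\Gamma$ generated by the elements $t_{22}^{(r)}-\sigma_r(\beta_1,\dots,\beta_p)$ $(1\le r\le p)$ and $d_i-\sigma_i(\gamma_1,\dots,\gamma_{2p})$ $(1\le i\le 2p)$, where $\sigma_r$ is the $r$-th elementary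 symmetric polynomial, and let $R_\ell$ be the category of weight modules with support contained in $D(\ell)$ (all $\mathrm Y$-module homomorphisms being morphisms). Write $\gamma(u)=(u+\gamma_1)\cdots(u+\gamma_{2p})$ and let $\delta_1,\dots,\delta_p$ be the standard basis of $\mathbb Z^p$. Let $K_\ell$ be the $\Bbbk$-linear category with set of objects $\mathbb Z^p$ whose morphisms are generated by $$f_i(k):k\to k+\delta_i,\qquad e_i(k):k\to k-\delta_i\qquad(1\le i\le p,\ k\in\mathbb Z^p)$$ subject to the relations $$\begin{aligned} f_j(k+\delta_i)f_i(k)&=f_i(k+\delta_j)f_j(k),\\ e_j(k-\delta_i)e_i(k)&=e_i(k-\delta_j)e_j(k),\\ e_i(k+\delta_j)f_j(k)&=f_j(k-\delta_i)e_i(k)\quad(i\neq j),\\ e_i(k+\delta_i)f_i(k)&=-\gamma(-\beta_i-k_i)\,1_k,\\ f_i(k-\delta_i)e_i(k)&=-\gamma(-\beta_i-k_i+1)\,1_k . \end{aligned}$$ Let $K_\ell\text{-mod}$ be the category of finitely generated $K_\ell$-modules, that is, of finitely generated $\Bbbk$-linear functors from $K_\ell$ to $\Bbbk$-vector spaces.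 Then the categories $R_\ell$ and $K_\ell\text{-mod}$ are equivalent (as $\Bbbk$-linear categories). -/

import Mathlib

universe u v

open CategoryTheory Polynomial

noncomputable section

/-! ## Harish-Chandra modules for a pair `(U, Γ)`, with `Γ` a commutative subalgebra of `U` -/

namespace HarishChandra

/-- `Sp Γ`: the maximal ideals of `Γ`. (The notion is used for commutative `Γ` only, where left
ideals are the same as two-sided ideals.) -/
def Sp (Γ : Type*) [Ring Γ] : Set (Ideal Γ) := {m | m.IsMaximal}

section
variable {k U : Type*} [Field k] [Ring U] [Algebra k U] (Γ : Subalgebra k U)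

/-- `M(𝐦) = {x ∈ M | 𝐦 ^ n x = 0 for some n ≥ 0}`. -/
def component (M : Type*) [AddCommGroup M] [Module U M] (m : Ideal Γ) : AddSubgroup M where
  carrier := {x | ∃ n : ℕ, ∀ g ∈ m ^ n, (g : U) • x = 0}
  zero_mem' := ⟨0, fun g _ => smul_zero _⟩
  add_mem' := by
    rintro x y ⟨n, hn⟩ ⟨l, hl⟩
    refine ⟨max n l, fun g hg => ?_⟩
    rw [smul_add, hn g (Ideal.pow_le_pow_right (le_max_left n l) hg),
      hl g (Ideal.pow_le_pow_right (le_max_right n l) hg), add_zero]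
  neg_mem' := by
    rintro x ⟨n, hn⟩
    exact ⟨n, fun g hg => by rw [smul_neg, hn g hg, neg_zero]⟩

/-- `M` is a Harish-Chandra module: it is finitely generated over `U` and it is the direct sum of
the `M(𝐦)`, `𝐦 ∈ Sp Γ`. -/
def IsHarishChandra (M : Type*) [AddCommGroup M] [Module U M] : Prop :=
  Module.Finite U M ∧ DirectSum.IsInternal (fun m : Sp Γ => component Γ M m.1)

/-- The weight condition: `𝐦 x = 0` for all `𝐦 ∈ Sp Γ` and all `x ∈ M(𝐦)`. -/
def IsWeight (M : Type*) [AddCommGroup M] [Module U M] : Prop :=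
  ∀ m ∈ Sp Γ, ∀ x ∈ component Γ M m, ∀ g ∈ m, (g : U) • x = 0

/-- `Supp M = {𝐦 ∈ Sp Γ | M(𝐦) ≠ 0}`. -/
def support (M : Type*) [AddCommGroup M] [Module U M] : Set (Ideal Γ) :=
  {m | m ∈ Sp Γ ∧ component Γ M m ≠ ⊥}

/-- The left `Γ`-submodule `Γ a 𝐦` of `U`; for `𝐦 = Γ` this is the bimodule `Γ a Γ`. -/
def leftRight (a : U) (m : Ideal Γ) : Submodule Γ U :=
  Submodule.span Γ {x | ∃ g ∈ m, x = a * (g : U)}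

/-- The set `X_a` of pairs `(𝐦, 𝐧)` of maximal ideals such that `Γ / 𝐧` is a subquotient of
`Γ a Γ / Γ a 𝐦`, i.e. `Γ / 𝐧 ≅ B / A` with `Γ a 𝐦 ≤ A ≤ B ≤ Γ a Γ`. -/
def X (a : U) (m n : Ideal Γ) : Prop :=
  m ∈ Sp Γ ∧ n ∈ Sp Γ ∧ ∃ A B : Submodule Γ U,
    leftRight Γ a m ≤ A ∧ A ≤ B ∧ B ≤ leftRight Γ a ⊤ ∧
      Nonempty ((↥B ⧸ A.submoduleOf B) ≃ₗ[Γ] (Γ ⧸ n))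

/-- The class of `𝐦` for the smallest equivalence relation `Δ` that contains all the `X_a`. -/
def block (m : Ideal Γ) : Set (Ideal Γ) :=
  {n | Relation.EqvGen (fun m' n' => ∃ a : U, X Γ a m' n') m n}

end

/-- The property of `U`-modules defining the category `ℍW(U, Γ, D)` of Harish-Chandra weight
modules with support in `D`. -/
def weightProperty {k U : Type u} [Field k] [Ring U] [Algebra k U] (Γ : Subalgebra k U)
    (D : Set (Ideal Γ)) : ObjectProperty (ModuleCat.{u} U) :=
  fun M => IsHarishChandra Γ M ∧ IsWeight Γ M ∧ support Γ M ⊆ D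

end HarishChandra

/-! ## The Yangian of level `p` for `𝔤𝔩₂`

The matrix indices `1, 2` are `0, 1 : Fin 2`. -/

namespace Yangian

section
variable (k : Type u) [Field k] (p : ℕ)

/-- `t_ij^(r)` in the free algebra on the generators `t_ij^(1), …, t_ij^(p)`, with the conventions
`t_ij^(0) = δ_ij` and `t_ij^(r) = 0` for `r > p`. -/
def freeT (i j : Fin 2) (r : ℕ) : FreeAlgebra k (Fin 2 × Fin 2 × Fin p) :=
  if r = 0 then (if i = j then 1 else 0)
  else if h : r - 1 < p then FreeAlgebra.ι k (i, j, ⟨r - 1, h⟩) else 0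

/-- The defining relations of the Yangian of level `p`. -/
inductive Rel : FreeAlgebra k (Fin 2 × Fin 2 × Fin p) →
    FreeAlgebra k (Fin 2 × Fin 2 × Fin p) → Prop
  | mk (i j c d : Fin 2) (r s : ℕ) :
      Rel (freeT k p i j r * freeT k p c d s - freeT k p c d s * freeT k p i j r)
        (∑ a ∈ Finset.Icc 1 (min r s),
          (freeT k p c j (a - 1) * freeT k p i d (r + s - a) -
            freeT k p c j (r + s - a) * freeT k p i d (a - 1)))

/-- The Yangian `Y_p(𝔤𝔩₂)` of level `p`. -/
abbrev Y : Type u := RingQuot (Rel k p)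

/-- The element `t_ij^(r)` of the Yangian. -/
def t (i j : Fin 2) (r : ℕ) : Y k p := RingQuot.mkAlgHom k (Rel k p) (freeT k p i j r)

/-- `T_ij(u) = δ_ij u^p + t_ij^(1) u^(p-1) + ⋯ + t_ij^(p)`. -/
def T (i j : Fin 2) : (Y k p)[X] :=
  ∑ r ∈ Finset.range (p + 1), Polynomial.C (t k p i j r) * Polynomial.X ^ (p - r)

/-- The quantum determinant `D(u) = T₁₁(u) T₂₂(u-1) - T₂₁(u) T₁₂(u-1)`. -/
def qdet : (Y k p)[X] :=
  T k p 0 0 * (T k p 1 1).comp (Polynomial.X - 1) - T k p 1 0 * (T k p 0 1).comp (Polynomial.X - 1)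

/-- `d_i`, the coefficient of `u^(2p-i)` in `D(u) = u^(2p) + d_1 u^(2p-1) + ⋯ + d_(2p)`. -/
def d (i : ℕ) : Y k p := (qdet k p).coeff (2 * p - i)

/-- The commutative subalgebra `Γ`, generated by `t₂₂^(1), …, t₂₂^(p)` and `d_1, …, d_(2p)`. -/
def Gam : Subalgebra k (Y k p) :=
  Algebra.adjoin k ({x | ∃ r ∈ Finset.Icc 1 p, x = t k p 1 1 r} ∪
    {x | ∃ i ∈ Finset.Icc 1 (2 * p), x = d k p i})

end

section
variable {k : Type u} [Field k] {p : ℕ}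

/-- `ι^*(ℓ) ∈ Sp Γ` for `ℓ = (β, γ)`: the maximal ideal of `Γ` generated by the elements
`t₂₂^(r) - σ_r(β_1, …, β_p)` and `d_i - σ_i(γ_1, …, γ_(2p))`, where `σ_r` is the `r`-th elementary
symmetric polynomial. -/
def iotaStar (β : Fin p → k) (γ : Fin (2 * p) → k) : Ideal (Gam k p) :=
  Ideal.span
    ({x | ∃ r ∈ Finset.Icc 1 p,
        (x : Y k p) = t k p 1 1 r - algebraMap k (Y k p) ((Finset.univ.val.map β).esymm r)} ∪
     {x | ∃ i ∈ Finset.Icc 1 (2 * p),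
        (x : Y k p) = d k p i - algebraMap k (Y k p) ((Finset.univ.val.map γ).esymm i)})

/-- The category `R_ℓ = ℍW(Y_p(𝔤𝔩₂), Γ, D(ℓ))`, for `ℓ = (β, γ)`, where `D(ℓ)` is the `Δ`-class of
`ι^*(ℓ)`. -/
abbrev R (β : Fin p → k) (γ : Fin (2 * p) → k) : Type (u + 1) :=
  (HarishChandra.weightProperty (Gam k p)
    (HarishChandra.block (Gam k p) (iotaStar β γ))).FullSubcategory

end

/-! ## The category `K_ℓ` -/

/-- The set `ℤ^p` of objects of `K_ℓ`. -/
def Ob (p : ℕ) : Type := Fin p → ℤ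

/-- `k + δ_i`. -/
def up {p : ℕ} (i : Fin p) (a : Fin p → ℤ) : Ob p := a + Pi.single i 1

/-- `k - δ_i`. -/
def down {p : ℕ} (i : Fin p) (a : Fin p → ℤ) : Ob p := a - Pi.single i 1

/-- The generating arrows `f_i(k) : k ⟶ k + δ_i` and `e_i(k) : k ⟶ k - δ_i`. The targets are
recorded through equations, so that `k + δ_i + δ_j` and `k + δ_j + δ_i` need not be equal by
definition. -/
inductive Arrow {p : ℕ} : Ob p → Ob p → Type
  | f (i : Fin p) {a b : Ob p} (h : b = up i a) : Arrow a b
  | e (i : Fin p) {a b : Ob p} (h : b = down i a) : Arrow a b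

instance (p : ℕ) : Quiver (Ob p) := ⟨Arrow⟩

/-- The free `k`-linear category on the generating arrows. -/
abbrev FreeK (k : Type u) (p : ℕ) : Type := CategoryTheory.Free k (Paths (Ob p))

section
variable (k : Type u) [Field k] {p : ℕ}

/-- The object `a ∈ ℤ^p` of the free `k`-linear category. -/
def ob (a : Ob p) : FreeK k p := a

/-- `f_i(a) : a ⟶ a + δ_i` in the free `k`-linear category. -/
def fHom (i : Fin p) {a b : Ob p} (h : b = up i a) : ob k a ⟶ ob k b :=
  (CategoryTheory.Free.embedding k (Paths (Ob p))).map
    ((Paths.of (Ob p)).map (Arrow.f i h : a ⟶ b))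

/-- `e_i(a) : a ⟶ a - δ_i` in the free `k`-linear category. -/
def eHom (i : Fin p) {a b : Ob p} (h : b = down i a) : ob k a ⟶ ob k b :=
  (CategoryTheory.Free.embedding k (Paths (Ob p))).map
    ((Paths.of (Ob p)).map (Arrow.e i h : a ⟶ b))

end

section
variable {k : Type u} [Field k] {p : ℕ}

/-- `γ(x) = (x + γ_1) ⋯ (x + γ_(2p))`. -/
def gam (γ : Fin (2 * p) → k) (x : k) : k := ∏ j, (x + γ j)

/-- The smallest relation on the morphisms of the free `k`-linear category that contains the
defining relations of `K_ℓ`, `ℓ = (β, γ)`, is an equivalence relation and is compatible with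
composition, sums and scalar multiples. Recall that `x ≫ y` is the composition `y x`. -/
inductive KRel (β : Fin p → k) (γ : Fin (2 * p) → k) : HomRel (FreeK k p)
  | ff (i j : Fin p) {a b b' c : Ob p} (h₁ : b = up i a) (h₂ : c = up j b)
      (h₃ : b' = up j a) (h₄ : c = up i b') :
      KRel β γ (fHom k i h₁ ≫ fHom k j h₂) (fHom k j h₃ ≫ fHom k i h₄)
  | ee (i j : Fin p) {a b b' c : Ob p} (h₁ : b = down i a) (h₂ : c = down j b)
      (h₃ : b' = down j a) (h₄ : c = down i b') :
      KRel β γ (eHom k i h₁ ≫ eHom k j h₂) (eHom k j h₃ ≫ eHom k i h₄)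
  | ef (i j : Fin p) (hij : i ≠ j) {a b b' c : Ob p} (h₁ : b = up j a) (h₂ : c = down i b)
      (h₃ : b' = down i a) (h₄ : c = up j b') :
      KRel β γ (fHom k j h₁ ≫ eHom k i h₂) (eHom k i h₃ ≫ fHom k j h₄)
  | ef_same (i : Fin p) {a b : Ob p} (h₁ : b = up i a) (h₂ : a = down i b) :
      KRel β γ (fHom k i h₁ ≫ eHom k i h₂)
        ((-gam γ (-β i - ((a i : ℤ) : k))) • 𝟙 (ob k a))
  | fe_same (i : Fin p) {a b : Ob p} (h₁ : b = down i a) (h₂ : a = up i b) :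
      KRel β γ (eHom k i h₁ ≫ fHom k i h₂)
        ((-gam γ (-β i - ((a i : ℤ) : k) + 1)) • 𝟙 (ob k a))
  | refl {x y : FreeK k p} (g : x ⟶ y) : KRel β γ g g
  | symm {x y : FreeK k p} {g h : x ⟶ y} : KRel β γ g h → KRel β γ h g
  | trans {x y : FreeK k p} {g h l : x ⟶ y} : KRel β γ g h → KRel β γ h l → KRel β γ g l
  | precomp {x y z : FreeK k p} (l : x ⟶ y) {g h : y ⟶ z} :
      KRel β γ g h → KRel β γ (l ≫ g) (l ≫ h)
  | postcomp {x y z : FreeK k p} {g h : x ⟶ y} (l : y ⟶ z) :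
      KRel β γ g h → KRel β γ (g ≫ l) (h ≫ l)
  | add {x y : FreeK k p} (g₁ g₂ h₁ h₂ : x ⟶ y) :
      KRel β γ g₁ g₂ → KRel β γ h₁ h₂ → KRel β γ (g₁ + h₁) (g₂ + h₂)
  | smul (c : k) {x y : FreeK k p} (g h : x ⟶ y) : KRel β γ g h → KRel β γ (c • g) (c • h)

instance (β : Fin p → k) (γ : Fin (2 * p) → k) : Congruence (KRel β γ) where
  equivalence := ⟨KRel.refl, KRel.symm, KRel.trans⟩
  comp_left _ _ _ h := KRel.precomp _ h
  comp_right _ h := KRel.postcomp _ h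

/-- The `k`-linear category `K_ℓ`, `ℓ = (β, γ)`. -/
abbrev K (β : Fin p → k) (γ : Fin (2 * p) → k) : Type := CategoryTheory.Quotient (KRel β γ)

instance (β : Fin p → k) (γ : Fin (2 * p) → k) : Preadditive (K β γ) :=
  Quotient.preadditive _ (fun _ _ => KRel.add)

instance (β : Fin p → k) (γ : Fin (2 * p) → k) :
    (Quotient.functor (KRel β γ)).Additive :=
  Quotient.functor_additive _ (fun _ _ => KRel.add)

instance (β : Fin p → k) (γ : Fin (2 * p) → k) : Linear k (K β γ) :=
  Quotient.linear k _ (fun c _ _ => KRel.smul c)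

end

/-- A functor `V` from a category to `k`-vector spaces is finitely generated: there are finitely
many elements `x_j ∈ V(c_j)` such that every `V(b)` is spanned by the `V(φ) x_j`, `φ : c_j ⟶ b`. -/
def IsFinitelyGenerated {k : Type u} [Field k] {C : Type} [Category.{u} C]
    (V : C ⥤ ModuleCat.{u} k) : Prop :=
  ∃ (n : ℕ) (c : Fin n → C) (x : ∀ j, V.obj (c j)), ∀ b : C,
    Submodule.span k {y : V.obj b | ∃ (j : Fin n) (φ : c j ⟶ b), y = (V.map φ).hom (x j)} = ⊤

/-- The category `K_ℓ-mod` of finitely generated modules over `K_ℓ`, that is, of finitely generated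
`k`-linear functors from `K_ℓ` to `k`-vector spaces. -/
abbrev KMod {k : Type u} [Field k] {p : ℕ} (β : Fin p → k) (γ : Fin (2 * p) → k) : Type (u + 1) :=
  ObjectProperty.FullSubcategory (C := K β γ ⥤ ModuleCat.{u} k)
    (fun V => V.Additive ∧ V.Linear k ∧ IsFinitelyGenerated V)

end Yangian

end

/-! A module in $R_\ell$ is a $\mathbb Z^p$-graded vector space: the piece of degree $k$ is the
joint eigenspace on which $T_{22}(u)$ acts by $\prod_i(u+\beta_i+k_i)$ and $D(u)$ by $\gamma(u)$.
Genericity makes the $p$ zeros $-\beta_i-k_i$ of this eigenvalue distinct. They serve as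
interpolation nodes: $T_{21}(u)$ and $T_{12}(u)$ have degree less than $p$, so on weight $k$ they
are determined by their values there. The RTT relation with $T_{22}$ shows that the value of
$T_{21}$ at the $i$-th node raises the weight by $\delta_i$ and that of $T_{12}$ lowers it; these
values are $f_i$ and $e_i$. Their commutation rules are RTT relations at nodes. The products
$e_if_i$ and $f_ie_i$ come from the two expressions of $D(u)$, evaluated where the term with
$T_{22}$ vanishes.

Conversely, Lagrange interpolation recovers $T_{21}$ and $T_{12}$ from a $K_\ell$-module, and
$T_{11}$ is forced to be $T_{22}(u)-[t_{21}^{(1)},T_{12}(u)]$. The relations that do not involve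
this $T_{11}$ in a commutator, and $D(u)=\gamma(u)$, are polynomial identities that can be tested at
nodes. Applying $\mathrm{ad}\,t_{21}^{(1)}$ and $\mathrm{ad}\,t_{12}^{(1)}$ to $D(u)=\gamma(u)$ and
cancelling $T_{22}$ gives the action of these elements on $T_{11}$ (`Datum.reducedRel`), and the
same derivations produce the full presentation (`ReducedRel.rtt`).

It remains to identify $D(\ell)$ with the ideals of the parameters $(\beta+k,\gamma)$, $k\in\mathbb
Z^p$ (`block_eq`). An explicit module with one-dimensional weight spaces links neighbouring weights
through $t_{21}^{(1)}$. In the other direction, every $a\in\mathrm Y$ lies in a $\Gamma$-bimodule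
$S$, finitely generated on the right, across which products of these ideals can be moved
(`exists_good`). If exactly one of $\mathbf m,\mathbf n$ belonged to the family, then $S=\mathbf
nS+S\mathbf m$. Nakayama's lemma over $\Gamma\otimes\Gamma$ then excludes $\Gamma/\mathbf n$ as a
subquotient of $\Gamma a\Gamma/\Gamma a\mathbf m$.

Passing to weight spaces is then a linear functor. It is fully faithful because $\mathrm Y$ is
generated by $t_{22}^{(r)},t_{21}^{(1)},t_{12}^{(1)}$, whose action on weight vectors is determined
by weights, $f_i$ and $e_i$; it is essentially surjective by the interpolation above. Finite
generation transfers both ways. -/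

noncomputable section

/-! ## Polynomial functions with values in a vector space -/

namespace Yangian

section PolyFun
variable {k M M' : Type*} [Field k] [AddCommGroup M] [Module k M] [AddCommGroup M'] [Module k M']

/-- `F` is a polynomial function of degree less than `n` with values in `M`. -/
def IsPoly (n : ℕ) (F : k → M) : Prop :=
  ∃ x : ℕ → M, ∀ u, F u = ∑ r ∈ Finset.range n, u ^ r • x r

theorem IsPoly.add {n : ℕ} {F G : k → M} (hF : IsPoly n F) (hG : IsPoly n G) :
    IsPoly n (fun u => F u + G u) := by
  obtain ⟨x, hx⟩ := hF
  obtain ⟨y, hy⟩ := hG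
  exact ⟨x + y, fun u => by simp [hx, hy, Finset.sum_add_distrib]⟩

theorem IsPoly.map {n : ℕ} {F : k → M} (hF : IsPoly n F) (φ : M →ₗ[k] M') :
    IsPoly n (fun u => φ (F u)) := by
  obtain ⟨x, hx⟩ := hF
  exact ⟨fun r => φ (x r), fun u => by simp [hx]⟩

theorem IsPoly.smul {n : ℕ} {F : k → M} (hF : IsPoly n F) (c : k) :
    IsPoly n (fun u => c • F u) :=
  hF.map (LinearMap.lsmul k M c)

theorem IsPoly.neg {n : ℕ} {F : k → M} (hF : IsPoly n F) : IsPoly n (fun u => - F u) := by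
  simpa using hF.smul (-1)

theorem IsPoly.sub {n : ℕ} {F G : k → M} (hF : IsPoly n F) (hG : IsPoly n G) :
    IsPoly n (fun u => F u - G u) := by
  simpa [sub_eq_add_neg] using hF.add hG.neg

theorem IsPoly.sum {n : ℕ} {ι : Type*} (s : Finset ι) {F : ι → k → M}
    (hF : ∀ i ∈ s, IsPoly n (F i)) : IsPoly n (fun u => ∑ i ∈ s, F i u) := by
  classical
  induction s using Finset.induction_on with
  | empty => exact ⟨0, fun u => by simp⟩
  | insert a s ha ih =>
    simp only [Finset.sum_insert ha]
    exact (hF a (by simp)).add (ih fun i hi => hF i (by simp [hi]))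

theorem IsPoly.mono {n m : ℕ} (h : n ≤ m) {F : k → M} (hF : IsPoly n F) : IsPoly m F := by
  obtain ⟨x, hx⟩ := hF
  refine ⟨fun r => if r < n then x r else 0, fun u => ?_⟩
  rw [hx]
  have : Finset.range n ⊆ Finset.range m := Finset.range_subset_range.2 h
  rw [← Finset.sum_subset this]
  · exact Finset.sum_congr rfl fun r hr => by simp [Finset.mem_range.1 hr]
  · intro r _ hr
    simp only [Finset.mem_range] at hr
    simp [hr]

theorem IsPoly.id_smul {n : ℕ} {F : k → M} (hF : IsPoly n F) : IsPoly (n + 1) (fun u => u • F u) := by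
  obtain ⟨x, hx⟩ := hF
  refine ⟨fun r => if r = 0 then 0 else x (r - 1), fun u => ?_⟩
  dsimp only
  rw [Finset.sum_range_succ', hx, Finset.smul_sum]
  simp [pow_succ', mul_smul]

theorem isPoly_eval {n : ℕ} {q : k[X]} (hq : q.degree < n) (x : M) :
    IsPoly n (fun u => q.eval u • x) := by
  refine ⟨fun r => q.coeff r • x, fun u => ?_⟩
  rcases Nat.eq_zero_or_pos n with rfl | hn
  · have : q = 0 := Polynomial.degree_eq_bot.1 (by simpa [Nat.WithBot.lt_zero_iff] using hq)
    simp [this]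
  have hq' : q.natDegree < n := by
    by_cases h0 : q = 0
    · simpa [h0] using hn
    · exact (Polynomial.natDegree_lt_iff_degree_lt h0).2 hq
  dsimp only
  rw [Polynomial.eval_eq_sum_range' hq', Finset.sum_smul]
  exact Finset.sum_congr rfl fun r _ => by rw [smul_smul, mul_comm]

theorem IsPoly.comp_add {n : ℕ} {F : k → M} (hF : IsPoly n F) (c : k) :
    IsPoly n (fun u => F (u + c)) := by
  obtain ⟨x, hx⟩ := hF
  simp only [hx]
  refine IsPoly.sum _ fun r hr => ?_
  have := isPoly_eval (k := k) (n := n) (q := (X + C c) ^ r) ?_ (x r)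
  · simpa using this
  · refine lt_of_le_of_lt (Polynomial.degree_pow_le _ _) ?_
    rw [Polynomial.degree_X_add_C]
    simpa using Finset.mem_range.1 hr

theorem IsPoly.comp_sub_one {n : ℕ} {F : k → M} (hF : IsPoly n F) :
    IsPoly n (fun u => F (u - 1)) := by
  simpa [sub_eq_add_neg] using hF.comp_add (-1)

theorem dual_sum_pow_smul (φ : M →ₗ[k] k) (n : ℕ) (x : ℕ → M) (u : k) :
    φ (∑ r ∈ Finset.range n, u ^ r • x r) =
      Polynomial.eval u (∑ r ∈ Finset.range n, C (φ (x r)) * X ^ r) := by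
  rw [Polynomial.eval_finsetSum, map_sum]
  refine Finset.sum_congr rfl fun r _ => ?_
  rw [map_smul, smul_eq_mul, Polynomial.eval_mul, Polynomial.eval_C, Polynomial.eval_pow,
    Polynomial.eval_X, mul_comm]

/-- Linear functionals reduce this to a scalar polynomial with at least as many roots as its degree
bound, so no finiteness of `M` is needed. -/
theorem IsPoly.eq_zero {n : ℕ} {F : k → M} (hF : IsPoly n F) (s : Finset k) (hs : n ≤ s.card)
    (h : ∀ u ∈ s, F u = 0) (u : k) : F u = 0 := by
  obtain ⟨x, hx⟩ := hF
  refine (Module.forall_dual_apply_eq_zero_iff k _).1 fun φ => ?_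
  have key : (∑ r ∈ Finset.range n, C (φ (x r)) * X ^ r : k[X]) = 0 := by
    refine Polynomial.eq_zero_of_degree_lt_of_eval_finset_eq_zero s ?_ ?_
    · refine (Polynomial.degree_sum_le _ _).trans_lt ?_
      rw [Finset.sup_lt_iff (by exact_mod_cast WithBot.bot_lt_coe _)]
      intro r hr
      refine (Polynomial.degree_C_mul_X_pow_le _ _).trans_lt ?_
      exact_mod_cast (Finset.mem_range.1 hr).trans_le hs
    · intro v hv
      rw [← dual_sum_pow_smul, ← hx, h v hv, map_zero]
  rw [hx, dual_sum_pow_smul, key, Polynomial.eval_zero]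

theorem IsPoly.eq_zero_of_nodes {ι : Type*} [Fintype ι] {n : ℕ} {F : k → M} (hF : IsPoly n F)
    (hn : n ≤ Fintype.card ι) {b : ι → k} (hb : Function.Injective b) (h : ∀ i, F (b i) = 0)
    (u : k) : F u = 0 := by
  classical
  refine hF.eq_zero (Finset.univ.image b) ?_ ?_ u
  · rwa [Finset.card_image_of_injective _ hb]
  · simpa using h

/-- Interpolation one variable at a time: first in `u` with `v` at a node, then in `v`. -/
theorem eq_zero_of_grid {ι : Type*} [Fintype ι] {n : ℕ} {F : k → k → M}
    (h₁ : ∀ v, IsPoly n (fun u => F u v)) (h₂ : ∀ u, IsPoly n (F u))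
    (hn : n ≤ Fintype.card ι) {b : ι → k} (hb : Function.Injective b)
    (h : ∀ i j, F (b i) (b j) = 0) (u v : k) : F u v = 0 :=
  (h₂ u).eq_zero_of_nodes hn hb
    (fun j => (h₁ (b j)).eq_zero_of_nodes hn hb (fun i => h i j) u) v

theorem IsPoly.pow_smul {n : ℕ} {F : k → M} (hF : IsPoly n F) (j : ℕ) :
    IsPoly (n + j) (fun u => u ^ j • F u) := by
  induction j with
  | zero => simpa using hF
  | succ j ih => simpa [pow_succ', mul_smul, ← add_assoc] using ih.id_smul

/-- Serves to cancel a factor `u - a`: the cancellation fails only at `a`, and a polynomial function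
on an infinite field cannot be nonzero at a single point. -/
theorem IsPoly.eq_zero_of_ne [Infinite k] {n : ℕ} {F : k → M} (hF : IsPoly n F) (a : k)
    (h : ∀ u, u ≠ a → F u = 0) (u : k) : F u = 0 := by
  classical
  obtain ⟨s, hs⟩ := Infinite.exists_subset_card_eq k (n + 1)
  refine hF.eq_zero (s.erase a) ?_ ?_ u
  · have := Finset.pred_card_le_card_erase (s := s) (a := a)
    omega
  · intro v hv
    exact h v (Finset.ne_of_mem_erase hv)

theorem coeff_eq_zero_of_sum_pow_smul [Infinite k] {n : ℕ} {x : ℕ → M}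
    (h : ∀ u : k, ∑ r ∈ Finset.range n, u ^ r • x r = 0) {r : ℕ} (hr : r < n) : x r = 0 := by
  refine (Module.forall_dual_apply_eq_zero_iff k _).1 fun φ => ?_
  have key : (∑ r ∈ Finset.range n, C (φ (x r)) * X ^ r : k[X]) = 0 := by
    refine Polynomial.funext fun u => ?_
    rw [← dual_sum_pow_smul, h u, map_zero, Polynomial.eval_zero]
  have := congrArg (fun q => Polynomial.coeff q r) key
  simpa [Polynomial.finsetSum_coeff, hr] using this

/-- The value at `u` of the polynomial `x 0 * u ^ p + ⋯ + x p`. -/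
def ev (p : ℕ) (x : ℕ → M) (u : k) : M := ∑ r ∈ Finset.range (p + 1), u ^ (p - r) • x r

theorem ev_eq_sum_reflect (p : ℕ) (x : ℕ → M) (u : k) :
    ev p x u = ∑ r ∈ Finset.range (p + 1), u ^ r • x (p - r) := by
  rw [ev, ← Finset.sum_range_reflect]
  refine Finset.sum_congr rfl fun r hr => ?_
  have : r ≤ p := by simpa [Nat.lt_succ_iff] using hr
  congr 2; omega

theorem isPoly_ev (p : ℕ) (x : ℕ → M) : IsPoly (p + 1) (ev (k := k) p x) :=
  ⟨fun r => x (p - r), ev_eq_sum_reflect p x⟩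

theorem ev_sub_leading (p : ℕ) (x : ℕ → M) (u : k) :
    ev p x u - u ^ p • x 0 = ∑ r ∈ Finset.range p, u ^ r • x (p - r) := by
  rw [ev_eq_sum_reflect, Finset.sum_range_succ]; simp

/-- Removing the leading term brings the number of coefficients down to `p`, the number of
interpolation nodes. -/
theorem isPoly_ev_sub (p : ℕ) (x : ℕ → M) :
    IsPoly p (fun u : k => ev p x u - u ^ p • x 0) :=
  ⟨fun r => x (p - r), ev_sub_leading p x⟩

theorem isPoly_ev_of_zero {p : ℕ} {x : ℕ → M} (hx : x 0 = 0) : IsPoly p (ev (k := k) p x) := by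
  simpa [hx] using isPoly_ev_sub (k := k) p x

theorem ev_map (p : ℕ) (x : ℕ → M) (φ : M →ₗ[k] M') (u : k) :
    ev p (fun r => φ (x r)) u = φ (ev p x u) := by simp [ev]

/-- Raising the index multiplies the generating function by `u`, except that `x 0` drops out at the
top; the vanishing of `x (p + 1)` ensures that no constant term enters. -/
theorem ev_succ {p : ℕ} {x : ℕ → M} (hx : x (p + 1) = 0) (u : k) :
    ev p (fun r => x (r + 1)) u = u • ev p x u - u ^ (p + 1) • x 0 := by
  rw [ev, Finset.sum_range_succ, hx, ev, Finset.smul_sum, Finset.sum_range_succ' _ p]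
  simp only [smul_zero, add_zero, tsub_zero, smul_smul, pow_succ']
  rw [add_sub_cancel_right]
  refine Finset.sum_congr rfl fun r hr => ?_
  rw [← pow_succ']
  congr 2
  have := Finset.mem_range.1 hr
  omega

theorem isPoly_smul_ev_sub {p : ℕ} {x : ℕ → M} (hx : x 0 = 0) (hx' : x (p + 1) = 0) :
    IsPoly p (fun u : k => u • ev p x u - u ^ p • x 1) := by
  have := isPoly_ev_sub (k := k) p (fun r => x (r + 1))
  simpa [ev_succ hx', hx] using this

theorem ev_coeff_eq_zero [Infinite k] {p : ℕ} {x : ℕ → M} (h : ∀ u : k, ev p x u = 0) {r : ℕ}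
    (hr : r ≤ p) : x r = 0 := by
  have := coeff_eq_zero_of_sum_pow_smul (k := k) (n := p + 1) (x := fun r => x (p - r))
    (fun u => by rw [← ev_eq_sum_reflect]; exact h u) (r := p - r) (by omega)
  simpa [Nat.sub_sub_self hr] using this

theorem ev_sub (p : ℕ) (x y : ℕ → M) (u : k) : ev p (fun r => x r - y r) u = ev p x u - ev p y u := by
  simp [ev, smul_sub]

end PolyFun

/-! ### Polynomial functions with values in an algebra -/

section PolyFunAlg
variable {k S : Type*} [Field k] [Ring S] [Algebra k S]

theorem ev_mul_left (p : ℕ) (x : ℕ → S) (a : S) (u : k) :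
    ev p (fun r => a * x r) u = a * ev p x u := ev_map p x (LinearMap.mulLeft k a) u

theorem ev_mul_right (p : ℕ) (x : ℕ → S) (a : S) (u : k) :
    ev p (fun r => x r * a) u = ev p x u * a := ev_map p x (LinearMap.mulRight k a) u

theorem IsPoly.mul {n m : ℕ} {F G : k → S} (hF : IsPoly n F) (hG : IsPoly m G) :
    IsPoly (n + m) (fun u => F u * G u) := by
  obtain ⟨x, hx⟩ := hF
  simp only [hx, Finset.sum_mul, smul_mul_assoc]
  refine IsPoly.sum _ fun r hr => ?_
  refine (IsPoly.pow_smul (hG.map (LinearMap.mulLeft k (x r))) r).mono ?_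
  have := Finset.mem_range.1 hr
  omega

theorem IsPoly.const_mul {n : ℕ} {F : k → S} (hF : IsPoly n F) (a : S) :
    IsPoly n (fun u => a * F u) := hF.map (LinearMap.mulLeft k a)

theorem IsPoly.mul_const {n : ℕ} {F : k → S} (hF : IsPoly n F) (a : S) :
    IsPoly n (fun u => F u * a) := hF.map (LinearMap.mulRight k a)

end PolyFunAlg

end Yangian

/-! ## The defining relations of the Yangian in terms of generating functions -/

namespace Yangian

section RTTSection
variable {k S : Type*} [Field k] [Ring S] [Algebra k S]

/-- The conventions `t_ij^(0) = δ_ij` and `t_ij^(r) = 0` for `r > p`. -/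
structure IsLevel (p : ℕ) (t : Fin 2 → Fin 2 → ℕ → S) : Prop where
  zero : ∀ i j, t i j 0 = if i = j then 1 else 0
  high : ∀ i j r, p < r → t i j r = 0

/-- The defining relations of the Yangian. -/
def Presented (t : Fin 2 → Fin 2 → ℕ → S) : Prop :=
  ∀ (i j c d : Fin 2) (r s : ℕ), t i j r * t c d s - t c d s * t i j r =
    ∑ a ∈ Finset.Icc 1 (min r s),
      (t c j (a - 1) * t i d (r + s - a) - t c j (r + s - a) * t i d (a - 1))

/-- The relation between `t_ij` and `t_cd`, for neighbouring commutators. -/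
def StepRelAt (t : Fin 2 → Fin 2 → ℕ → S) (i j c d : Fin 2) : Prop :=
  ∀ r s : ℕ,
    (t i j (r + 1) * t c d s - t c d s * t i j (r + 1)) -
      (t i j r * t c d (s + 1) - t c d (s + 1) * t i j r) =
    t c j r * t i d s - t c j s * t i d r

/-- The defining relations of the Yangian, for neighbouring commutators. -/
def StepRel (t : Fin 2 → Fin 2 → ℕ → S) : Prop :=
  ∀ i j c d : Fin 2, StepRelAt t i j c d

/-- The relation between `t_ij` and `t_cd`, for the generating functions. -/
def RTTAt (k : Type*) {S : Type*} [Field k] [Ring S] [Algebra k S] (p : ℕ)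
    (t : Fin 2 → Fin 2 → ℕ → S) (i j c d : Fin 2) : Prop :=
  ∀ u v : k,
    (u - v) • (ev p (t i j) u * ev p (t c d) v - ev p (t c d) v * ev p (t i j) u) =
      ev p (t c j) u * ev p (t i d) v - ev p (t c j) v * ev p (t i d) u

/-- The defining relations of the Yangian, for the generating functions. -/
def RTT (k : Type*) {S : Type*} [Field k] [Ring S] [Algebra k S] (p : ℕ)
    (t : Fin 2 → Fin 2 → ℕ → S) : Prop :=
  ∀ i j c d : Fin 2, RTTAt k p t i j c d

/-- The sums for `(r + 1, s)` and `(r, s + 1)` have the same summands, which depend on `r + s + 1`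
only. Their upper limits differ by at most one, so at most one summand survives in the difference.
-/
theorem Presented.stepRel {t : Fin 2 → Fin 2 → ℕ → S} (h : Presented t) : StepRel t := by
  intro i j c d r s
  rw [h i j c d (r + 1) s, h i j c d r (s + 1)]
  have e1 : r + 1 + s = r + (s + 1) := by ring
  rw [e1]
  rcases lt_trichotomy s r with hsr | rfl | hsr
  · rw [min_eq_right (by omega : s ≤ r + 1), min_eq_right (by omega : s + 1 ≤ r),
      Finset.sum_Icc_succ_top (by omega)]
    have : r + (s + 1) - (s + 1) = r := by omega
    rw [this, Nat.add_sub_cancel]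
    abel
  · rw [min_eq_right (by omega : s ≤ s + 1), min_eq_left (by omega : s ≤ s + 1)]
    simp
  · rw [min_eq_left (by omega : r + 1 ≤ s), min_eq_left (by omega : r ≤ s + 1),
      Finset.sum_Icc_succ_top (by omega)]
    have : r + (s + 1) - (r + 1) = s := by omega
    rw [this, Nat.add_sub_cancel]
    abel

/-- The reflection `a ↦ r + s + 1 - a` preserves the range and exchanges `a - 1` with `r + s - a`,
so the summand is antisymmetric. Hence the upper limit `min r s` of the defining relation may be
replaced by `s`. -/
theorem sum_comm_eq_zero_of_le (g : ℕ → ℕ → S) (r s : ℕ) :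
    ∑ a ∈ Finset.Icc (r + 1) s, (g (a - 1) (r + s - a) - g (r + s - a) (a - 1)) = 0 := by
  rw [Finset.sum_sub_distrib, sub_eq_zero]
  refine Finset.sum_bij' (fun a _ => r + s + 1 - a) (fun a _ => r + s + 1 - a) ?_ ?_ ?_ ?_ ?_
  · intro a ha; simp only [Finset.mem_Icc] at ha ⊢; omega
  · intro a ha; simp only [Finset.mem_Icc] at ha ⊢; omega
  · intro a ha; simp only [Finset.mem_Icc] at ha; omega
  · intro a ha; simp only [Finset.mem_Icc] at ha; omega
  · intro a ha
    simp only [Finset.mem_Icc] at ha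
    congr 1 <;> omega

/-- Telescoping in `s` down to `t^(0)`, which is a scalar and commutes with everything; the
reflection then trims the sum to `min r s`. -/
theorem StepRel.presented {p : ℕ} {t : Fin 2 → Fin 2 → ℕ → S} (hp : IsLevel p t)
    (h : StepRel t) : Presented t := by
  have key : ∀ (i j c d : Fin 2) (s r : ℕ), t i j r * t c d s - t c d s * t i j r =
      ∑ a ∈ Finset.Icc 1 s,
        (t c j (a - 1) * t i d (r + s - a) - t c j (r + s - a) * t i d (a - 1)) := by
    intro i j c d s
    induction s with
    | zero =>
      intro r
      rw [hp.zero c d]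
      by_cases hcd : c = d <;> simp [hcd]
    | succ s ih =>
      intro r
      have h1 := h i j c d r s
      rw [ih (r + 1)] at h1
      rw [Finset.sum_Icc_succ_top (by omega)]
      have e1 : r + 1 + s = r + (s + 1) := by ring
      have e2 : r + (s + 1) - (s + 1) = r := by omega
      rw [e1] at h1
      rw [e2, Nat.add_sub_cancel, ← sub_eq_zero]
      rw [← sub_eq_zero] at h1
      rw [← neg_eq_zero, ← h1]
      abel
  intro i j c d r s
  rw [key]
  rcases le_total s r with hsr | hrs
  · rw [min_eq_right hsr]
  · rw [min_eq_left hrs]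
    have e : Finset.Icc 1 s = Finset.Icc 1 r ∪ Finset.Icc (r + 1) s := by
      ext a; simp only [Finset.mem_Icc, Finset.mem_union]; omega
    rw [e, Finset.sum_union, sum_comm_eq_zero_of_le (fun x y => t c j x * t i d y) r s, add_zero]
    rw [Finset.disjoint_left]
    intro a ha hb
    simp only [Finset.mem_Icc] at ha hb
    omega

theorem ev_mul_ev (p : ℕ) (x y : ℕ → S) (u v : k) :
    ev p x u * ev p y v = ev p (fun r => ev p (fun s => x r * y s) v) u := by
  simp only [ev, Finset.sum_mul_sum, Finset.smul_sum]
  refine Finset.sum_congr rfl fun r _ => Finset.sum_congr rfl fun s _ => ?_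
  rw [smul_mul_smul_comm, mul_smul]

theorem ev_mul_ev' (p : ℕ) (x y : ℕ → S) (u v : k) :
    ev p y v * ev p x u = ev p (fun r => ev p (fun s => y s * x r) v) u := by
  simp only [ev, Finset.sum_mul_sum, Finset.smul_sum]
  rw [Finset.sum_comm]
  refine Finset.sum_congr rfl fun r _ => Finset.sum_congr rfl fun s _ => ?_
  rw [smul_mul_smul_comm, ← mul_smul, mul_comm]

/-- Raising `r` is multiplication by `u` and raising `s` is multiplication by `v`; the lost leading
terms are scalars and disappear from the commutators. -/
theorem step_ev {p : ℕ} {t : Fin 2 → Fin 2 → ℕ → S} (hp : IsLevel p t) (i j c d : Fin 2)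
    (u v : k) :
    ev p (fun r => ev p (fun s => (t i j (r + 1) * t c d s - t c d s * t i j (r + 1)) -
      (t i j r * t c d (s + 1) - t c d (s + 1) * t i j r)) v) u =
    (u - v) • (ev p (t i j) u * ev p (t c d) v - ev p (t c d) v * ev p (t i j) u) := by
  simp only [ev_sub, ← ev_mul_ev, ← ev_mul_ev']
  rw [ev_succ (hp.high _ _ _ (Nat.lt_succ_self p)),
    ev_succ (hp.high _ _ _ (Nat.lt_succ_self p)), hp.zero, hp.zero]
  have e1 : ∀ (w : k) (a b : Fin 2) (x : S), (w • (if a = b then (1 : S) else 0)) * x =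
      x * (w • (if a = b then (1 : S) else 0)) := by
    intro w a b x
    split_ifs <;> simp
  simp only [sub_mul, mul_sub, e1, smul_mul_assoc, mul_smul_comm, sub_smul, smul_sub]
  abel

theorem StepRel.rtt {p : ℕ} {t : Fin 2 → Fin 2 → ℕ → S} (hp : IsLevel p t)
    (h : StepRel t) : RTT k p t := by
  intro i j c d u v
  rw [← step_ev hp, ev_mul_ev, ev_mul_ev', ← ev_sub]
  refine congrArg (fun x : ℕ → S => ev p x u) (funext fun r => ?_)
  rw [← ev_sub]
  exact congrArg (fun x : ℕ → S => ev p x v) (funext fun s => h i j c d r s)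

theorem RTTAt.stepRelAt [Infinite k] {p : ℕ} {t : Fin 2 → Fin 2 → ℕ → S} (hp : IsLevel p t)
    {i j c d : Fin 2} (h : RTTAt k p t i j c d) : StepRelAt t i j c d := by
  intro r s
  by_cases hr : p < r
  · simp [hp.high _ _ r hr, hp.high _ _ (r + 1) (by omega)]
  by_cases hs : p < s
  · simp [hp.high _ _ s hs, hp.high _ _ (s + 1) (by omega)]
  push Not at hr hs
  rw [← sub_eq_zero]
  refine ev_coeff_eq_zero (k := k) (p := p) (x := fun s =>
    t i j (r + 1) * t c d s - t c d s * t i j (r + 1) -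
      (t i j r * t c d (s + 1) - t c d (s + 1) * t i j r) -
    (t c j r * t i d s - t c j s * t i d r)) (fun v => ?_) hs
  refine ev_coeff_eq_zero (k := k) (p := p) (x := fun r => ev p (fun s =>
    t i j (r + 1) * t c d s - t c d s * t i j (r + 1) -
      (t i j r * t c d (s + 1) - t c d (s + 1) * t i j r) -
    (t c j r * t i d s - t c j s * t i d r)) v) (fun u => ?_) hr
  have h1 := h u v
  rw [← step_ev hp, ev_mul_ev, ev_mul_ev', ← ev_sub] at h1
  simp only [ev_sub] at h1 ⊢
  rw [h1, sub_self]

theorem RTT.stepRel [Infinite k] {p : ℕ} {t : Fin 2 → Fin 2 → ℕ → S} (hp : IsLevel p t)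
    (h : RTT k p t) : StepRel t :=
  fun i j c d => (h i j c d).stepRelAt hp

end RTTSection

end Yangian

/-! ## Consequences of the defining relations: the adjoint action and the quantum determinant -/

namespace Yangian

section QDet
variable {k S : Type*} [Field k] [Ring S] [Algebra k S]

/-- The quantum determinant, as a function on the ground field. -/
def qD (p : ℕ) (t : Fin 2 → Fin 2 → ℕ → S) (u : k) : S :=
  ev p (t 0 0) u * ev p (t 1 1) (u - 1) - ev p (t 1 0) u * ev p (t 0 1) (u - 1)

variable {p : ℕ} {t : Fin 2 → Fin 2 → ℕ → S}

-- The case `r = 0` of the step relation: the elements `t_ij^(1)` act as `𝔤𝔩₂` does by the adjoint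
-- action.
omit [Algebra k S] in
theorem StepRelAt.ad_one_coeff (hp : IsLevel p t) {i j c d : Fin 2} (h : StepRelAt t i j c d)
    (s : ℕ) : t i j 1 * t c d s - t c d s * t i j 1 =
      (if c = j then t i d s else 0) - (if i = d then t c j s else 0) := by
  have h1 := h 0 s
  rw [hp.zero i j, hp.zero c j, hp.zero i d] at h1
  have e : (if i = j then (1 : S) else 0) * t c d (s + 1) -
      t c d (s + 1) * (if i = j then (1 : S) else 0) = 0 := by split_ifs <;> simp
  rw [e, sub_zero, zero_add] at h1
  rw [h1]
  split_ifs <;> simp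

theorem StepRelAt.ad_one (hp : IsLevel p t) {i j c d : Fin 2} (h : StepRelAt t i j c d) (v : k) :
    t i j 1 * ev p (t c d) v - ev p (t c d) v * t i j 1 =
      (if c = j then ev p (t i d) v else 0) - (if i = d then ev p (t c j) v else 0) := by
  rw [← ev_mul_left, ← ev_mul_right, ← ev_sub]
  simp only [h.ad_one_coeff hp]
  rw [ev_sub]
  split_ifs <;> simp [ev]

/-- At `v = u - 1` the factor `u - v` is `1`, and the relation between `T₂₁` and `T₁₂` exchanges the
two expressions. This form has `T₂₂(u)` on the right instead of `T₂₂(u - 1)`, so it can be evaluated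
at the other family of nodes. -/
theorem RTTAt.qD_eq (h : RTTAt k p t 1 0 0 1) (u : k) :
    qD p t u = ev p (t 0 0) (u - 1) * ev p (t 1 1) u - ev p (t 0 1) (u - 1) * ev p (t 1 0) u := by
  have h1 := h u (u - 1)
  rw [sub_sub_cancel, one_smul] at h1
  rw [qD]
  linear_combination (norm := abel) -h1

/-- `ad t₂₁^(1)` is a derivation with known values on the four factors; what remains is the RTT
relation of `T₂₁` and `T₁₁` at `(u, u - 1)`. -/
theorem RTT.qD_commute_lower (hp : IsLevel p t) (hs : StepRel t) (h : RTT k p t) (u : k) :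
    qD p t u * t 1 0 1 = t 1 0 1 * qD p t u := by
  have hA := (hs 1 0 0 0).ad_one hp u
  have hN := (hs 1 0 1 1).ad_one hp (u - 1)
  have hB := (hs 1 0 0 1).ad_one hp (u - 1)
  have hC := (hs 1 0 1 0).ad_one hp u
  have hCA := h 1 0 0 0 u (u - 1)
  simp only [sub_sub_cancel, one_smul, Fin.isValue, one_ne_zero, if_true, if_false,
    sub_zero, zero_sub] at hA hN hB hC hCA
  have h1 := congrArg (fun x => x * ev p (t 1 1) (u - 1)) hA
  have h2 := congrArg (fun x => ev p (t 0 0) u * x) hN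
  have h3 := congrArg (fun x => x * ev p (t 0 1) (u - 1)) hC
  have h4 := congrArg (fun x => ev p (t 1 0) u * x) hB
  rw [qD]
  simp only [sub_mul, mul_sub, mul_assoc, zero_mul, mul_neg] at *
  linear_combination (norm := abel) -h1 - h2 + h3 + h4 - hCA

theorem RTT.qD_commute_upper (hp : IsLevel p t) (hs : StepRel t) (h : RTT k p t) (u : k) :
    qD p t u * t 0 1 1 = t 0 1 1 * qD p t u := by
  have hA := (hs 0 1 0 0).ad_one hp u
  have hN := (hs 0 1 1 1).ad_one hp (u - 1)
  have hB := (hs 0 1 0 1).ad_one hp (u - 1)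
  have hC := (hs 0 1 1 0).ad_one hp u
  have hNB := h 1 1 0 1 u (u - 1)
  simp only [sub_sub_cancel, one_smul, Fin.isValue, zero_ne_one, if_true, if_false,
    sub_zero, zero_sub] at hA hN hB hC hNB
  have h1 := congrArg (fun x => x * ev p (t 1 1) (u - 1)) hA
  have h2 := congrArg (fun x => ev p (t 0 0) u * x) hN
  have h3 := congrArg (fun x => x * ev p (t 0 1) (u - 1)) hC
  have h4 := congrArg (fun x => ev p (t 1 0) u * x) hB
  rw [qD]
  simp only [sub_mul, mul_sub, mul_assoc, mul_zero, neg_mul] at *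
  linear_combination (norm := abel) -h1 - h2 + h3 + h4 - hNB

/-- For equal index pairs the right side of RTT is the commutator itself, so `u - w - 1` times the
commutator is zero. -/
theorem RTT.commute_same [Infinite k] (h : RTT k p t) (i j : Fin 2) (u v : k) :
    ev p (t i j) u * ev p (t i j) v = ev p (t i j) v * ev p (t i j) u := by
  rw [← sub_eq_zero]
  refine (((isPoly_ev p (t i j)).map (LinearMap.mulLeft k (ev p (t i j) u))).sub
    ((isPoly_ev p (t i j)).map (LinearMap.mulRight k (ev p (t i j) u)))).eq_zero_of_ne (u - 1) ?_ v
  intro w hw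
  have h1 := h i j i j u w
  have h2 : (u - w - 1) • (ev p (t i j) u * ev p (t i j) w - ev p (t i j) w * ev p (t i j) u) = 0 := by
    rw [sub_smul, one_smul, h1, sub_self]
  exact (smul_eq_zero.1 h2).resolve_left fun h3 => hw (by linear_combination -h3)

/-- After multiplication by `u - v`, `T₂₂(v)` can be moved through both products by RTT and the
error terms cancel; the point `v = u` is recovered by polynomiality. -/
theorem RTT.qD_commute_diag [Infinite k] (h : RTT k p t) (u v : k) :
    qD p t u * ev p (t 1 1) v = ev p (t 1 1) v * qD p t u := by
  rw [← sub_eq_zero]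
  refine (((isPoly_ev p (t 1 1)).map (LinearMap.mulLeft k (qD p t u))).sub
    ((isPoly_ev p (t 1 1)).map (LinearMap.mulRight k (qD p t u)))).eq_zero_of_ne u ?_ v
  intro v hv
  have h2 : (u - v) • (qD p t u * ev p (t 1 1) v - ev p (t 1 1) v * qD p t u) = 0 := by
    have h1 := congrArg (fun x => x * ev p (t 1 1) (u - 1)) (h 0 0 1 1 u v)
    have h2 := congrArg (fun x => x * ev p (t 0 1) (u - 1)) (h 1 0 1 1 u v)
    have h3 := congrArg (fun x => ev p (t 1 0) u * x) (h 1 1 0 1 v (u - 1))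
    have h4 := congrArg (fun x => ev p (t 1 0) v * x) (h 1 1 0 1 u (u - 1))
    have h5 := congrArg (fun x => ev p (t 0 0) u * x) (h.commute_same 1 1 (u - 1) v)
    rw [qD]
    simp only [sub_mul, mul_sub, mul_assoc, smul_mul_assoc, mul_smul_comm, sub_sub_cancel,
      one_smul] at *
    linear_combination (norm := module) h1 - h2 - h3 + h4 + (u - v) • h5
  exact (smul_eq_zero.1 h2).resolve_left (sub_ne_zero.2 (Ne.symm hv))

theorem IsLevel.isPoly_diag_sub (hp : IsLevel p t) (i : Fin 2) :
    IsPoly p (fun u : k => ev p (t i i) u - u ^ p • (1 : S)) := by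
  simpa [hp.zero] using isPoly_ev_sub (k := k) p (t i i)

theorem IsLevel.isPoly_shift_diag_sub (hl : IsLevel p t) (i : Fin 2) :
    IsPoly p (fun u : k => ev p (t i i) (u - 1) - u ^ p • (1 : S)) := by
  have h1 : IsPoly p (fun u : k => ((X - 1 : k[X]) ^ p - X ^ p).eval u • (1 : S)) := by
    refine isPoly_eval ?_ _
    rcases Nat.eq_zero_or_pos p with rfl | hp
    · simp
    have hd : ((X - 1 : k[X]) ^ p).degree = p := by
      rw [Polynomial.degree_pow, ← C_1, Polynomial.degree_X_sub_C]; simp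
    refine (Polynomial.degree_sub_lt_left (by rw [hd]; simp) ?_ ?_).trans_eq hd
    · rw [← C_1]; exact pow_ne_zero _ (Polynomial.X_sub_C_ne_zero 1)
    · rw [← C_1, ((Polynomial.monic_X_sub_C (1 : k)).pow p).leadingCoeff,
        (Polynomial.monic_X_pow p).leadingCoeff]
  have h2 := (hl.isPoly_diag_sub i).comp_sub_one.add h1
  refine (congrArg (IsPoly p) (funext fun u => ?_)).mp h2
  simp only [Polynomial.eval_sub, Polynomial.eval_pow, Polynomial.eval_X, Polynomial.eval_one]
  module

/-- The quantum determinant is monic of degree `2p`: both diagonal factors are monic, and the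
off-diagonal ones have degree less than `p`. -/
theorem IsLevel.isPoly_qD_sub (hp : IsLevel p t) :
    IsPoly (2 * p) (fun u : k => qD p t u - u ^ (2 * p) • (1 : S)) := by
  have hC : IsPoly p (ev (k := k) p (t 1 0)) := isPoly_ev_of_zero (by simp [hp.zero])
  have hB : IsPoly p (ev (k := k) p (t 0 1)) := isPoly_ev_of_zero (by simp [hp.zero])
  -- With `A` and `N` the diagonal factors minus `u ^ p`, their product minus `u ^ (2p)` is `A N + u
  -- ^ p A + u ^ p N`.
  have h1 := ((((hp.isPoly_diag_sub 0).mul (hp.isPoly_shift_diag_sub 1)).add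
    ((hp.isPoly_diag_sub 0).pow_smul p)).add
    ((hp.isPoly_shift_diag_sub 1).pow_smul p)).sub (hC.mul hB.comp_sub_one)
  rw [← two_mul] at h1
  refine (congrArg (IsPoly (2 * p)) (funext fun u => ?_)).mp h1
  rw [qD, two_mul, pow_add, mul_smul]
  simp only [mul_sub, sub_mul, mul_smul_comm, smul_mul_assoc, mul_one, one_mul, smul_sub]
  abel

end QDet

end Yangian

/-! ## A reduced set of relations -/

namespace Yangian

section Reduced
variable {k S : Type*} [Field k] [Ring S] [Algebra k S]

theorem commutator_mul {x P Q P' Q' : S} (hP : x * P - P * x = P') (hQ : x * Q - Q * x = Q') :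
    x * (P * Q) - P * Q * x = P' * Q + P * Q' := by
  rw [← hP, ← hQ]; noncomm_ring

/-- The derivation `ad x` applied to a quadratic relation yields another one; this is how relations
containing `T₁₁` are produced from relations without it. -/
theorem commutator_relation {w : k} {x P Q R T U V P' Q' R' T' U' V' : S}
    (hE : w • (P * Q - Q * P) = R * T - U * V)
    (hP : x * P - P * x = P') (hQ : x * Q - Q * x = Q') (hR : x * R - R * x = R')
    (hT : x * T - T * x = T') (hU : x * U - U * x = U') (hV : x * V - V * x = V') :
    w • ((P' * Q + P * Q') - (Q' * P + Q * P')) = (R' * T + R * T') - (U' * V + U * V') := by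
  rw [← commutator_mul hP hQ, ← commutator_mul hQ hP, ← commutator_mul hR hT,
    ← commutator_mul hU hV]
  have h1 := congrArg (fun z => x * z - z * x) hE
  simp only [mul_smul_comm, smul_mul_assoc, mul_sub, sub_mul, ← smul_sub] at h1 ⊢
  linear_combination (norm := module) h1

/-- Relations for `t₁₂`, `t₂₁` and `t₂₂`, with `t₁₁` given by a commutator, from which the defining
relations of the Yangian follow. -/
structure ReducedRel (k : Type*) {S : Type*} [Field k] [Ring S] [Algebra k S] (p : ℕ)
    (t : Fin 2 → Fin 2 → ℕ → S) : Prop where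
  level : IsLevel p t
  nn : ∀ u v : k, ev p (t 1 1) u * ev p (t 1 1) v = ev p (t 1 1) v * ev p (t 1 1) u
  bb : ∀ u v : k, ev p (t 0 1) u * ev p (t 0 1) v = ev p (t 0 1) v * ev p (t 0 1) u
  cc : ∀ u v : k, ev p (t 1 0) u * ev p (t 1 0) v = ev p (t 1 0) v * ev p (t 1 0) u
  nb : RTTAt k p t 1 1 0 1
  bn : RTTAt k p t 0 1 1 1
  nc : RTTAt k p t 1 1 1 0
  cn : RTTAt k p t 1 0 1 1
  cb : RTTAt k p t 1 0 0 1
  lower_upper : ∀ v : k, t 1 0 1 * ev p (t 0 1) v - ev p (t 0 1) v * t 1 0 1 =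
    ev p (t 1 1) v - ev p (t 0 0) v
  upper_lower : ∀ v : k, t 0 1 1 * ev p (t 1 0) v - ev p (t 1 0) v * t 0 1 1 =
    ev p (t 0 0) v - ev p (t 1 1) v
  lower_a : ∀ v : k, t 1 0 1 * ev p (t 0 0) v - ev p (t 0 0) v * t 1 0 1 = ev p (t 1 0) v
  upper_a : ∀ v : k, t 0 1 1 * ev p (t 0 0) v - ev p (t 0 0) v * t 0 1 1 = - ev p (t 0 1) v

variable {p : ℕ} {t : Fin 2 → Fin 2 → ℕ → S}

theorem RTTAt.of_commute {i j : Fin 2}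
    (h : ∀ u v : k, ev p (t i j) u * ev p (t i j) v = ev p (t i j) v * ev p (t i j) u) :
    RTTAt k p t i j i j := by
  intro u v
  rw [h u v]; simp

namespace ReducedRel
variable [Infinite k] (h : ReducedRel k p t)
include h

theorem lower_n (v : k) : t 1 0 1 * ev p (t 1 1) v - ev p (t 1 1) v * t 1 0 1 = - ev p (t 1 0) v := by
  simpa using (h.cn.stepRelAt h.level).ad_one h.level v

theorem upper_n (v : k) : t 0 1 1 * ev p (t 1 1) v - ev p (t 1 1) v * t 0 1 1 = ev p (t 0 1) v := by
  simpa using (h.bn.stepRelAt h.level).ad_one h.level v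

theorem lower_c (v : k) : t 1 0 1 * ev p (t 1 0) v - ev p (t 1 0) v * t 1 0 1 = 0 := by
  simpa using ((RTTAt.of_commute h.cc).stepRelAt h.level).ad_one h.level v

theorem upper_b (v : k) : t 0 1 1 * ev p (t 0 1) v - ev p (t 0 1) v * t 0 1 1 = 0 := by
  simpa using ((RTTAt.of_commute h.bb).stepRelAt h.level).ad_one h.level v

/-- Apply `ad t₂₁^(1)` to `nb`: it sends `T₁₂` to `T₂₂ - T₁₁`, which introduces `T₁₁`, and the terms
left over are `cb` and the commutativity of `T₂₂`. -/
theorem na : RTTAt k p t 1 1 0 0 := by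
  intro u v
  have h1 := commutator_relation (h.nb u v) (h.lower_n u) (h.lower_upper v) (h.lower_upper u)
    (h.lower_n v) (h.lower_upper v) (h.lower_n u)
  have h2 := h.cb u v
  have h3 := h.nn u v
  simp only [mul_sub, sub_mul, mul_neg, neg_mul] at h1 ⊢
  linear_combination (norm := module) -h1 - h2 + (u - v) • h3 - h3

-- Both `u - v` and the right side of `cb` change sign when `u` and `v` are exchanged.
omit [Infinite k] in
theorem swap_cb (u v : k) :
    ev p (t 1 0) u * ev p (t 0 1) v - ev p (t 0 1) v * ev p (t 1 0) u =
      ev p (t 1 0) v * ev p (t 0 1) u - ev p (t 0 1) u * ev p (t 1 0) v := by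
  by_cases huv : u = v
  · rw [huv]
  have h1 := h.cb u v
  have h2 := h.cb v u
  refine smul_right_injective S (sub_ne_zero.2 huv) ?_
  linear_combination (norm := module) h1 + h2

theorem swap_na (u v : k) :
    ev p (t 1 1) u * ev p (t 0 0) v - ev p (t 0 0) v * ev p (t 1 1) u =
      ev p (t 1 1) v * ev p (t 0 0) u - ev p (t 0 0) u * ev p (t 1 1) v := by
  by_cases huv : u = v
  · rw [huv]
  have h1 := h.na u v
  have h2 := h.na v u
  refine smul_right_injective S (sub_ne_zero.2 huv) ?_
  linear_combination (norm := module) h1 + h2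

theorem an : RTTAt k p t 0 0 1 1 := by
  intro u v
  have h1 := commutator_relation (h.bn u v) (h.lower_upper u) (h.lower_n v) (h.lower_n u)
    (h.lower_upper v) (h.lower_n v) (h.lower_upper u)
  have h2 := h.cb v u
  have h3 := h.nn u v
  have h4 := h.swap_na u v
  simp only [mul_sub, sub_mul, mul_neg, neg_mul] at h1 ⊢
  linear_combination (norm := module) -h1 - h2 + (u - v) • h3 - h3 + h4

theorem bc : RTTAt k p t 0 1 1 0 := by
  intro u v
  have h1 := h.cb u v
  have h2 := h.swap_cb u v
  have h3 := h.swap_na u v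
  linear_combination (norm := module) -h1 + (u - v) • h2 - h3

theorem ab : RTTAt k p t 0 0 0 1 := by
  intro u v
  have h1 := commutator_relation (h.an u v) (h.upper_a u) (h.upper_n v) (h.upper_lower u)
    (h.upper_b v) (h.upper_lower v) (h.upper_b u)
  have h2 := h.bn u v
  simp only [sub_mul, mul_neg, neg_mul, mul_zero] at h1 ⊢
  linear_combination (norm := module) h1 + h2

theorem ba : RTTAt k p t 0 1 0 0 := by
  intro u v
  have h1 := commutator_relation (h.na u v) (h.upper_n u) (h.upper_a v) (h.upper_b u)
    (h.upper_lower v) (h.upper_b v) (h.upper_lower u)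
  have h2 := h.nb u v
  simp only [mul_sub, mul_neg, neg_mul, zero_mul] at h1 ⊢
  linear_combination (norm := module) h1 + h2

theorem ac : RTTAt k p t 0 0 1 0 := by
  intro u v
  have h1 := commutator_relation (h.an u v) (h.lower_a u) (h.lower_n v) (h.lower_c u)
    (h.lower_upper v) (h.lower_c v) (h.lower_upper u)
  have h2 := h.cn u v
  simp only [mul_sub, mul_neg, neg_mul, zero_mul] at h1 ⊢
  linear_combination (norm := module) -h1 + h2

theorem ca : RTTAt k p t 1 0 0 0 := by
  intro u v
  have h1 := commutator_relation (h.na u v) (h.lower_n u) (h.lower_a v) (h.lower_upper u)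
    (h.lower_c v) (h.lower_upper v) (h.lower_c u)
  have h2 := h.nc u v
  simp only [sub_mul, mul_neg, neg_mul, mul_zero] at h1 ⊢
  linear_combination (norm := module) -h1 + h2

theorem aa : RTTAt k p t 0 0 0 0 := by
  intro u v
  have h1 := commutator_relation (h.ab u v) (h.lower_a u) (h.lower_upper v) (h.lower_a u)
    (h.lower_upper v) (h.lower_a v) (h.lower_upper u)
  have h2 := h.cb u v
  have h3 := h.an u v
  simp only [mul_sub, sub_mul] at h1 ⊢
  linear_combination (norm := module) -h1 + h2 + h3

theorem rtt : RTT k p t := by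
  intro i j c d
  fin_cases i <;> fin_cases j <;> fin_cases c <;> fin_cases d
  exacts [h.aa, h.ab, h.ac, h.an, h.ba, RTTAt.of_commute h.bb, h.bc, h.bn, h.ca, h.cb,
    RTTAt.of_commute h.cc, h.cn, h.na, h.nb, h.nc, RTTAt.of_commute h.nn]

end ReducedRel

end Reduced

end Yangian

/-! ## Gelfand–Tsetlin data define representations of the Yangian -/

namespace Yangian

section Datum
variable {k : Type*} [Field k] {p : ℕ}

/-- The parameters `β_i + a_i` of the weight `a`. -/
def shift (β : Fin p → k) (a : Fin p → ℤ) (i : Fin p) : k := β i + (a i : k)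

/-- The eigenvalue of `T₂₂(u)` for the weight `a`. -/
def eig (β : Fin p → k) (a : Fin p → ℤ) (u : k) : k := ∏ i, (u + shift β a i)

/-- The Lagrange basis polynomial that is `1` at `-β_i - a_i` and `0` at the other `-β_j - a_j`. -/
def lag (β : Fin p → k) (a : Fin p → ℤ) (i : Fin p) : k[X] :=
  Lagrange.basis Finset.univ (fun j => - shift β a j) i

/-- The parameter `β` is generic: the differences of its entries are not integers. -/
def Generic (β : Fin p → k) : Prop := ∀ i j : Fin p, i ≠ j → ∀ m : ℤ, β i - β j ≠ (m : k)

variable {β : Fin p → k}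

theorem shift_add_single (a : Fin p → ℤ) (i j : Fin p) (m : ℤ) :
    shift β (a + Pi.single i m) j = shift β a j + if j = i then (m : k) else 0 := by
  by_cases h : j = i
  · subst h; simp [shift, add_assoc]
  · simp [shift, h]

theorem shift_add_single_of_ne (a : Fin p → ℤ) {i j : Fin p} (h : j ≠ i) (m : ℤ) :
    shift β (a + Pi.single i m) j = shift β a j := by
  simp [shift_add_single, h]

theorem shift_sub_single_of_ne (a : Fin p → ℤ) {i j : Fin p} (h : j ≠ i) (m : ℤ) :
    shift β (a - Pi.single i m) j = shift β a j := by
  simp [shift, h]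

theorem Generic.injective (hβ : Generic β) (a : Fin p → ℤ) :
    Function.Injective (fun i => - shift β a i) := by
  intro i j hij
  by_contra hne
  refine hβ i j hne (a j - a i) ?_
  simp only [shift, neg_inj] at hij
  push_cast
  linear_combination hij

/-- These `2p` points are where the quantum determinant, of degree `2p`, is compared with `γ(u)`. -/
theorem Generic.injective_sum [CharZero k] (hβ : Generic β) (a : Fin p → ℤ) :
    Function.Injective (Sum.elim (fun i => - shift β a i) (fun i => - shift β a i + 1)) := by
  have key : ∀ i j, - shift β a i ≠ - shift β a j + 1 := by
    intro i j h
    by_cases hij : i = j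
    · subst hij
      exact one_ne_zero (α := k) (by linear_combination -h)
    · refine hβ i j hij (a j - a i - 1) ?_
      simp only [shift] at h
      push_cast
      linear_combination -h
  rintro (i | i) (j | j) h
  · exact congrArg _ (hβ.injective a h)
  · exact (key i j h).elim
  · exact (key j i h.symm).elim
  · exact congrArg _ (hβ.injective a (add_right_cancel h))

theorem eig_node (a : Fin p → ℤ) (i : Fin p) : eig β a (- shift β a i) = 0 :=
  Finset.prod_eq_zero (Finset.mem_univ i) (by simp)

theorem eig_eq (a : Fin p → ℤ) (i : Fin p) (u : k) :
    eig β a u = (u + shift β a i) * ∏ j ∈ Finset.univ.erase i, (u + shift β a j) :=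
  (Finset.mul_prod_erase _ _ (Finset.mem_univ i)).symm

theorem eig_add_single (a : Fin p → ℤ) (i : Fin p) (m : ℤ) (u : k) :
    eig β (a + Pi.single i m) u =
      (u + shift β a i + m) * ∏ j ∈ Finset.univ.erase i, (u + shift β a j) := by
  rw [eig_eq _ i, shift_add_single, if_pos rfl, ← add_assoc]
  congr 1
  refine Finset.prod_congr rfl fun j hj => ?_
  rw [shift_add_single_of_ne _ (Finset.ne_of_mem_erase hj)]

theorem eig_sub_single (a : Fin p → ℤ) (i : Fin p) (u : k) :
    eig β (a - Pi.single i 1) u =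
      (u + shift β a i - 1) * ∏ j ∈ Finset.univ.erase i, (u + shift β a j) := by
  have := eig_add_single (β := β) a i (-1) u
  rw [Pi.single_neg, ← sub_eq_add_neg] at this
  rw [this]; push_cast; ring

/-- Up to a constant the Lagrange polynomial is the eigenvalue of `T₂₂` with its `i`-th factor
removed. A shift by `δ_i` alters only that factor, so the relations with `T₂₂` become scalar
identities. -/
theorem eval_lag (a : Fin p → ℤ) (i : Fin p) :
    ∃ c : k, ∀ u, (lag β a i).eval u = c * ∏ j ∈ Finset.univ.erase i, (u + shift β a j) := by
  refine ⟨∏ j ∈ Finset.univ.erase i, (- shift β a i - - shift β a j)⁻¹, fun u => ?_⟩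
  rw [lag, Lagrange.basis, Polynomial.eval_prod, ← Finset.prod_mul_distrib]
  refine Finset.prod_congr rfl fun j _ => ?_
  simp [Lagrange.basisDivisor]

theorem eval_lag_node (hβ : Generic β) (a : Fin p → ℤ) (i j : Fin p) :
    (lag β a i).eval (- shift β a j) = if i = j then 1 else 0 := by
  split_ifs with h
  · subst h
    exact Lagrange.eval_basis_self ((hβ.injective a).injOn) (Finset.mem_univ _)
  · exact Lagrange.eval_basis_of_ne (v := fun j => - shift β a j) h (Finset.mem_univ j)

theorem degree_lag_lt (hβ : Generic β) (a : Fin p → ℤ) (i : Fin p) : (lag β a i).degree < p := by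
  have h : (lag β a i).degree = _ :=
    Lagrange.degree_basis ((hβ.injective a).injOn) (Finset.mem_univ i)
  rw [h]
  have := i.pos
  simp only [Finset.card_univ, Fintype.card_fin]
  exact_mod_cast Nat.sub_lt this one_pos

theorem eq_sum_lag {M : Type*} [AddCommGroup M] [Module k M] (hβ : Generic β) (a : Fin p → ℤ)
    {F : k → M} (hF : IsPoly p F) (u : k) :
    F u = ∑ i, (lag β a i).eval u • F (- shift β a i) := by
  rw [← sub_eq_zero]
  refine (hF.sub (IsPoly.sum Finset.univ fun i _ =>
    isPoly_eval (degree_lag_lt hβ a i) (F (- shift β a i)))).eq_zero_of_nodes (by simp)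
    (hβ.injective a) (fun j => ?_) u
  simp [eval_lag_node hβ]

/-- Vieta's formula, which turns the parameters `σ_r(β)` and `σ_i(γ)` into products of linear
factors. -/
theorem ev_esymm_map {n : ℕ} (s : Fin n → k) (u : k) :
    ev n (fun r => (Finset.univ.val.map s).esymm r) u = ∏ i, (u + s i) := by
  have h := Multiset.prod_X_add_C_eq_sum_esymm (Finset.univ.val.map s)
  have h' := congrArg (Polynomial.eval u) h
  simp only [Multiset.map_map, Multiset.card_map, Finset.card_val, Finset.card_univ,
    Fintype.card_fin, Polynomial.eval_finsetSum] at h'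
  rw [ev]
  have e : ((Finset.univ.val : Multiset (Fin n)).map
      ((fun r => X + C r) ∘ s)).prod = ∏ i, (X + C (s i)) := rfl
  rw [e, Polynomial.eval_prod] at h'
  simp only [Polynomial.eval_add, Polynomial.eval_X, Polynomial.eval_C, Polynomial.eval_mul,
    Polynomial.eval_pow] at h'
  rw [h']
  exact Finset.sum_congr rfl fun r _ => by rw [smul_eq_mul, mul_comm]

theorem ev_esymm (a : Fin p → ℤ) (u : k) :
    ev p (fun r => (Finset.univ.val.map (shift β a)).esymm r) u = eig β a u :=
  ev_esymm_map _ u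

/-- A graded vector space with operators satisfying the relations of `K_ℓ`. -/
structure Datum (β : Fin p → k) (γ : Fin (2 * p) → k) (V : Type*) [AddCommGroup V] [Module k V] where
  wt : (Fin p → ℤ) → Submodule k V
  span : ⨆ a, wt a = ⊤
  -- Part of the data because the `wt a` are only required to span: it makes weight-dependent
  -- scalars into operators on all of `V`.
  diag : ((Fin p → ℤ) → k) → V →ₗ[k] V
  diag_apply : ∀ φ a w, w ∈ wt a → diag φ w = φ a • w
  f : Fin p → V →ₗ[k] V
  e : Fin p → V →ₗ[k] V
  f_mem : ∀ i a w, w ∈ wt a → f i w ∈ wt (a + Pi.single i 1)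
  e_mem : ∀ i a w, w ∈ wt a → e i w ∈ wt (a - Pi.single i 1)
  ff : ∀ i j a w, w ∈ wt a → f i (f j w) = f j (f i w)
  ee : ∀ i j a w, w ∈ wt a → e i (e j w) = e j (e i w)
  ef : ∀ i j a w, w ∈ wt a → i ≠ j → e i (f j w) = f j (e i w)
  ef_same : ∀ i a w, w ∈ wt a → e i (f i w) = (-gam γ (-β i - (a i : k))) • w
  fe_same : ∀ i a w, w ∈ wt a → f i (e i w) = (-gam γ (-β i - (a i : k) + 1)) • w

/-! ### Operators obtained from a datum by Lagrange interpolation, and their relations -/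

namespace Datum
variable {γ : Fin (2 * p) → k} {V : Type*} [AddCommGroup V] [Module k V] (D : Datum β γ V)

/-- The operator `t₂₂^(r)`. -/
def n (r : ℕ) : Module.End k V := D.diag fun a => (Finset.univ.val.map (shift β a)).esymm r

/-- The operator `t₂₁^(r)`. -/
def c (r : ℕ) : Module.End k V :=
  -- For `r > p` the subtraction `p - r` truncates to `0`, so these indices must be excluded
  -- explicitly.
  if r = 0 ∨ p < r then 0 else ∑ i, D.f i ∘ₗ D.diag fun a => (lag β a i).coeff (p - r)

/-- The operator `t₁₂^(r)`. -/
def b (r : ℕ) : Module.End k V :=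
  if r = 0 ∨ p < r then 0 else ∑ i, D.e i ∘ₗ D.diag fun a => (lag β a i).coeff (p - r)

/-- The operators `t_ij^(r)`. -/
def t (i j : Fin 2) (r : ℕ) : Module.End k V :=
  -- `T₁₁` is forced by the relation between `t₂₁^(1)` and `T₁₂`, namely `[t₂₁^(1), T₁₂(u)] = T₂₂(u)
  -- - T₁₁(u)`.
  if i = 0 then if j = 0 then D.n r - (D.c 1 * D.b r - D.b r * D.c 1) else D.b r
  else if j = 0 then D.c r else D.n r

@[simp] theorem t_zero_zero : D.t 0 0 = fun r => D.n r - (D.c 1 * D.b r - D.b r * D.c 1) := rfl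
@[simp] theorem t_zero_one : D.t 0 1 = D.b := rfl
@[simp] theorem t_one_zero : D.t 1 0 = D.c := rfl
@[simp] theorem t_one_one : D.t 1 1 = D.n := rfl

include D in
theorem hom_ext {W : Type*} [AddCommGroup W] [Module k W] {φ ψ : V →ₗ[k] W}
    (h : ∀ a, ∀ w ∈ D.wt a, φ w = ψ w) : φ = ψ := by
  refine LinearMap.ext_on (s := ⋃ a, (D.wt a : Set V)) ?_ ?_
  · rw [Submodule.span_iUnion]
    simpa using D.span
  · intro w hw
    obtain ⟨a, ha⟩ := Set.mem_iUnion.1 hw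
    exact h a w ha

theorem b_zero : D.b 0 = 0 := by simp [b]
theorem c_zero : D.c 0 = 0 := by simp [c]
theorem b_high {r : ℕ} (h : p < r) : D.b r = 0 := by simp [b, h]
theorem c_high {r : ℕ} (h : p < r) : D.c r = 0 := by simp [c, h]

theorem n_zero : D.n 0 = 1 := by
  refine D.hom_ext fun a w hw => ?_
  rw [n, D.diag_apply _ a w hw, Multiset.esymm, Multiset.powersetCard_zero_left]
  simp

theorem n_high {r : ℕ} (h : p < r) : D.n r = 0 := by
  refine D.hom_ext fun a w hw => ?_
  rw [n, D.diag_apply _ a w hw, Multiset.esymm, Multiset.powersetCard_eq_empty]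
  · simp
  · simpa using h

theorem isLevel : IsLevel p D.t where
  zero i j := by
    fin_cases i <;> fin_cases j <;> simp [n_zero, b_zero, c_zero]
  high i j r h := by
    fin_cases i <;> fin_cases j <;> simp [D.n_high h, D.b_high h, D.c_high h]

theorem ev_apply (x : ℕ → Module.End k V) (u : k) (w : V) :
    ev p x u w = ev p (fun r => x r w) u :=
  (ev_map p x (LinearMap.applyₗ w) u).symm

theorem ev_n (u : k) {a : Fin p → ℤ} {w : V} (hw : w ∈ D.wt a) :
    ev p D.n u w = eig β a u • w := by
  rw [ev_apply, ← ev_esymm]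
  simp only [n, D.diag_apply _ a w hw]
  exact ev_map p _ (LinearMap.toSpanSingleton k V w) u

theorem ev_lag (hβ : Generic β) (x : Fin p → V) (a : Fin p → ℤ) (u : k) :
    ev p (fun r => if r = 0 ∨ p < r then 0 else ∑ i, (lag β a i).coeff (p - r) • x i) u =
      ∑ i, (lag β a i).eval u • x i := by
  rw [ev_eq_sum_reflect, Finset.sum_range_succ]
  simp only [tsub_self, true_or, if_true, smul_zero, add_zero]
  have : ∀ i, (lag β a i).eval u • x i =
      ∑ r ∈ Finset.range p, u ^ r • (lag β a i).coeff r • x i := by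
    intro i
    have hq : (lag β a i).natDegree < p := by
      rcases eq_or_ne (lag β a i) 0 with h0 | h0
      · simpa [h0] using i.pos
      · exact (Polynomial.natDegree_lt_iff_degree_lt h0).2 (degree_lag_lt hβ a i)
    rw [Polynomial.eval_eq_sum_range' hq, Finset.sum_smul]
    exact Finset.sum_congr rfl fun r _ => by rw [smul_smul, mul_comm]
  simp only [this]
  rw [Finset.sum_comm]
  refine Finset.sum_congr rfl fun r hr => ?_
  have hr := Finset.mem_range.1 hr
  rw [if_neg (by omega), Finset.smul_sum, Nat.sub_sub_self hr.le]

theorem c_apply (r : ℕ) {a : Fin p → ℤ} {w : V} (hw : w ∈ D.wt a) :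
    D.c r w = if r = 0 ∨ p < r then 0 else ∑ i, (lag β a i).coeff (p - r) • D.f i w := by
  rw [c]
  split_ifs
  · rfl
  · simp [D.diag_apply _ a w hw]

theorem b_apply (r : ℕ) {a : Fin p → ℤ} {w : V} (hw : w ∈ D.wt a) :
    D.b r w = if r = 0 ∨ p < r then 0 else ∑ i, (lag β a i).coeff (p - r) • D.e i w := by
  rw [b]
  split_ifs
  · rfl
  · simp [D.diag_apply _ a w hw]

theorem ev_c (hβ : Generic β) (u : k) {a : Fin p → ℤ} {w : V} (hw : w ∈ D.wt a) :
    ev p D.c u w = ∑ i, (lag β a i).eval u • D.f i w := by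
  rw [ev_apply, ← ev_lag hβ]
  simp only [D.c_apply _ hw]

theorem ev_b (hβ : Generic β) (u : k) {a : Fin p → ℤ} {w : V} (hw : w ∈ D.wt a) :
    ev p D.b u w = ∑ i, (lag β a i).eval u • D.e i w := by
  rw [ev_apply, ← ev_lag hβ]
  simp only [D.b_apply _ hw]

/-- At the `i`-th node all Lagrange polynomials but the `i`-th vanish. The value `u` is a separate
variable so that a node of a neighbouring weight can be used when it is numerically the same. -/
theorem ev_c_node (hβ : Generic β) {a : Fin p → ℤ} {w : V} (hw : w ∈ D.wt a) (i : Fin p) {u : k}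
    (hu : u = - shift β a i) : ev p D.c u w = D.f i w := by
  rw [D.ev_c hβ u hw, hu]
  simp [eval_lag_node hβ]

theorem ev_b_node (hβ : Generic β) {a : Fin p → ℤ} {w : V} (hw : w ∈ D.wt a) (i : Fin p) {u : k}
    (hu : u = - shift β a i) : ev p D.b u w = D.e i w := by
  rw [D.ev_b hβ u hw, hu]
  simp [eval_lag_node hβ]

theorem isPoly_c : IsPoly p (ev (k := k) p D.c) := isPoly_ev_of_zero D.c_zero
theorem isPoly_b : IsPoly p (ev (k := k) p D.b) := isPoly_ev_of_zero D.b_zero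

/-- An operator-valued polynomial function of two variables vanishes if it vanishes at the nodes of
each weight space. -/
theorem eq_zero_of_grid (hβ : Generic β) {F : k → k → Module.End k V}
    (h₁ : ∀ v, IsPoly p (fun u => F u v)) (h₂ : ∀ u, IsPoly p (F u))
    (h : ∀ a, ∀ w ∈ D.wt a, ∀ i j, F (- shift β a i) (- shift β a j) w = 0) (u v : k) :
    F u v = 0 := by
  refine D.hom_ext fun a w hw => ?_
  exact Yangian.eq_zero_of_grid (F := fun u v => F u v w)
    (fun v => (h₁ v).map (LinearMap.applyₗ w)) (fun u => (h₂ u).map (LinearMap.applyₗ w))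
    (by simp) (hβ.injective a) (h a w hw) u v

theorem commute_n (u v : k) : ev p D.n u * ev p D.n v = ev p D.n v * ev p D.n u := by
  refine D.hom_ext fun a w hw => ?_
  simp only [Module.End.mul_apply, D.ev_n _ hw, map_smul]
  rw [smul_comm]

/-- It suffices to test pairs of distinct nodes. Adding `δ_j` does not move the `i`-th node for `i ≠
j`, so both compositions are taken at nodes and the claim is `ff`. -/
theorem commute_c (hβ : Generic β) (u v : k) :
    ev p D.c u * ev p D.c v = ev p D.c v * ev p D.c u := by
  rw [← sub_eq_zero]
  refine D.eq_zero_of_grid hβ (F := fun u v => ev p D.c u * ev p D.c v - ev p D.c v * ev p D.c u)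
    (fun v => (D.isPoly_c.mul_const _).sub (D.isPoly_c.const_mul _))
    (fun u => (D.isPoly_c.const_mul _).sub (D.isPoly_c.mul_const _)) ?_ u v
  intro a w hw i j
  by_cases hij : i = j
  · subst hij; simp
  rw [LinearMap.sub_apply, Module.End.mul_apply, Module.End.mul_apply, D.ev_c_node hβ hw j rfl,
    D.ev_c_node hβ hw i rfl, D.ev_c_node hβ (D.f_mem j a w hw) i,
    D.ev_c_node hβ (D.f_mem i a w hw) j, D.ff i j a w hw, sub_self]
  · rw [shift_add_single_of_ne _ (Ne.symm hij)]
  · rw [shift_add_single_of_ne _ hij]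

theorem commute_b (hβ : Generic β) (u v : k) :
    ev p D.b u * ev p D.b v = ev p D.b v * ev p D.b u := by
  rw [← sub_eq_zero]
  refine D.eq_zero_of_grid hβ (F := fun u v => ev p D.b u * ev p D.b v - ev p D.b v * ev p D.b u)
    (fun v => (D.isPoly_b.mul_const _).sub (D.isPoly_b.const_mul _))
    (fun u => (D.isPoly_b.const_mul _).sub (D.isPoly_b.mul_const _)) ?_ u v
  intro a w hw i j
  by_cases hij : i = j
  · subst hij; simp
  rw [LinearMap.sub_apply, Module.End.mul_apply, Module.End.mul_apply, D.ev_b_node hβ hw j rfl,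
    D.ev_b_node hβ hw i rfl, D.ev_b_node hβ (D.e_mem j a w hw) i,
    D.ev_b_node hβ (D.e_mem i a w hw) j, D.ee i j a w hw, sub_self]
  · rw [shift_sub_single_of_ne _ (Ne.symm hij)]
  · rw [shift_sub_single_of_ne _ hij]

theorem n_mul_c (hβ : Generic β) (u v : k) {a : Fin p → ℤ} {w : V} (hw : w ∈ D.wt a) :
    (ev p D.n u * ev p D.c v) w =
      ∑ i, (eig β (a + Pi.single i 1) u * (lag β a i).eval v) • D.f i w := by
  rw [Module.End.mul_apply, D.ev_c hβ v hw, map_sum]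
  refine Finset.sum_congr rfl fun i _ => ?_
  rw [map_smul, D.ev_n u (D.f_mem i a w hw), smul_smul, mul_comm]

theorem c_mul_n (hβ : Generic β) (u v : k) {a : Fin p → ℤ} {w : V} (hw : w ∈ D.wt a) :
    (ev p D.c u * ev p D.n v) w = ∑ i, (eig β a v * (lag β a i).eval u) • D.f i w := by
  rw [Module.End.mul_apply, D.ev_n v hw, map_smul, D.ev_c hβ u hw, Finset.smul_sum]
  simp only [smul_smul]

theorem n_mul_b (hβ : Generic β) (u v : k) {a : Fin p → ℤ} {w : V} (hw : w ∈ D.wt a) :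
    (ev p D.n u * ev p D.b v) w =
      ∑ i, (eig β (a - Pi.single i 1) u * (lag β a i).eval v) • D.e i w := by
  rw [Module.End.mul_apply, D.ev_b hβ v hw, map_sum]
  refine Finset.sum_congr rfl fun i _ => ?_
  rw [map_smul, D.ev_n u (D.e_mem i a w hw), smul_smul, mul_comm]

theorem b_mul_n (hβ : Generic β) (u v : k) {a : Fin p → ℤ} {w : V} (hw : w ∈ D.wt a) :
    (ev p D.b u * ev p D.n v) w = ∑ i, (eig β a v * (lag β a i).eval u) • D.e i w := by
  rw [Module.End.mul_apply, D.ev_n v hw, map_smul, D.ev_b hβ u hw, Finset.smul_sum]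
  simp only [smul_smul]

/-- On each component `f_i w` this is an identity between products of linear factors, all divisible
by `∏_{j ≠ i} (u + β_j + a_j)` and the same product in `v`. -/
theorem nc (hβ : Generic β) : RTTAt k p D.t 1 1 1 0 := by
  intro u v
  refine D.hom_ext fun a w hw => ?_
  simp only [t_one_one, t_one_zero, LinearMap.smul_apply, LinearMap.sub_apply, D.n_mul_c hβ _ _ hw,
    D.c_mul_n hβ _ _ hw, ← Finset.sum_sub_distrib, Finset.smul_sum, ← sub_smul, smul_smul]
  refine Finset.sum_congr rfl fun i _ => congrArg (· • _) ?_
  obtain ⟨c, hc⟩ := eval_lag (β := β) a i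
  rw [hc, hc, eig_add_single, eig_add_single, eig_eq a i]
  push_cast; ring

theorem cn (hβ : Generic β) : RTTAt k p D.t 1 0 1 1 := by
  intro u v
  refine D.hom_ext fun a w hw => ?_
  simp only [t_one_one, t_one_zero, LinearMap.smul_apply, LinearMap.sub_apply, D.n_mul_c hβ _ _ hw,
    D.c_mul_n hβ _ _ hw, ← Finset.sum_sub_distrib, Finset.smul_sum, ← sub_smul, smul_smul]
  refine Finset.sum_congr rfl fun i _ => congrArg (· • _) ?_
  obtain ⟨c, hc⟩ := eval_lag (β := β) a i
  rw [hc, hc, eig_add_single, eig_eq a i, eig_eq a i]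
  push_cast; ring

theorem nb (hβ : Generic β) : RTTAt k p D.t 1 1 0 1 := by
  intro u v
  refine D.hom_ext fun a w hw => ?_
  simp only [t_one_one, t_zero_one, LinearMap.smul_apply, LinearMap.sub_apply, D.n_mul_b hβ _ _ hw,
    D.b_mul_n hβ _ _ hw, ← Finset.sum_sub_distrib, Finset.smul_sum, ← sub_smul, smul_smul]
  refine Finset.sum_congr rfl fun i _ => congrArg (· • _) ?_
  obtain ⟨c, hc⟩ := eval_lag (β := β) a i
  rw [hc, hc, eig_sub_single, eig_eq a i, eig_eq a i]
  ring

theorem bn (hβ : Generic β) : RTTAt k p D.t 0 1 1 1 := by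
  intro u v
  refine D.hom_ext fun a w hw => ?_
  simp only [t_one_one, t_zero_one, LinearMap.smul_apply, LinearMap.sub_apply, D.n_mul_b hβ _ _ hw,
    D.b_mul_n hβ _ _ hw, ← Finset.sum_sub_distrib, Finset.smul_sum, ← sub_smul, smul_smul]
  refine Finset.sum_congr rfl fun i _ => congrArg (· • _) ?_
  obtain ⟨c, hc⟩ := eval_lag (β := β) a i
  rw [hc, hc, eig_sub_single, eig_sub_single, eig_eq a i]
  ring

/-- The commutator of `T₂₁(u)` and `T₁₂(v)`. -/
def h (u v : k) : Module.End k V := ev p D.c u * ev p D.b v - ev p D.b v * ev p D.c u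

theorem isPoly_h_left (v : k) : IsPoly p (fun u => D.h u v) :=
  (D.isPoly_c.mul_const _).sub (D.isPoly_c.const_mul _)

theorem isPoly_h_right (u : k) : IsPoly p (D.h u) :=
  (D.isPoly_b.const_mul _).sub (D.isPoly_b.mul_const _)

theorem h_node (hβ : Generic β) {a : Fin p → ℤ} {w : V} (hw : w ∈ D.wt a) {i j : Fin p}
    (hij : i ≠ j) : D.h (- shift β a i) (- shift β a j) w = 0 := by
  rw [h, LinearMap.sub_apply, Module.End.mul_apply, Module.End.mul_apply, D.ev_b_node hβ hw j rfl,
    D.ev_c_node hβ hw i rfl, D.ev_c_node hβ (D.e_mem j a w hw) i,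
    D.ev_b_node hβ (D.f_mem i a w hw) j, D.ef j i a w hw hij.symm, sub_self]
  · rw [shift_add_single_of_ne _ (Ne.symm hij)]
  · rw [shift_sub_single_of_ne _ hij]

/-- Both sides have degree less than `p` in each variable; at distinct nodes they vanish, and at
equal arguments they agree trivially. -/
theorem h_symm (hβ : Generic β) (u v : k) : D.h u v = D.h v u := by
  rw [← sub_eq_zero]
  refine D.eq_zero_of_grid hβ (F := fun u v => D.h u v - D.h v u)
    (fun v => (D.isPoly_h_left v).sub (D.isPoly_h_right v))
    (fun u => (D.isPoly_h_right u).sub (D.isPoly_h_left u)) ?_ u v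
  intro a w hw i j
  by_cases hij : i = j
  · subst hij; simp
  rw [LinearMap.sub_apply, D.h_node hβ hw hij, D.h_node hβ hw (Ne.symm hij), sub_self]

/-- The coefficient of `u ^ (p - 1)` in the symmetry `h u v = h v u`. -/
theorem lower_eq_upper [Infinite k] (hp : 0 < p) (hβ : Generic β) (v : k) :
    D.c 1 * ev p D.b v - ev p D.b v * D.c 1 = ev p D.c v * D.b 1 - D.b 1 * ev p D.c v := by
  rw [← sub_eq_zero]
  refine ev_coeff_eq_zero (k := k) (p := p) (r := 1) (x := fun r =>
    (D.c r * ev p D.b v - ev p D.b v * D.c r) - (ev p D.c v * D.b r - D.b r * ev p D.c v))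
    (fun u => ?_) hp
  simp only [ev_sub, ev_mul_left, ev_mul_right]
  exact sub_eq_zero.2 (D.h_symm hβ u v)

theorem ev_a (v : k) : ev p (D.t 0 0) v =
    ev p D.n v - (D.c 1 * ev p D.b v - ev p D.b v * D.c 1) := by
  simp only [t_zero_zero, ev_sub, ev_mul_left, ev_mul_right]

/-- The subtracted operator is the coefficient of `u ^ p` in `u • h u v`, so the bound `p` is
restored after the multiplication by `u`. -/
theorem isPoly_smul_h_left (v : k) : IsPoly p (fun u => u • D.h u v -
    u ^ p • (D.c 1 * ev p D.b v - ev p D.b v * D.c 1)) := by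
  have := isPoly_smul_ev_sub (k := k) (p := p)
    (x := fun r => D.c r * ev p D.b v - ev p D.b v * D.c r) (by simp [c_zero])
    (by simp [D.c_high (Nat.lt_succ_self p)])
  simpa only [h, ev_sub, ev_mul_left, ev_mul_right] using this

theorem isPoly_smul_h_right (u : k) : IsPoly p (fun v => v • D.h u v -
    v ^ p • (ev p D.c u * D.b 1 - D.b 1 * ev p D.c u)) := by
  have := isPoly_smul_ev_sub (k := k) (p := p)
    (x := fun r => ev p D.c u * D.b r - D.b r * ev p D.c u) (by simp [b_zero])
    (by simp [D.b_high (Nat.lt_succ_self p)])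
  simpa only [h, ev_sub, ev_mul_left, ev_mul_right] using this

theorem isPoly_n_sub : IsPoly p (fun u : k => ev p D.n u - u ^ p • (1 : Module.End k V)) := by
  simpa [n_zero] using isPoly_ev_sub (k := k) p D.n

/-- `T₂₂` is monic, so the terms in `u ^ p` and in `v ^ p` cancel and the difference has degree less
than `p` in each variable. At nodes `T₂₂` kills the weight vector, and `(u - v) • h u v` vanishes
either by `ef` or by the factor `u - v`. -/
theorem h_eq (hβ : Generic β) (u v : k) : (u - v) • D.h u v =
    (D.c 1 * ev p D.b v - ev p D.b v * D.c 1) * ev p D.n u -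
      (ev p D.c u * D.b 1 - D.b 1 * ev p D.c u) * ev p D.n v := by
  rw [← sub_eq_zero]
  refine D.eq_zero_of_grid hβ (F := fun u v => (u - v) • D.h u v -
    ((D.c 1 * ev p D.b v - ev p D.b v * D.c 1) * ev p D.n u -
      (ev p D.c u * D.b 1 - D.b 1 * ev p D.c u) * ev p D.n v)) (fun v => ?_) (fun u => ?_) ?_ u v
  · have h1 := (((D.isPoly_smul_h_left v).sub ((D.isPoly_h_left v).smul v)).sub
      (D.isPoly_n_sub.const_mul (D.c 1 * ev p D.b v - ev p D.b v * D.c 1))).add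
      ((((D.isPoly_c.mul_const (D.b 1)).sub (D.isPoly_c.const_mul (D.b 1)))).mul_const (ev p D.n v))
    refine (congrArg (IsPoly p) (funext fun u => ?_)).mp h1
    simp only [mul_sub, sub_mul, mul_smul_comm, mul_one]
    module
  · have h1 := ((((D.isPoly_h_right u).smul u).sub (D.isPoly_smul_h_right u)).sub
      ((((D.isPoly_b.const_mul (D.c 1)).sub (D.isPoly_b.mul_const (D.c 1)))).mul_const
        (ev p D.n u))).add
      (D.isPoly_n_sub.const_mul (ev p D.c u * D.b 1 - D.b 1 * ev p D.c u))
    refine (congrArg (IsPoly p) (funext fun v => ?_)).mp h1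
    simp only [mul_sub, sub_mul, mul_smul_comm, mul_one]
    module
  · intro a w hw i j
    have e1 : (- shift β a i - - shift β a j) • D.h (- shift β a i) (- shift β a j) w = 0 := by
      by_cases hij : i = j
      · subst hij; simp
      · rw [D.h_node hβ hw hij, smul_zero]
    simp only [LinearMap.sub_apply, LinearMap.smul_apply, e1]
    rw [Module.End.mul_apply, Module.End.mul_apply, D.ev_n _ hw, D.ev_n _ hw, eig_node, eig_node]
    simp

/-- This is `h_eq` after substituting `T₁₁(u) = T₂₂(u) - [t₂₁^(1), T₁₂(u)]`; the two products of
`T₂₂` cancel. -/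
theorem cb [Infinite k] (hp : 0 < p) (hβ : Generic β) : RTTAt k p D.t 1 0 0 1 := by
  intro u v
  have h1 := D.h_eq hβ u v
  rw [← D.lower_eq_upper hp hβ u] at h1
  rw [D.ev_a, D.ev_a]
  simp only [t_zero_one, t_one_zero, t_one_one]
  rw [h] at h1
  rw [h1]
  simp only [sub_mul]
  linear_combination (norm := abel) -D.commute_n u v

theorem isPoly_gam_sub :
    IsPoly (2 * p) (fun u : k => gam γ u • (1 : Module.End k V) - u ^ (2 * p) • 1) := by
  have h1 : IsPoly (2 * p) (fun u : k =>
      ((∏ j, (X + C (γ j)) : k[X]) - X ^ (2 * p)).eval u • (1 : Module.End k V)) := by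
    refine isPoly_eval ?_ _
    have hm : (∏ j, (X + C (γ j)) : k[X]).Monic :=
      Polynomial.monic_prod_of_monic _ _ fun j _ => Polynomial.monic_X_add_C _
    have hd : (∏ j, (X + C (γ j)) : k[X]).degree = (2 * p : ℕ) := by
      rw [Polynomial.degree_prod]; simp
    refine (Polynomial.degree_sub_lt_left (by rw [hd, Polynomial.degree_X_pow]) hm.ne_zero ?_).trans_eq hd
    rw [hm.leadingCoeff, (Polynomial.monic_X_pow _).leadingCoeff]
  refine (congrArg (IsPoly (2 * p)) (funext fun u => ?_)).mp h1
  rw [Polynomial.eval_sub, Polynomial.eval_prod, sub_smul, gam]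
  simp

/-- The difference has degree less than `2p`, and on each weight space it vanishes at `2p` distinct
points. -/
theorem qD_eq_gam [CharZero k] (hp : 0 < p) (hβ : Generic β) (u : k) :
    qD p D.t u = gam γ u • 1 := by
  rw [← sub_eq_zero]
  refine D.hom_ext fun a w hw => ?_
  have h1 := ((D.isLevel.isPoly_qD_sub.sub (isPoly_gam_sub (γ := γ) (V := V)))).map (LinearMap.applyₗ w)
  simp only [sub_sub_sub_cancel_right] at h1
  refine h1.eq_zero_of_nodes (by simp [two_mul]) (hβ.injective_sum a) ?_ u
  rintro (i | i)
  -- At a node `T₂₂(u)` vanishes, so the second expression of the determinant leaves `-e_i f_i`.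
  · rw [Sum.elim_inl, (D.cb hp hβ).qD_eq]
    simp only [LinearMap.applyₗ_apply_apply, LinearMap.sub_apply, Module.End.mul_apply, t_one_one,
      t_one_zero, t_zero_one]
    rw [D.ev_n _ hw, eig_node, zero_smul, map_zero, D.ev_c_node hβ hw i rfl,
      D.ev_b_node hβ (D.f_mem i a w hw) i, D.ef_same i a w hw]
    · simp [shift, sub_eq_add_neg, add_comm]
    · simp only [shift_add_single, if_true]; push_cast; ring
  -- At a node plus one `T₂₂(u - 1)` vanishes, so the definition leaves `-f_i e_i`.
  · rw [Sum.elim_inr, qD]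
    simp only [LinearMap.applyₗ_apply_apply, LinearMap.sub_apply, Module.End.mul_apply, t_one_one,
      t_one_zero, t_zero_one, add_sub_cancel_right]
    rw [D.ev_n _ hw, eig_node, zero_smul, map_zero, D.ev_b_node hβ hw i rfl,
      D.ev_c_node hβ (D.e_mem i a w hw) i, D.fe_same i a w hw]
    · simp [shift, sub_eq_add_neg, add_comm]
    · simp only [shift, Pi.sub_apply, Pi.single_eq_same]; push_cast; ring

/-- On a weight space `T₂₂(u + c)` is a nonzero scalar outside at most `p` points, so among `n + p`
points at least `n` remain to force `F` to vanish there. -/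
theorem eq_zero_of_mul_n [Infinite k] {n : ℕ} {F : k → Module.End k V} (hF : IsPoly n F) (c : k)
    (h : ∀ u, F u * ev p D.n (u + c) = 0) (u : k) : F u = 0 := by
  classical
  refine D.hom_ext fun a w hw => ?_
  obtain ⟨s, hs⟩ := Infinite.exists_subset_card_eq k (n + p)
  refine (hF.map (LinearMap.applyₗ w)).eq_zero
    (s \ Finset.univ.image fun i => - shift β a i - c) ?_ ?_ u
  · have h1 := Finset.le_card_sdiff (Finset.univ.image fun i => - shift β a i - c) s
    have h2 : (Finset.univ.image fun i => - shift β a i - c).card ≤ p := by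
      simpa using Finset.card_image_le (s := Finset.univ) (f := fun i => - shift β a i - c)
    omega
  · intro v hv
    have h1 := LinearMap.congr_fun (h v) w
    rw [Module.End.mul_apply, D.ev_n _ hw, map_smul, LinearMap.zero_apply] at h1
    refine (smul_eq_zero.1 h1).resolve_left ?_
    refine Finset.prod_ne_zero_iff.2 ?_
    intro i _ h0
    simp only [Finset.mem_sdiff, Finset.mem_image, Finset.mem_univ, true_and, not_exists] at hv
    exact hv.2 i (by linear_combination -h0)

/-- Only the commutators of `t₂₁^(1)` and `t₁₂^(1)` with `T₁₁` are still missing. They follow from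
the scalar value of the quantum determinant, which every commutator kills. -/
theorem reducedRel [CharZero k] (hp : 0 < p) (hβ : Generic β) : ReducedRel k p D.t := by
  have lower_n (v : k) : D.c 1 * ev p D.n v - ev p D.n v * D.c 1 = - ev p D.c v := by
    simpa using ((D.cn hβ).stepRelAt D.isLevel).ad_one D.isLevel v
  have upper_n (v : k) : D.b 1 * ev p D.n v - ev p D.n v * D.b 1 = ev p D.b v := by
    simpa using ((D.bn hβ).stepRelAt D.isLevel).ad_one D.isLevel v
  have lower_c (v : k) : D.c 1 * ev p D.c v - ev p D.c v * D.c 1 = 0 := by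
    simpa using ((RTTAt.of_commute (t := D.t) (i := 1) (j := 0)
      (D.commute_c hβ)).stepRelAt D.isLevel).ad_one D.isLevel v
  have upper_b (v : k) : D.b 1 * ev p D.b v - ev p D.b v * D.b 1 = 0 := by
    simpa using ((RTTAt.of_commute (t := D.t) (i := 0) (j := 1)
      (D.commute_b hβ)).stepRelAt D.isLevel).ad_one D.isLevel v
  have lower_b (v : k) : D.c 1 * ev p D.b v - ev p D.b v * D.c 1 =
      ev p D.n v - ev p (D.t 0 0) v := by
    rw [D.ev_a]; abel
  have upper_c (v : k) : D.b 1 * ev p D.c v - ev p D.c v * D.b 1 =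
      ev p (D.t 0 0) v - ev p D.n v := by
    rw [D.ev_a, D.lower_eq_upper hp hβ]; abel
  refine ⟨D.isLevel, D.commute_n, D.commute_b hβ, D.commute_c hβ, D.nb hβ, D.bn hβ, D.nc hβ, D.cn hβ,
    D.cb hp hβ, lower_b, upper_c, ?_, ?_⟩
  · intro v
    rw [← sub_eq_zero]
    have hP : IsPoly (p + 1) (fun v : k => D.c 1 * ev p (D.t 0 0) v - ev p (D.t 0 0) v * D.c 1 -
        ev p D.c v) :=
      (((isPoly_ev p (D.t 0 0)).const_mul _).sub ((isPoly_ev p (D.t 0 0)).mul_const _)).sub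
        (isPoly_ev p D.c)
    -- Applying `ad t₂₁^(1)` to `D(u + 1) = T₁₁(u) T₂₂(u + 1) - T₁₂(u) T₂₁(u + 1)` gives the claim
    -- multiplied on the right by `T₂₂(u + 1)`.
    refine D.eq_zero_of_mul_n hP 1 (fun u => ?_) v
    have h0 := (D.cb hp hβ).qD_eq (u + 1)
    have h1 := D.nc hβ (u + 1) u
    have h2 := D.cn hβ (u + 1) u
    rw [D.qD_eq_gam hp hβ] at h0
    simp only [add_sub_cancel_right, t_one_zero, t_one_one, t_zero_one] at h0 h1 h2
    rw [add_sub_cancel_left, one_smul] at h1 h2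
    have h3 := congrArg (fun x => D.c 1 * x - x * D.c 1) h0
    have h4 := congrArg (fun x => x * ev p D.c (u + 1)) (lower_b u)
    have h5 := congrArg (fun x => ev p D.b u * x) (lower_c (u + 1))
    have h6 := congrArg (fun x => ev p (D.t 0 0) u * x) (lower_n (u + 1))
    simp only [mul_sub, sub_mul, mul_assoc, mul_smul_comm, smul_mul_assoc, mul_one, one_mul,
      mul_neg, mul_zero, sub_self] at h3 h4 h5 h6 ⊢
    linear_combination (norm := abel) -h3 + h4 + h5 - h6 + h1
  · intro v
    rw [← sub_eq_zero]
    have hP : IsPoly (p + 1) (fun v : k => D.b 1 * ev p (D.t 0 0) v - ev p (D.t 0 0) v * D.b 1 -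
        - ev p D.b v) :=
      (((isPoly_ev p (D.t 0 0)).const_mul _).sub ((isPoly_ev p (D.t 0 0)).mul_const _)).sub
        (isPoly_ev p D.b).neg
    -- Here `ad t₁₂^(1)` is applied to the definition of `D(u)`, whose last diagonal factor is
    -- `T₂₂(u - 1)`.
    refine D.eq_zero_of_mul_n hP (-1) (fun u => ?_) v
    rw [← sub_eq_add_neg]
    have h0 := D.qD_eq_gam hp hβ u
    have h1 := D.nb hβ u (u - 1)
    rw [qD] at h0
    simp only [t_one_zero, t_one_one, t_zero_one] at h0 h1
    rw [sub_sub_cancel, one_smul] at h1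
    have h3 := congrArg (fun x => D.b 1 * x - x * D.b 1) h0
    have h4 := congrArg (fun x => x * ev p D.b (u - 1)) (upper_c u)
    have h5 := congrArg (fun x => ev p D.c u * x) (upper_b (u - 1))
    have h6 := congrArg (fun x => ev p (D.t 0 0) u * x) (upper_n (u - 1))
    simp only [mul_sub, sub_mul, mul_assoc, mul_smul_comm, smul_mul_assoc, mul_one, one_mul,
      neg_mul, mul_zero, sub_self] at h3 h4 h5 h6 ⊢
    linear_combination (norm := abel) h3 + h4 + h5 - h6 - h1

end Datum

end Datum

end Yangian

/-! ## The Yangian: generators, central elements, the algebra `Γ` -/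

namespace Yangian

section YangianBasic
variable {k : Type u} [Field k] {p : ℕ}

theorem isLevel_t : IsLevel p (t k p) where
  zero i j := by
    simp only [t, freeT, if_true]
    split_ifs <;> simp
  high i j r h := by
    rw [t, freeT, if_neg (by omega), dif_neg (by omega), map_zero]

theorem presented_t : Presented (t k p) := by
  intro i j c d r s
  have h := RingQuot.mkAlgHom_rel k (Rel.mk (k := k) (p := p) i j c d r s)
  simp only [map_sub, map_mul, map_sum] at h
  exact h

theorem stepRel_t : StepRel (t k p) := presented_t.stepRel

theorem rtt_t : RTT k p (t k p) := stepRel_t.rtt isLevel_t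

/-- The homomorphism from the Yangian given by elements satisfying the defining relations. -/
def liftY {S : Type*} [Ring S] [Algebra k S] (x : Fin 2 → Fin 2 → ℕ → S) (hx : IsLevel p x)
    (h : Presented x) : Y k p →ₐ[k] S :=
  RingQuot.liftAlgHom k ⟨FreeAlgebra.lift k fun z => x z.1 z.2.1 (z.2.2 + 1), by
    have key : ∀ i j r, FreeAlgebra.lift k (fun z : Fin 2 × Fin 2 × Fin p =>
        x z.1 z.2.1 (z.2.2 + 1)) (freeT k p i j r) = x i j r := by
      intro i j r
      rw [freeT]
      split_ifs with h1 h2 h3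
      · simp [h1, hx.zero, h2]
      · simp [h1, hx.zero, h2]
      · simp [Nat.sub_add_cancel (Nat.one_le_iff_ne_zero.2 h1)]
      · rw [hx.high _ _ _ (by omega), map_zero]
    rintro _ _ ⟨i, j, c, d, r, s⟩
    simp only [map_sub, map_mul, map_sum, key]
    exact h i j c d r s⟩

theorem liftY_t {S : Type*} [Ring S] [Algebra k S] (x : Fin 2 → Fin 2 → ℕ → S) (hx : IsLevel p x)
    (h : Presented x) (i j : Fin 2) (r : ℕ) : liftY x hx h (t k p i j r) = x i j r := by
  rw [liftY, t, RingQuot.liftAlgHom_mkAlgHom_apply, freeT]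
  split_ifs with h1 h2 h3
  · simp [h1, hx.zero, h2]
  · simp [h1, hx.zero, h2]
  · simp [Nat.sub_add_cancel (Nat.one_le_iff_ne_zero.2 h1)]
  · rw [hx.high _ _ _ (by omega), map_zero]

theorem t_zero_one_eq (s : ℕ) :
    t k p 0 1 s = t k p 0 1 1 * t k p 1 1 s - t k p 1 1 s * t k p 0 1 1 := by
  simpa using ((stepRel_t (k := k) (p := p) 0 1 1 1).ad_one_coeff isLevel_t s).symm

theorem t_one_zero_eq (s : ℕ) :
    t k p 1 0 s = t k p 1 1 s * t k p 1 0 1 - t k p 1 0 1 * t k p 1 1 s := by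
  have h := (stepRel_t (k := k) (p := p) 1 0 1 1).ad_one_coeff isLevel_t s
  simp only [Fin.isValue, one_ne_zero, if_true, if_false, zero_sub] at h
  rw [← neg_sub, h, neg_neg]

theorem t_zero_zero_eq (s : ℕ) :
    t k p 0 0 s = t k p 1 1 s - (t k p 1 0 1 * t k p 0 1 s - t k p 0 1 s * t k p 1 0 1) := by
  have h := (stepRel_t (k := k) (p := p) 1 0 0 1).ad_one_coeff isLevel_t s
  simp only [Fin.isValue, if_true] at h
  rw [h, sub_sub_cancel]

variable (k p) in
/-- The elements `t₂₂^(r)`, `t₂₁^(1)`, `t₁₂^(1)`, which generate the Yangian. -/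
def gens : Set (Y k p) := Set.range (t k p 1 1) ∪ {t k p 1 0 1, t k p 0 1 1}

/-- All `t₁₂^(s)` and `t₂₁^(s)` are, up to sign, commutators of `t₁₂^(1)` and `t₂₁^(1)` with
`t₂₂^(s)`, and `t₁₁^(s)` is `t₂₂^(s)` minus a commutator of `t₂₁^(1)` with `t₁₂^(s)`. -/
theorem adjoin_gens : Algebra.adjoin k (gens k p) = ⊤ := by
  have h11 : ∀ r, t k p 1 1 r ∈ Algebra.adjoin k (gens k p) := fun r =>
    Algebra.subset_adjoin (Or.inl ⟨r, rfl⟩)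
  have hc : t k p 1 0 1 ∈ Algebra.adjoin k (gens k p) := Algebra.subset_adjoin (Or.inr (Or.inl rfl))
  have hb : t k p 0 1 1 ∈ Algebra.adjoin k (gens k p) := Algebra.subset_adjoin (Or.inr (Or.inr rfl))
  have h01 : ∀ r, t k p 0 1 r ∈ Algebra.adjoin k (gens k p) := fun r => by
    rw [t_zero_one_eq]
    exact sub_mem (mul_mem hb (h11 r)) (mul_mem (h11 r) hb)
  have h10 : ∀ r, t k p 1 0 r ∈ Algebra.adjoin k (gens k p) := fun r => by
    rw [t_one_zero_eq]
    exact sub_mem (mul_mem (h11 r) hc) (mul_mem hc (h11 r))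
  have h00 : ∀ r, t k p 0 0 r ∈ Algebra.adjoin k (gens k p) := fun r => by
    rw [t_zero_zero_eq]
    exact sub_mem (h11 r) (sub_mem (mul_mem hc (h01 r)) (mul_mem (h01 r) hc))
  rw [eq_top_iff]
  rintro x -
  obtain ⟨y, rfl⟩ := RingQuot.mkAlgHom_surjective k (Rel k p) x
  induction y using FreeAlgebra.induction with
  | grade0 r => rw [AlgHom.commutes]; exact Subalgebra.algebraMap_mem _ r
  | grade1 z =>
    obtain ⟨i, j, r⟩ := z
    have e : RingQuot.mkAlgHom k (Rel k p) (FreeAlgebra.ι k (i, j, r)) = t k p i j (r + 1) := by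
      simp [t, freeT]
    rw [e]
    fin_cases i <;> fin_cases j
    exacts [h00 _, h01 _, h10 _, h11 _]
  | mul a b ha hb => rw [map_mul]; exact mul_mem ha hb
  | add a b ha hb => rw [map_add]; exact add_mem ha hb

/-- An additive subgroup of a `Y`-module stable under the generators is a submodule. -/
theorem gens_induction {M : Type*} [AddCommGroup M] [Module (Y k p) M] {P : M → Prop}
    (hadd : ∀ x y, P x → P y → P (x + y))
    (hscalar : ∀ (c : k) x, P x → P (algebraMap k (Y k p) c • x))
    (hgen : ∀ g ∈ gens k p, ∀ x, P x → P (g • x)) (y : Y k p) {x : M} (hx : P x) : P (y • x) := by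
  have hy : y ∈ Algebra.adjoin k (gens k p) := by rw [adjoin_gens]; trivial
  revert x
  induction hy using Algebra.adjoin_induction with
  | mem g hg => intro x hx; exact hgen g hg x hx
  | algebraMap c => intro x hx; exact hscalar c x hx
  | add a b _ _ ha hb => intro x hx; rw [add_smul]; exact hadd _ _ (ha hx) (hb hx)
  | mul a b _ _ ha hb => intro x hx; rw [mul_smul]; exact ha (hb hx)

/-- Evaluation at a scalar. -/
def evalScalar {S : Type*} [Ring S] [Algebra k S] (u : k) : S[X] →+* S :=
  Polynomial.eval₂RingHom' (RingHom.id S) (algebraMap k S u)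
    fun a => (Algebra.commutes u a).symm

theorem evalScalar_C {S : Type*} [Ring S] [Algebra k S] (u : k) (a : S) :
    evalScalar u (C a) = a := by simp [evalScalar, Polynomial.eval₂RingHom']

theorem evalScalar_X {S : Type*} [Ring S] [Algebra k S] (u : k) :
    evalScalar u (X : S[X]) = algebraMap k S u := by
  simp [evalScalar, Polynomial.eval₂RingHom']

theorem evalScalar_T (i j : Fin 2) (u : k) :
    evalScalar u (T k p i j) = ev p (t k p i j) u := by
  rw [T, map_sum, ev]
  refine Finset.sum_congr rfl fun r _ => ?_
  rw [map_mul, map_pow, evalScalar_C, evalScalar_X, ← map_pow, Algebra.smul_def]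
  exact (Algebra.commutes _ _).symm

theorem evalScalar_comp {S : Type*} [Ring S] [Algebra k S] (u : k) (q : S[X]) :
    evalScalar u (q.comp (X - 1)) = evalScalar (u - 1) q := by
  induction q using Polynomial.induction_on' with
  | add a b ha hb => rw [Polynomial.add_comp, map_add, map_add, ha, hb]
  | monomial n a =>
    rw [Polynomial.monomial_comp, map_mul, map_pow, evalScalar_C, map_sub, evalScalar_X, map_one,
      ← C_mul_X_pow_eq_monomial, map_mul, map_pow, evalScalar_C, evalScalar_X, map_sub, map_one]

theorem evalScalar_qdet (u : k) : evalScalar u (qdet k p) = qD p (t k p) u := by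
  rw [qdet, qD, map_sub, map_mul, map_mul, evalScalar_comp, evalScalar_comp]
  simp only [evalScalar_T]

theorem natDegree_T_le (i j : Fin 2) : (T k p i j).natDegree ≤ p := by
  refine Polynomial.natDegree_sum_le_of_forall_le _ _ fun r _ => ?_
  exact (Polynomial.natDegree_C_mul_X_pow_le _ _).trans (Nat.sub_le _ _)

theorem natDegree_qdet_le : (qdet k p).natDegree ≤ 2 * p := by
  have h : ∀ i j, ((T k p i j).comp (X - 1)).natDegree ≤ p := by
    intro i j
    refine Polynomial.natDegree_comp_le.trans ?_
    have h1 : (X - 1 : (Y k p)[X]).natDegree ≤ 1 := by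
      rw [← C_1]; exact Polynomial.natDegree_X_sub_C_le _
    calc _ ≤ p * 1 := Nat.mul_le_mul (natDegree_T_le i j) h1
      _ = p := mul_one p
  have h2 : ∀ i j i' j', (T k p i j * (T k p i' j').comp (X - 1)).natDegree ≤ 2 * p := by
    intro i j i' j'
    refine Polynomial.natDegree_mul_le.trans ?_
    have := natDegree_T_le (k := k) (p := p) i j
    have := h i' j'
    omega
  exact (Polynomial.natDegree_sub_le _ _).trans (max_le (h2 _ _ _ _) (h2 _ _ _ _))

theorem qD_t (u : k) : qD p (t k p) u = ev (2 * p) (d k p) u := by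
  rw [← evalScalar_qdet, ev_eq_sum_reflect]
  have e : evalScalar u (qdet k p) = (qdet k p).eval₂ (RingHom.id _) (algebraMap k _ u) := rfl
  rw [e, Polynomial.eval₂_eq_sum_range' _ (Nat.lt_succ_of_le natDegree_qdet_le)]
  refine Finset.sum_congr rfl fun r hr => ?_
  have hr := Finset.mem_range.1 hr
  rw [RingHom.id_apply, ← map_pow, Algebra.smul_def, d, Nat.sub_sub_self (by omega)]
  exact (Algebra.commutes _ _).symm

theorem d_zero [Infinite k] : d k p 0 = 1 := by
  have h1 := (isLevel_t (k := k) (p := p)).isPoly_qD_sub (k := k)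
  have h2 := isPoly_ev_sub (k := k) (2 * p) (d k p)
  have h3 := h1.sub h2
  obtain ⟨x, hx⟩ := h3
  -- Both `D(u) - u^(2p)` and `D(u) - u^(2p) d₀` have degree less than `2p`, so `(d₀ - 1) u^(2p)`
  -- equals a polynomial of smaller degree; the sequence collects the coefficients of that identity.
  have h4 : ∀ u : k, ev (2 * p) (fun r => if r = 0 then d k p 0 - 1 else - x (2 * p - r)) u = 0 := by
    intro u
    have h5 := hx u
    dsimp only at h5
    rw [← sub_add_cancel (ev (2 * p) _ u) (u ^ (2 * p) • _), ev_sub_leading]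
    have e : ∑ r ∈ Finset.range (2 * p), u ^ r • (fun r => if r = 0 then d k p 0 - 1 else
        - x (2 * p - r)) (2 * p - r) = - ∑ r ∈ Finset.range (2 * p), u ^ r • x r := by
      rw [← Finset.sum_neg_distrib]
      refine Finset.sum_congr rfl fun r hr => ?_
      have hr := Finset.mem_range.1 hr
      simp only [if_neg (show ¬ 2 * p - r = 0 by omega), Nat.sub_sub_self hr.le, smul_neg]
    rw [e, ← h5, qD_t]
    simp only [if_true]
    module
  have h6 := ev_coeff_eq_zero h4 (Nat.zero_le _)
  simpa [sub_eq_zero] using h6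

/-- An effect of truncated subtraction in the index `2p - i`: beyond `2p` the value is the constant
coefficient, not zero. -/
theorem d_high {i : ℕ} (h : 2 * p < i) : d k p i = d k p (2 * p) := by
  simp [d, Nat.sub_eq_zero_of_le h.le]

theorem qD_commute [Infinite k] (u : k) (y : Y k p) : qD p (t k p) u * y = y * qD p (t k p) u := by
  have hy : y ∈ Algebra.adjoin k (gens k p) := by rw [adjoin_gens]; trivial
  induction hy using Algebra.adjoin_induction with
  | mem g hg =>
    rcases hg with ⟨r, rfl⟩ | rfl | rfl
    · by_cases hr : p < r
      · rw [isLevel_t.high _ _ _ hr]; simp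
      rw [← sub_eq_zero]
      refine ev_coeff_eq_zero (k := k) (p := p)
        (x := fun r => qD p (t k p) u * t k p 1 1 r - t k p 1 1 r * qD p (t k p) u)
        (fun v => ?_) (not_lt.1 hr)
      rw [ev_sub, ev_mul_left, ev_mul_right, rtt_t.qD_commute_diag, sub_self]
    · exact rtt_t.qD_commute_lower isLevel_t stepRel_t u
    · exact rtt_t.qD_commute_upper isLevel_t stepRel_t u
  | algebraMap c => exact (Algebra.commutes _ _).symm
  | add a b _ _ ha hb => rw [mul_add, add_mul, ha, hb]
  | mul a b _ _ ha hb => rw [← mul_assoc, ha, mul_assoc, hb, mul_assoc]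

theorem d_commute [Infinite k] (i : ℕ) (y : Y k p) : d k p i * y = y * d k p i := by
  wlog hi : i ≤ 2 * p
  · rw [d_high (not_le.1 hi)]
    exact this _ _ le_rfl
  rw [← sub_eq_zero]
  refine ev_coeff_eq_zero (k := k) (p := 2 * p) (x := fun i => d k p i * y - y * d k p i)
    (fun u => ?_) hi
  rw [ev_sub, ev_mul_left, ev_mul_right, ← qD_t, qD_commute, sub_self]

theorem t_one_one_commute [Infinite k] (r s : ℕ) :
    t k p 1 1 r * t k p 1 1 s = t k p 1 1 s * t k p 1 1 r := by
  have h := presented_t (k := k) (p := p) 1 1 1 1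
  by_cases hr : p < r
  · simp [isLevel_t.high _ _ _ hr]
  by_cases hs : p < s
  · simp [isLevel_t.high _ _ _ hs]
  rw [← sub_eq_zero]
  refine ev_coeff_eq_zero (k := k) (p := p)
    (x := fun r => t k p 1 1 r * t k p 1 1 s - t k p 1 1 s * t k p 1 1 r) (fun u => ?_) (not_lt.1 hr)
  rw [ev_sub, ev_mul_left, ev_mul_right]
  refine ev_coeff_eq_zero (k := k) (p := p)
    (x := fun s => ev p (t k p 1 1) u * t k p 1 1 s - t k p 1 1 s * ev p (t k p 1 1) u)
    (fun v => ?_) (not_lt.1 hs)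
  rw [ev_sub, ev_mul_left, ev_mul_right, rtt_t.commute_same, sub_self]

theorem gam_mul_comm [Infinite k] (x y : Gam k p) : x * y = y * x := by
  have key : ∀ x ∈ {x | ∃ r ∈ Finset.Icc 1 p, x = t k p 1 1 r} ∪
      {x | ∃ i ∈ Finset.Icc 1 (2 * p), x = d k p i},
      ∀ y ∈ {x | ∃ r ∈ Finset.Icc 1 p, x = t k p 1 1 r} ∪
      {x | ∃ i ∈ Finset.Icc 1 (2 * p), x = d k p i}, x * y = y * x := by
    rintro x (⟨r, -, rfl⟩ | ⟨i, -, rfl⟩) y (⟨s, -, rfl⟩ | ⟨j, -, rfl⟩)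
    · exact t_one_one_commute r s
    · exact (d_commute j _).symm
    · exact d_commute i _
    · exact d_commute i _
  exact (Algebra.isMulCommutative_adjoin k key).is_comm.comm x y

/-- `Γ` is commutative. -/
instance instCommRingGam [Infinite k] : CommRing (Gam k p) :=
  { (Gam k p).toRing with mul_comm := gam_mul_comm }

theorem t_mem_Gam (r : ℕ) : t k p 1 1 r ∈ Gam k p := by
  by_cases h0 : r = 0
  · rw [h0, isLevel_t.zero]; simp
  by_cases hr : p < r
  · rw [isLevel_t.high _ _ _ hr]; exact zero_mem _
  · exact Algebra.subset_adjoin (Or.inl ⟨r, by simp; omega, rfl⟩)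

theorem d_mem_Gam [Infinite k] (i : ℕ) : d k p i ∈ Gam k p := by
  by_cases h0 : i = 0
  · rw [h0, d_zero]; exact one_mem _
  wlog hi : i ≤ 2 * p
  · rw [d_high (not_le.1 hi)]
    by_cases hp : 2 * p = 0
    · rw [hp, d_zero]; exact one_mem _
    · exact this _ hp le_rfl
  exact Algebra.subset_adjoin (Or.inr ⟨i, by simp; omega, rfl⟩)

end YangianBasic

end Yangian

/-! ## Weight spaces of modules over the Yangian -/

namespace Yangian

section WeightSpaces
variable {k : Type u} [Field k] {p : ℕ} (β : Fin p → k) (γ : Fin (2 * p) → k)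

/-- The maximal ideal of `Γ` for the parameters `(β + a, γ)`. -/
def wtIdeal (a : Fin p → ℤ) : Ideal (Gam k p) := iotaStar (shift β a) γ

theorem wtIdeal_zero : wtIdeal β γ 0 = iotaStar β γ := by
  rw [wtIdeal]
  congr 1
  funext i
  simp [shift]

section
variable (M : Type*) [AddCommGroup M] [Module k M] [Module (Y k p) M] [IsScalarTower k (Y k p) M]

/-- The joint eigenspace of `T₂₂(u)` and the quantum determinant for the weight `a`. -/
def wtSpace (a : Fin p → ℤ) : Submodule k M where
  carrier := {x | (∀ u : k, ev p (t k p 1 1) u • x = eig β a u • x) ∧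
    ∀ u : k, qD p (t k p) u • x = gam γ u • x}
  zero_mem' := by simp
  add_mem' := by
    rintro x y ⟨h1, h2⟩ ⟨h3, h4⟩
    exact ⟨fun u => by rw [smul_add, h1, h3, smul_add], fun u => by rw [smul_add, h2, h4, smul_add]⟩
  smul_mem' := by
    rintro c x ⟨h1, h2⟩
    have hc : ∀ y : Y k p, y • c • x = c • y • x := fun y => by
      rw [← algebraMap_smul (Y k p) c x, ← mul_smul, ← Algebra.commutes, mul_smul, algebraMap_smul]
    exact ⟨fun u => by rw [hc, h1, smul_comm], fun u => by rw [hc, h2, smul_comm]⟩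

variable {M}

theorem smul_comm_scalar (y : Y k p) (c : k) (x : M) : y • c • x = c • y • x := by
  rw [← algebraMap_smul (Y k p) c x, ← mul_smul, ← Algebra.commutes, mul_smul, algebraMap_smul]

theorem ev_smul {n : ℕ} (y : ℕ → Y k p) (u : k) (x : M) :
    ev n y u • x = ev n (fun r => y r • x) u := by
  simp [ev, Finset.sum_smul, smul_assoc]

variable {β γ}

/-- The generators of the ideal are the coefficients of `T₂₂(u) - ∏(u + β_i + a_i)` and of `D(u) -
γ(u)`, and a polynomial function on an infinite field determines its coefficients. -/
theorem mem_wtSpace_iff [Infinite k] {a : Fin p → ℤ} {x : M} :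
    x ∈ wtSpace β γ M a ↔ ∀ g ∈ wtIdeal β γ a, (g : Y k p) • x = 0 := by
  have hN : ∀ u : k, ev p (fun r => t k p 1 1 r • x -
      (Finset.univ.val.map (shift β a)).esymm r • x) u =
      ev p (t k p 1 1) u • x - eig β a u • x := fun u => by
    rw [ev_sub, ev_smul, ← ev_esymm]
    congr 1
    exact ev_map p _ (LinearMap.toSpanSingleton k M x) u
  have hD : ∀ u : k, ev (2 * p) (fun r => d k p r • x -
      (Finset.univ.val.map γ).esymm r • x) u = qD p (t k p) u • x - gam γ u • x := fun u => by
    rw [ev_sub, qD_t, ev_smul, gam, ← ev_esymm_map]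
    congr 1
    exact ev_map (2 * p) _ (LinearMap.toSpanSingleton k M x) u
  constructor
  · rintro ⟨h1, h2⟩ g hg
    induction hg using Submodule.span_induction with
    | mem g hg =>
      rcases hg with ⟨r, hr, hg⟩ | ⟨i, hi, hg⟩
      · rw [hg, sub_smul, algebraMap_smul]
        refine ev_coeff_eq_zero (k := k) (p := p) (x := fun r => t k p 1 1 r • x -
          (Finset.univ.val.map (shift β a)).esymm r • x) (fun u => ?_) (Finset.mem_Icc.1 hr).2
        rw [hN, h1, sub_self]
      · rw [hg, sub_smul, algebraMap_smul]
        refine ev_coeff_eq_zero (k := k) (p := 2 * p) (x := fun r => d k p r • x -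
          (Finset.univ.val.map γ).esymm r • x) (fun u => ?_) (Finset.mem_Icc.1 hi).2
        rw [hD, h2, sub_self]
    | zero => exact zero_smul _ x
    | add g h _ _ hg hh =>
      change ((g : Y k p) + (h : Y k p)) • x = 0
      rw [add_smul, hg, hh, add_zero]
    | smul c g _ hg =>
      change ((c : Y k p) * (g : Y k p)) • x = 0
      rw [mul_smul, hg, smul_zero]
  · intro h
    constructor
    · intro u
      rw [← sub_eq_zero, ← hN, ev]
      refine Finset.sum_eq_zero fun r hr => ?_
      have hr := Finset.mem_range.1 hr
      -- The coefficient for `r = 0` is not among the generators, but it compares `t₂₂^(0) = 1` with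
      -- `σ_0 = 1`.
      rcases Nat.eq_zero_or_pos r with rfl | h0
      · rw [isLevel_t.zero, Multiset.esymm, Multiset.powersetCard_zero_left]; simp
      have h1 : (⟨t k p 1 1 r, t_mem_Gam r⟩ - algebraMap k (Gam k p)
          ((Finset.univ.val.map (shift β a)).esymm r) : Gam k p) ∈ wtIdeal β γ a :=
        Ideal.subset_span (Or.inl ⟨r, Finset.mem_Icc.2 ⟨h0, by omega⟩, rfl⟩)
      have h2 := h _ h1
      change (t k p 1 1 r - algebraMap k (Y k p) _) • x = 0 at h2
      rw [sub_smul, algebraMap_smul] at h2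
      rw [h2, smul_zero]
    · intro u
      rw [← sub_eq_zero, ← hD, ev]
      refine Finset.sum_eq_zero fun r hr => ?_
      have hr := Finset.mem_range.1 hr
      rcases Nat.eq_zero_or_pos r with rfl | h0
      · rw [d_zero, Multiset.esymm, Multiset.powersetCard_zero_left]; simp
      have h1 : (⟨d k p r, d_mem_Gam r⟩ - algebraMap k (Gam k p)
          ((Finset.univ.val.map γ).esymm r) : Gam k p) ∈ wtIdeal β γ a :=
        Ideal.subset_span (Or.inr ⟨r, Finset.mem_Icc.2 ⟨h0, by omega⟩, rfl⟩)
      have h2 := h _ h1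
      change (d k p r - algebraMap k (Y k p) _) • x = 0 at h2
      rw [sub_smul, algebraMap_smul] at h2
      rw [h2, smul_zero]

/-- Modulo the ideal every generator of `Γ` is a scalar; hence the quotient is spanned by `1`,
without any appeal to maximality. -/
theorem exists_scalar (a : Fin p → ℤ) (g : Gam k p) :
    ∃ c : k, g - algebraMap k (Gam k p) c ∈ wtIdeal β γ a := by
  obtain ⟨y, hy⟩ := g
  have h : y ∈ Gam k p := hy
  rw [Gam] at h
  induction h using Algebra.adjoin_induction with
  | mem y h =>
    rcases h with ⟨r, hr, rfl⟩ | ⟨i, hi, rfl⟩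
    · exact ⟨_, Ideal.subset_span (Or.inl ⟨r, hr, rfl⟩)⟩
    · exact ⟨_, Ideal.subset_span (Or.inr ⟨i, hi, rfl⟩)⟩
  | algebraMap c => exact ⟨c, (congrArg (· ∈ wtIdeal β γ a) (sub_self _)).mpr (zero_mem _)⟩
  | add x y hx' hy' h1 h2 =>
    obtain ⟨c, hc⟩ := h1 hx'
    obtain ⟨e, he⟩ := h2 hy'
    refine ⟨c + e, ?_⟩
    have h3 := add_mem hc he
    convert h3 using 1
    refine Subtype.ext ?_
    change x + y - algebraMap k (Y k p) (c + e) =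
      x - algebraMap k (Y k p) c + (y - algebraMap k (Y k p) e)
    rw [map_add]
    abel
  | mul x y hx' hy' h1 h2 =>
    obtain ⟨c, hc⟩ := h1 hx'
    obtain ⟨e, he⟩ := h2 hy'
    refine ⟨c * e, ?_⟩
    have h3 := add_mem (Ideal.mul_mem_left _ (⟨x, hx'⟩ : Gam k p) he)
      (Ideal.mul_mem_left _ (algebraMap k (Gam k p) e) hc)
    convert h3 using 1
    refine Subtype.ext ?_
    change x * y - algebraMap k (Y k p) (c * e) =
      x * (y - algebraMap k (Y k p) e) +
        algebraMap k (Y k p) e * (x - algebraMap k (Y k p) c)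
    rw [mul_sub, mul_sub, Algebra.commutes e x, ← map_mul, mul_comm e c]
    abel

/-- If the two eigenvalues were equal, each zero of one would be a zero of the other; genericity
matches the indices `i`, and characteristic `0` then matches the integers. -/
theorem exists_eig_ne [CharZero k] (hβ : Generic β) {a a' : Fin p → ℤ} (h : a ≠ a') :
    ∃ u, eig β a u ≠ eig β a' u := by
  by_contra! h1
  refine h (funext fun i => ?_)
  have h2 := h1 (- shift β a i)
  rw [eig_node, eq_comm, eig, Finset.prod_eq_zero_iff] at h2
  obtain ⟨j, -, hj⟩ := h2
  by_cases hij : i = j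
  · subst hij
    simp only [shift] at hj
    exact_mod_cast (show (a i : k) = a' i by linear_combination -hj)
  · refine (hβ i j hij (a' j - a i) ?_).elim
    simp only [shift] at hj
    push_cast
    linear_combination -hj

/-- Joint eigenspaces of the commuting operators `T₂₂(u)`, `u ∈ k`, for distinct systems of
eigenvalues. -/
theorem iSupIndep_wtSpace [CharZero k] (hβ : Generic β) : iSupIndep (wtSpace β γ M) := by
  let f : k → Module.End k M := fun u => Algebra.lsmul k k M (ev p (t k p 1 1) u)
  have hcomm : ∀ u v, Commute (f u) (f v) := fun u v => by
    rw [commute_iff_eq, ← map_mul, ← map_mul, rtt_t.commute_same]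
  have h1 := Module.End.independent_iInf_maxGenEigenspace_of_forall_mapsTo f
    fun i j φ => Module.End.mapsTo_maxGenEigenspace_of_comm (hcomm j i) φ
  refine (h1.comp (f := fun a : Fin p → ℤ => eig β a) ?_).mono ?_
  · intro a a' h
    by_contra hne
    obtain ⟨u, hu⟩ := exists_eig_ne hβ hne
    exact hu (congrFun h u)
  · intro a x hx
    simp only [Function.comp_apply, Submodule.mem_iInf]
    intro u
    refine Module.End.mem_maxGenEigenspace _ _ _ |>.2 ⟨1, ?_⟩
    rw [pow_one]
    change ev p (t k p 1 1) u • x - eig β a u • x = 0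
    rw [hx.1, sub_self]

/-- The spectrum condition: the module is the sum of its weight spaces. -/
def IsWt (β : Fin p → k) (γ : Fin (2 * p) → k) (M : Type*) [AddCommGroup M] [Module k M]
    [Module (Y k p) M] [IsScalarTower k (Y k p) M] : Prop := ⨆ a, wtSpace β γ M a = ⊤

theorem isInternal_wtSpace [CharZero k] (hβ : Generic β) (hM : IsWt β γ M) :
    DirectSum.IsInternal (wtSpace β γ M) :=
  (DirectSum.isInternal_submodule_iff_iSupIndep_and_iSup_eq_top _).2 ⟨iSupIndep_wtSpace hβ, hM⟩

/-- The linear map defined by linear maps on the weight spaces. -/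
theorem exists_glue [CharZero k] (hβ : Generic β) (hM : IsWt β γ M) {W : Type*} [AddCommGroup W]
    [Module k W] (φ : ∀ a, wtSpace β γ M a →ₗ[k] W) :
    ∃ ψ : M →ₗ[k] W, ∀ a (x : wtSpace β γ M a), ψ x = φ a x := by
  let e := LinearEquiv.ofBijective (DirectSum.coeLinearMap (wtSpace β γ M))
    (isInternal_wtSpace hβ hM)
  refine ⟨DirectSum.toModule k _ W φ ∘ₗ e.symm.toLinearMap, fun a x => ?_⟩
  have h : e.symm x = DirectSum.lof k _ (fun a => wtSpace β γ M a) a x := by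
    rw [LinearEquiv.symm_apply_eq]
    exact (DirectSum.coeLinearMap_lof (wtSpace β γ M) a x).symm
  rw [LinearMap.comp_apply, LinearEquiv.coe_coe, h, DirectSum.toModule_lof]

theorem IsWt.hom_ext (hM : IsWt β γ M) {W : Type*} [AddCommGroup W] [Module k W]
    {φ ψ : M →ₗ[k] W} (h : ∀ a, ∀ w ∈ wtSpace β γ M a, φ w = ψ w) : φ = ψ := by
  refine LinearMap.ext_on (s := ⋃ a, (wtSpace β γ M a : Set M)) ?_ ?_
  · rw [Submodule.span_iUnion]
    simpa using (show ⨆ a, wtSpace β γ M a = ⊤ from hM)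
  · intro w hw
    obtain ⟨a, ha⟩ := Set.mem_iUnion.1 hw
    exact h a w ha

/-- The operator acting by the scalar `φ a` on the weight space for `a`. -/
theorem exists_diag [CharZero k] (hβ : Generic β) (hM : IsWt β γ M) (φ : (Fin p → ℤ) → k) :
    ∃ ψ : M →ₗ[k] M, ∀ a, ∀ x ∈ wtSpace β γ M a, ψ x = φ a • x := by
  obtain ⟨ψ, hψ⟩ := exists_glue hβ hM fun a => φ a • (wtSpace β γ M a).subtype
  exact ⟨ψ, fun a x hx => hψ a ⟨x, hx⟩⟩

theorem exists_scalar_smul [Infinite k] (a : Fin p → ℤ) (g : Gam k p) :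
    ∃ c : k, g - algebraMap k (Gam k p) c ∈ wtIdeal β γ a ∧
      ∀ x ∈ wtSpace β γ M a, (g : Y k p) • x = c • x := by
  obtain ⟨c, hc⟩ := exists_scalar (β := β) (γ := γ) a g
  refine ⟨c, hc, fun x hx => ?_⟩
  have h := mem_wtSpace_iff.1 hx _ hc
  change ((g : Y k p) - algebraMap k (Y k p) c) • x = 0 at h
  rwa [sub_smul, algebraMap_smul, sub_eq_zero] at h

theorem diag_smul_gam [Infinite k] (hM : IsWt β γ M) {φ : (Fin p → ℤ) → k} {ψ : M →ₗ[k] M}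
    (hψ : ∀ a, ∀ x ∈ wtSpace β γ M a, ψ x = φ a • x) (g : Gam k p) (x : M) :
    ψ ((g : Y k p) • x) = (g : Y k p) • ψ x := by
  have h : ψ ∘ₗ Algebra.lsmul k k M (g : Y k p) = Algebra.lsmul k k M (g : Y k p) ∘ₗ ψ := by
    refine hM.hom_ext fun a w hw => ?_
    obtain ⟨c, -, hc⟩ := exists_scalar_smul (M := M) (β := β) (γ := γ) a g
    change ψ ((g : Y k p) • w) = (g : Y k p) • ψ w
    rw [hc w hw, map_smul, hψ a w hw, smul_comm_scalar, hc w hw, smul_comm]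
  exact LinearMap.congr_fun h x

end

/-! ### The representation defined by a Gelfand–Tsetlin datum -/

namespace Datum
variable {β γ} {V : Type*} [AddCommGroup V] [Module k V] [CharZero k]

/-- The representation of the Yangian defined by a datum. -/
def rep (hp : 0 < p) (hβ : Generic β) (D : Datum β γ V) : Y k p →ₐ[k] Module.End k V :=
  liftY D.t D.isLevel ((D.reducedRel hp hβ).rtt.stepRel D.isLevel |>.presented D.isLevel)

/-- The vector space of a datum, as a module over the Yangian. -/
def Carrier (_ : 0 < p) (_ : Generic β) (_ : Datum β γ V) : Type _ := V

variable (hp : 0 < p) (hβ : Generic β) (D : Datum β γ V)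

instance : AddCommGroup (D.Carrier hp hβ) := inferInstanceAs (AddCommGroup V)
instance : Module (Y k p) (D.Carrier hp hβ) :=
  letI : Module (Module.End k V) (D.Carrier hp hβ) := inferInstanceAs (Module (Module.End k V) V)
  Module.compHom _ (D.rep hp hβ).toRingHom
-- The scalars act through the Yangian instead of being copied from `V`, which gives the scalar
-- tower for free; `of` compares the two structures.
instance : Module k (D.Carrier hp hβ) := Module.restrictScalars k (Y k p) (D.Carrier hp hβ)
instance : IsScalarTower k (Y k p) (D.Carrier hp hβ) :=
  IsScalarTower.restrictScalars k (Y k p) (D.Carrier hp hβ)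

/-- The vector space of a datum, identified with its module. -/
def of : V ≃ₗ[k] D.Carrier hp hβ where
  toFun x := x
  invFun x := x
  left_inv _ := rfl
  right_inv _ := rfl
  map_add' _ _ := rfl
  map_smul' c x := (LinearMap.congr_fun ((D.rep hp hβ).commutes c) x).symm

theorem smul_of (y : Y k p) (x : V) : y • D.of hp hβ x = D.of hp hβ (D.rep hp hβ y x) := rfl

theorem ev_smul_of (i j : Fin 2) (u : k) (x : V) :
    ev p (Yangian.t k p i j) u • D.of hp hβ x = D.of hp hβ (ev p (D.t i j) u x) := by
  rw [smul_of]
  have h := ev_map p (Yangian.t k p i j) (D.rep hp hβ).toLinearMap u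
  simp only [AlgHom.toLinearMap_apply, rep, liftY_t] at h
  rw [rep, h]

theorem qD_smul_of (u : k) (x : V) :
    qD p (Yangian.t k p) u • D.of hp hβ x = gam γ u • D.of hp hβ x := by
  have h := LinearMap.congr_fun (D.qD_eq_gam hp hβ u) x
  rw [qD] at h ⊢
  rw [sub_smul, mul_smul, mul_smul, ev_smul_of, ev_smul_of, ev_smul_of, ev_smul_of, ← map_sub,
    ← map_smul]
  exact congrArg (D.of hp hβ) h

theorem of_mem {a : Fin p → ℤ} {x : V} (hx : x ∈ D.wt a) :
    D.of hp hβ x ∈ wtSpace β γ (D.Carrier hp hβ) a := by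
  refine ⟨fun u => ?_, fun u => D.qD_smul_of hp hβ u x⟩
  rw [ev_smul_of, ← map_smul]
  exact congrArg (D.of hp hβ) (D.ev_n u hx)

theorem isWt : IsWt β γ (D.Carrier hp hβ) := by
  rw [IsWt, eq_top_iff]
  have h : (⊤ : Submodule k (D.Carrier hp hβ)) =
      ⨆ a, (D.wt a).map (D.of hp hβ).toLinearMap := by
    rw [← Submodule.map_iSup, D.span, Submodule.map_top]
    exact (LinearMap.range_eq_top.2 (D.of hp hβ).surjective).symm
  rw [h]
  refine iSup_mono fun a => ?_
  rintro _ ⟨x, hx, rfl⟩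
  exact D.of_mem hp hβ hx

end Datum

end WeightSpaces

end Yangian

/-! ## The maximal ideals of the parameters, and links between them -/

namespace Yangian

section Links
variable {k : Type u} [Field k] [CharZero k] {p : ℕ} {β : Fin p → k} {γ : Fin (2 * p) → k}

variable (β γ) in
/-- The datum with one-dimensional weight spaces and all `f_i` equal to `1`. -/
def lineDatum : Datum β γ ((Fin p → ℤ) →₀ k) where
  wt a := LinearMap.range (Finsupp.lsingle a)
  span := Finsupp.iSup_lsingle_range
  diag φ := Finsupp.lsum k fun a => φ a • Finsupp.lsingle a
  diag_apply := by rintro φ a _ ⟨c, rfl⟩; simp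
  f i := Finsupp.lsum k fun a => Finsupp.lsingle (a + Pi.single i 1)
  -- Once every `f_i` is the plain shift of the basis, this coefficient is forced by `fe_same`.
  e i := Finsupp.lsum k fun a =>
    (-gam γ (-β i - (a i : k) + 1)) • Finsupp.lsingle (a - Pi.single i 1)
  f_mem := by rintro i a _ ⟨c, rfl⟩; exact ⟨c, by simp⟩
  e_mem := by
    rintro i a _ ⟨c, rfl⟩
    exact ⟨(-gam γ (-β i - (a i : k) + 1)) * c, by simp⟩
  ff := by rintro i j a _ ⟨c, rfl⟩; simp [add_right_comm]
  ee := by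
    rintro i j a _ ⟨c, rfl⟩
    by_cases hij : i = j
    · subst hij; rfl
    · simp only [Finsupp.lsingle_apply, Finsupp.lsum_single, LinearMap.smul_apply, Finsupp.smul_single, smul_eq_mul,
        Pi.sub_apply, Pi.single_eq_of_ne hij, Pi.single_eq_of_ne (Ne.symm hij), sub_zero]
      rw [sub_right_comm, mul_left_comm]
  ef := by
    rintro i j a _ ⟨c, rfl⟩ hij
    simp only [Finsupp.lsingle_apply, Finsupp.lsum_single, LinearMap.smul_apply, Finsupp.smul_single, smul_eq_mul,
      Pi.add_apply, Pi.single_eq_of_ne hij, add_zero]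
    rw [sub_add_eq_add_sub a]
  ef_same := by
    rintro i a _ ⟨c, rfl⟩
    simp only [Finsupp.lsingle_apply, Finsupp.lsum_single, LinearMap.smul_apply, Finsupp.smul_single, smul_eq_mul,
      Pi.add_apply, Pi.single_eq_same, add_sub_cancel_right]
    push_cast
    rw [sub_add_eq_sub_sub, sub_add_cancel]
  fe_same := by
    rintro i a _ ⟨c, rfl⟩
    simp only [Finsupp.lsingle_apply, Finsupp.lsum_single, LinearMap.smul_apply, Finsupp.smul_single, smul_eq_mul, sub_add_cancel]

section
variable {M : Type*} [AddCommGroup M] [Module k M] [Module (Y k p) M] [IsScalarTower k (Y k p) M]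

/-- The quotient is spanned by `1`; the nonzero vector only certifies that the ideal is proper. -/
theorem wtIdeal_isMaximal_of_ne_zero {a : Fin p → ℤ} {x : M} (hx : x ∈ wtSpace β γ M a)
    (h0 : x ≠ 0) : (wtIdeal β γ a).IsMaximal := by
  refine Ideal.isMaximal_iff.2 ⟨fun h => h0 ?_, fun J g hJ hg hgJ => ?_⟩
  · have := mem_wtSpace_iff.1 hx 1 h
    simpa using this
  · obtain ⟨c, hc⟩ := exists_scalar (β := β) (γ := γ) a g
    have hc0 : c ≠ 0 := by
      rintro rfl
      rw [map_zero, sub_zero] at hc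
      exact hg hc
    have h1 := sub_mem hgJ (hJ hc)
    rw [sub_sub_cancel] at h1
    have h2 := J.mul_mem_left (algebraMap k (Gam k p) c⁻¹) h1
    rwa [← map_mul, inv_mul_cancel₀ hc0, map_one] at h2

/-- The map `u ↦ ψ (u • x)` on `Γ y Γ` is `Γ`-linear, because the projection `ψ` commutes with `Γ`.
It kills `Γ y 𝐦` since `𝐦 x = 0`, and its image is the line of `ψ (y • x)`, which is `Γ / 𝐧`. -/
theorem X_of_diag (hM : IsWt β γ M) {a a' : Fin p → ℤ} {x : M} (hx : x ∈ wtSpace β γ M a)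
    (y : Y k p) {ψ : M →ₗ[k] M}
    (hψ : ∀ c, ∀ w ∈ wtSpace β γ M c, ψ w = (if c = a' then (1 : k) else 0) • w)
    (h0 : ψ (y • x) ≠ 0) : HarishChandra.X (Gam k p) y (wtIdeal β γ a) (wtIdeal β γ a') := by
  have hmem : ∀ w, ψ w ∈ wtSpace β γ M a' := by
    intro w
    have hw : w ∈ ⨆ c, wtSpace β γ M c := by
      rw [show ⨆ c, wtSpace β γ M c = ⊤ from hM]; trivial
    induction hw using Submodule.iSup_induction' with
    | mem c w hw =>
      rw [hψ c w hw]
      split_ifs with h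
      · subst h; rwa [one_smul]
      · rw [zero_smul]; exact zero_mem _
    | zero => rw [map_zero]; exact zero_mem _
    | add v w _ _ hv hw => rw [map_add]; exact add_mem hv hw
  have hx0 : x ≠ 0 := by rintro rfl; simp at h0
  have hmax := wtIdeal_isMaximal_of_ne_zero (hmem (y • x)) h0
  refine ⟨wtIdeal_isMaximal_of_ne_zero hx hx0, hmax, ?_⟩
  let Ψ : Y k p →ₗ[Gam k p] M :=
    { toFun := fun u => ψ (u • x)
      map_add' := fun u v => by rw [add_smul, map_add]
      map_smul' := fun g u => by
        change ψ (((g : Y k p) * u) • x) = (g : Y k p) • ψ (u • x)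
        rw [mul_smul, diag_smul_gam hM hψ] }
  have hΨ : ∀ g : Gam k p, ∃ c : k, Ψ (y * (g : Y k p)) = c • ψ (y • x) := fun g => by
    obtain ⟨c, -, hc⟩ := exists_scalar_smul (M := M) (β := β) (γ := γ) a g
    refine ⟨c, ?_⟩
    change ψ ((y * (g : Y k p)) • x) = _
    rw [mul_smul, hc x hx, smul_comm_scalar, map_smul]
  let B := HarishChandra.leftRight (Gam k p) y ⊤
  let Z := LinearMap.toSpanSingleton (Gam k p) M (ψ (y • x))
  have hyB : y ∈ B := Submodule.subset_span ⟨1, trivial, by simp⟩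
  have hrange : LinearMap.range (Ψ ∘ₗ B.subtype) = LinearMap.range Z := by
    rw [LinearMap.range_comp, Submodule.range_subtype]
    apply le_antisymm
    · refine (Submodule.map_span_le _ _ _).2 ?_
      rintro _ ⟨g, -, rfl⟩
      obtain ⟨c, hc⟩ := hΨ g
      rw [hc]
      exact ⟨algebraMap k (Gam k p) c, algebraMap_smul (Y k p) c (ψ (y • x))⟩
    · rintro _ ⟨g, rfl⟩
      exact Submodule.smul_mem _ g ⟨y, hyB, rfl⟩
  have hker : LinearMap.ker Z = wtIdeal β γ a' := by
    refine (hmax.eq_of_le ?_ ?_).symm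
    · rw [Ne, Ideal.eq_top_iff_one]
      intro h
      refine h0 ?_
      have h1 : (1 : Gam k p) • ψ (y • x) = 0 := h
      rwa [one_smul] at h1
    · intro g hg
      exact mem_wtSpace_iff.1 (hmem (y • x)) g hg
  refine ⟨B ⊓ LinearMap.ker Ψ, B, ?_, inf_le_left, le_rfl, ?_⟩
  · refine Submodule.span_le.2 ?_
    rintro _ ⟨g, hg, rfl⟩
    refine ⟨Submodule.subset_span ⟨g, trivial, rfl⟩, ?_⟩
    change ψ ((y * (g : Y k p)) • x) = 0
    rw [mul_smul, mem_wtSpace_iff.1 hx g hg, smul_zero, map_zero]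
  · have hsub : (B ⊓ LinearMap.ker Ψ).submoduleOf B = LinearMap.ker (Ψ ∘ₗ B.subtype) := by
      ext u
      simp [Submodule.submoduleOf]
    exact ⟨(Submodule.quotEquivOfEq _ _ hsub).trans
      ((LinearMap.quotKerEquivRange _).trans
        ((LinearEquiv.ofEq _ _ hrange).trans
          ((LinearMap.quotKerEquivRange Z).symm.trans (Submodule.quotEquivOfEq _ _ hker))))⟩

end

variable (hp : 0 < p) (hβ : Generic β)
include hp hβ

theorem lineDatum_mem (a : Fin p → ℤ) : (lineDatum β γ).of hp hβ (Finsupp.single a 1) ∈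
    wtSpace β γ ((lineDatum β γ).Carrier hp hβ) a :=
  (lineDatum β γ).of_mem hp hβ ⟨1, rfl⟩

theorem lineDatum_ne_zero (a : Fin p → ℤ) :
    (lineDatum β γ).of hp hβ (Finsupp.single a 1) ≠ 0 :=
  (LinearEquiv.map_ne_zero_iff _).2 (Finsupp.single_ne_zero.2 one_ne_zero)

theorem wtIdeal_isMaximal (a : Fin p → ℤ) : (wtIdeal β γ a).IsMaximal :=
  wtIdeal_isMaximal_of_ne_zero (lineDatum_mem (γ := γ) hp hβ a) (lineDatum_ne_zero hp hβ a)

theorem wtIdeal_injective : Function.Injective (wtIdeal β γ) := by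
  intro a a' h
  by_contra hne
  obtain ⟨u, hu⟩ := exists_eig_ne hβ hne
  have h1 := lineDatum_mem (γ := γ) hp hβ a
  have h2 := h1
  rw [mem_wtSpace_iff, h, ← mem_wtSpace_iff] at h2
  have h3 := (h1.1 u).symm.trans (h2.1 u)
  rw [← sub_eq_zero, ← sub_smul] at h3
  exact (smul_eq_zero.1 h3).elim (fun h => hu (sub_eq_zero.1 h)) (lineDatum_ne_zero hp hβ a)

/-- In the module with one-dimensional weight spaces, `t₂₁^(1)` sends the basis vector of weight `a`
to a combination of those of weights `a + δ_j`; the point is that each coefficient is nonzero. -/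
theorem link_single (a : Fin p → ℤ) (i : Fin p) : HarishChandra.X (Gam k p) (t k p 1 0 1)
    (wtIdeal β γ a) (wtIdeal β γ (a + Pi.single i 1)) := by
  obtain ⟨ψ, hψ⟩ := exists_diag hβ ((lineDatum β γ).isWt hp hβ)
    (fun c => if c = a + Pi.single i 1 then (1 : k) else 0)
  refine X_of_diag ((lineDatum β γ).isWt hp hβ) (lineDatum_mem hp hβ a) _ hψ ?_
  have hf : ∀ j, (lineDatum β γ).f j (Finsupp.single a 1) = Finsupp.single (a + Pi.single j 1) 1 :=
    fun j => by simp [lineDatum]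
  have hψf : ∀ j, ψ ((lineDatum β γ).of hp hβ (Finsupp.single (a + Pi.single j 1) 1)) =
      if j = i then (lineDatum β γ).of hp hβ (Finsupp.single (a + Pi.single i 1) 1) else 0 := by
    intro j
    rw [hψ _ _ (lineDatum_mem hp hβ _)]
    by_cases hji : j = i
    · subst hji; simp
    · rw [if_neg, if_neg hji, zero_smul]
      intro h
      have h4 := congrFun (add_left_cancel h) j
      simp [hji] at h4
  have h1 : t k p 1 0 1 • (lineDatum β γ).of hp hβ (Finsupp.single a 1) =
      ∑ j, (lag β a j).coeff (p - 1) •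
        (lineDatum β γ).of hp hβ (Finsupp.single (a + Pi.single j 1) 1) := by
    rw [Datum.smul_of, Datum.rep, liftY_t, Datum.t_one_zero,
      Datum.c_apply (lineDatum β γ) 1 (a := a) (w := Finsupp.single a 1) ⟨1, rfl⟩, if_neg (by omega), map_sum]
    simp only [map_smul, hf]
  rw [h1, map_sum]
  simp only [map_smul, hψf, smul_ite, smul_zero, Finset.sum_ite_eq', Finset.mem_univ, if_true]
  -- The coefficient of index `p - 1` is the leading one, because a Lagrange polynomial on `p` nodes
  -- has degree exactly `p - 1`.
  refine smul_ne_zero ?_ (lineDatum_ne_zero hp hβ _)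
  have hne : lag β a i ≠ 0 := Lagrange.basis_ne_zero ((hβ.injective a).injOn) (Finset.mem_univ i)
  have hd : (lag β a i).natDegree = p - 1 := by
    have h5 : (lag β a i).natDegree = _ :=
      Lagrange.natDegree_basis ((hβ.injective a).injOn) (Finset.mem_univ i)
    simpa using h5
  rw [← hd]
  exact Polynomial.leadingCoeff_ne_zero.2 hne

/-- The translations that link every weight of the family to its translate form a subgroup of `ℤ^p`,
and it contains the `δ_i`. -/
theorem wtIdeal_mem_block (a : Fin p → ℤ) :
    wtIdeal β γ a ∈ HarishChandra.block (Gam k p) (iotaStar β γ) := by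
  rw [← wtIdeal_zero]
  let S : AddSubgroup (Fin p → ℤ) :=
    { carrier := {s | ∀ c, Relation.EqvGen (fun m n => ∃ y, HarishChandra.X (Gam k p) y m n)
        (wtIdeal β γ c) (wtIdeal β γ (c + s))}
      zero_mem' := fun c => by rw [add_zero]; exact Relation.EqvGen.refl _
      add_mem' := fun {s s'} hs hs' c => by
        rw [← add_assoc]; exact (hs c).trans _ _ _ (hs' _)
      neg_mem' := fun {s} hs c => by
        have h := hs (c + -s)
        rw [neg_add_cancel_right] at h
        exact h.symm _ _ }
  have h1 : ∀ i, (Pi.single i 1 : Fin p → ℤ) ∈ S := fun i c =>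
    Relation.EqvGen.rel _ _ ⟨_, link_single hp hβ c i⟩
  have h2 : a ∈ S := by
    have e : a = ∑ i, a i • (Pi.single i 1 : Fin p → ℤ) := by
      funext j
      simp [Finset.sum_apply, Pi.single_apply]
    rw [e]
    exact sum_mem fun i _ => S.zsmul_mem (h1 i) _
  have h3 := h2 0
  rwa [zero_add] at h3

end Links

end Yangian

/-! ## Sub-bimodules of the Yangian -/

namespace Yangian

set_option linter.unusedSectionVars false

section Bimodules
variable {k : Type u} [Field k] [CharZero k] {p : ℕ} (β : Fin p → k) (γ : Fin (2 * p) → k)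

/-- The image of an ideal of `Γ` in the Yangian. -/
def img (J : Ideal (Gam k p)) : Submodule k (Y k p) :=
  (J.restrictScalars k).map (Gam k p).val.toLinearMap

variable (k p) in
/-- `Γ` as a subspace of the Yangian. -/
def gamSub : Submodule k (Y k p) := Subalgebra.toSubmodule (Gam k p)

theorem img_le (J : Ideal (Gam k p)) : img J ≤ gamSub k p := by
  rintro _ ⟨g, -, rfl⟩
  exact g.2

theorem one_le_gamSub : 1 ≤ gamSub k p := Submodule.one_le.2 (one_mem (Gam k p))

theorem gamSub_mul_gamSub : gamSub k p * gamSub k p ≤ gamSub k p :=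
  Submodule.mul_le.2 fun _ hx _ hy => mul_mem (S := Subalgebra k (Y k p)) hx hy

theorem gamSub_mul_comm {J J' : Submodule k (Y k p)} (h : J ≤ gamSub k p) (h' : J' ≤ gamSub k p) :
    J * J' = J' * J :=
  Submodule.mul_comm_of_commute fun x hx y hy =>
    congrArg Subtype.val (gam_mul_comm (⟨x, h hx⟩ : Gam k p) ⟨y, h' hy⟩)

theorem gamSub_mul_img (J : Ideal (Gam k p)) : gamSub k p * img J ≤ img J := by
  refine Submodule.mul_le.2 ?_
  rintro x hx _ ⟨g, hg, rfl⟩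
  exact ⟨⟨x, hx⟩ * g, J.mul_mem_left _ hg, rfl⟩

theorem img_mul_gamSub (J : Ideal (Gam k p)) : img J * gamSub k p ≤ img J := by
  rw [gamSub_mul_comm (img_le J) le_rfl]
  exact gamSub_mul_img J

/-- The products of the ideals `wtIdeal β γ a`. -/
def prods : Submonoid (Submodule k (Y k p)) :=
  Submonoid.closure (Set.range fun a => img (wtIdeal β γ a))

variable {β γ}

theorem img_mem_prods (a : Fin p → ℤ) : img (wtIdeal β γ a) ∈ prods β γ :=
  Submonoid.subset_closure ⟨a, rfl⟩

theorem le_gamSub_of_mem_prods {J : Submodule k (Y k p)} (hJ : J ∈ prods β γ) : J ≤ gamSub k p := by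
  induction hJ using Submonoid.closure_induction with
  | mem J h => obtain ⟨a, rfl⟩ := h; exact img_le _
  | one => exact one_le_gamSub
  | mul J J' _ _ h h' => exact (mul_le_mul' h h').trans gamSub_mul_gamSub

theorem list_prod_le_of_mem {l : List (Ideal (Gam k p))} {J : Ideal (Gam k p)} (h : J ∈ l) :
    (l.map img).prod ≤ img J := by
  have hG : ∀ l : List (Ideal (Gam k p)), (l.map img).prod ≤ gamSub k p := by
    intro l
    induction l with
    | nil => exact one_le_gamSub
    | cons J l ih =>
      rw [List.map_cons, List.prod_cons]
      exact (mul_le_mul' (img_le J) ih).trans gamSub_mul_gamSub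
  induction l with
  | nil => simp at h
  | cons J' l ih =>
    rw [List.map_cons, List.prod_cons]
    rcases List.mem_cons.1 h with rfl | h
    · exact (mul_le_mul' le_rfl (hG l)).trans (img_mul_gamSub _)
    · exact (mul_le_mul' (img_le J') (ih h)).trans (gamSub_mul_img _)

theorem exists_prods_le {ι : Type*} [Fintype ι] (s : ι → Fin p → ℤ) :
    ∃ J ∈ prods β γ, ∀ i, J ≤ img (wtIdeal β γ (s i)) := by
  refine ⟨((Finset.univ.toList.map fun i => wtIdeal β γ (s i)).map img).prod, ?_, fun i => ?_⟩
  · refine Submonoid.list_prod_mem _ fun J hJ => ?_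
    simp only [List.map_map, List.mem_map] at hJ
    obtain ⟨i, -, rfl⟩ := hJ
    exact img_mem_prods _
  · exact list_prod_le_of_mem (List.mem_map.2 ⟨i, Finset.mem_toList.2 (Finset.mem_univ i), rfl⟩)

/-- An ideal that is comaximal with each factor is comaximal with their product. -/
theorem one_le_sup_of_mem_prods {n : Ideal (Gam k p)} (hn : ∀ a, wtIdeal β γ a ⊔ n = ⊤)
    {J : Submodule k (Y k p)} (hJ : J ∈ prods β γ) : 1 ≤ img n ⊔ J := by
  have h : 1 ≤ img n ⊔ J ∧ J ≤ gamSub k p := by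
    refine ⟨?_, le_gamSub_of_mem_prods hJ⟩
    induction hJ using Submonoid.closure_induction with
    | mem J h =>
      obtain ⟨a, rfl⟩ := h
      have h1 : (1 : Gam k p) ∈ n ⊔ wtIdeal β γ a := by rw [sup_comm, hn]; trivial
      obtain ⟨x, hx, y, hy, hxy⟩ := Submodule.mem_sup.1 h1
      exact Submodule.one_le.2 (Submodule.mem_sup.2 ⟨x, ⟨x, hx, rfl⟩, y, ⟨y, hy, rfl⟩,
        congrArg Subtype.val hxy⟩)
    | one => exact le_sup_right
    | mul J J' hJ hJ' h h' =>
      have h1 := le_gamSub_of_mem_prods hJ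
      have h2 := le_gamSub_of_mem_prods hJ'
      calc (1 : Submodule k (Y k p)) = 1 * 1 := (mul_one 1).symm
        _ ≤ (img n ⊔ J) * (img n ⊔ J') := mul_le_mul' h h'
        _ ≤ img n ⊔ J * J' := by
          rw [Submodule.sup_mul, Submodule.mul_sup, Submodule.mul_sup]
          refine sup_le (sup_le ?_ ?_) (sup_le ?_ le_sup_right)
          · exact ((mul_le_mul' le_rfl (img_le n)).trans (img_mul_gamSub n)).trans le_sup_left
          · exact ((mul_le_mul' le_rfl h2).trans (img_mul_gamSub n)).trans le_sup_left
          · exact ((mul_le_mul' h1 le_rfl).trans (gamSub_mul_img n)).trans le_sup_left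
  exact h.1

variable (β γ) in
/-- A sub-bimodule of the Yangian that is finitely generated as a right module, such that products
of the ideals `wtIdeal β γ a` can be moved from one side to the other. -/
structure Good (S : Submodule k (Y k p)) : Prop where
  left : gamSub k p * S ≤ S
  right : S * gamSub k p ≤ S
  fg : ∃ T : Submodule k (Y k p), T.FG ∧ S = T * gamSub k p
  move : ∀ J ∈ prods β γ, ∃ J' ∈ prods β γ, J' * S ≤ S * J
  move' : ∀ J ∈ prods β γ, ∃ J' ∈ prods β γ, S * J' ≤ J * S

theorem Good.sup {S S' : Submodule k (Y k p)} (h : Good β γ S) (h' : Good β γ S') :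
    Good β γ (S ⊔ S') where
  left := by rw [Submodule.mul_sup]; exact sup_le_sup h.left h'.left
  right := by rw [Submodule.sup_mul]; exact sup_le_sup h.right h'.right
  fg := by
    obtain ⟨T, hT, rfl⟩ := h.fg
    obtain ⟨T', hT', rfl⟩ := h'.fg
    exact ⟨T ⊔ T', hT.sup hT', (Submodule.sup_mul _ _ _).symm⟩
  move J hJ := by
    obtain ⟨J₁, h₁, i₁⟩ := h.move J hJ
    obtain ⟨J₂, h₂, i₂⟩ := h'.move J hJ
    -- On `S` the factor `J₂` is absorbed by the left action of `Γ`, and on `S'` the factor `J₁` is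
    -- absorbed after `J₂` has been moved.
    refine ⟨J₁ * J₂, mul_mem h₁ h₂, ?_⟩
    rw [Submodule.mul_sup, Submodule.sup_mul, mul_assoc, mul_assoc]
    refine sup_le_sup ?_ ?_
    · exact (mul_le_mul' le_rfl ((mul_le_mul' (le_gamSub_of_mem_prods h₂) le_rfl).trans h.left)).trans i₁
    · refine (mul_le_mul' (le_gamSub_of_mem_prods h₁) i₂).trans ?_
      rw [← mul_assoc]
      exact mul_le_mul' h'.left le_rfl
  move' J hJ := by
    obtain ⟨J₁, h₁, i₁⟩ := h.move' J hJ
    obtain ⟨J₂, h₂, i₂⟩ := h'.move' J hJ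
    refine ⟨J₂ * J₁, mul_mem h₂ h₁, ?_⟩
    rw [Submodule.sup_mul, Submodule.mul_sup, ← mul_assoc, ← mul_assoc]
    refine sup_le_sup ?_ ?_
    · exact (mul_le_mul' ((mul_le_mul' le_rfl (le_gamSub_of_mem_prods h₂)).trans h.right) le_rfl).trans i₁
    · refine (mul_le_mul' i₂ (le_gamSub_of_mem_prods h₁)).trans ?_
      rw [mul_assoc]
      exact mul_le_mul' le_rfl h'.right

/-- For finite generation, `T Γ T' Γ = T T' Γ` because `Γ S' = S'`; ideals are moved through one
factor after the other. -/
theorem Good.mul {S S' : Submodule k (Y k p)} (h : Good β γ S) (h' : Good β γ S') :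
    Good β γ (S * S') where
  left := by rw [← mul_assoc]; exact mul_le_mul' h.left le_rfl
  right := by rw [mul_assoc]; exact mul_le_mul' le_rfl h'.right
  fg := by
    obtain ⟨T, hT, hS⟩ := h.fg
    obtain ⟨T', hT', hS'⟩ := h'.fg
    refine ⟨T * T', hT.mul hT', ?_⟩
    have e : gamSub k p * S' = S' := le_antisymm h'.left
      ((one_mul S').ge.trans (mul_le_mul' one_le_gamSub le_rfl))
    rw [hS, mul_assoc, e, hS', mul_assoc]
  move J hJ := by
    obtain ⟨J₁, h₁, i₁⟩ := h'.move J hJ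
    obtain ⟨J₂, h₂, i₂⟩ := h.move J₁ h₁
    refine ⟨J₂, h₂, ?_⟩
    rw [← mul_assoc]
    refine (mul_le_mul' i₂ le_rfl).trans ?_
    rw [mul_assoc, mul_assoc]
    exact mul_le_mul' le_rfl i₁
  move' J hJ := by
    obtain ⟨J₁, h₁, i₁⟩ := h.move' J hJ
    obtain ⟨J₂, h₂, i₂⟩ := h'.move' J₁ h₁
    refine ⟨J₂, h₂, ?_⟩
    rw [mul_assoc]
    refine (mul_le_mul' le_rfl i₂).trans ?_
    rw [← mul_assoc, ← mul_assoc]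
    exact mul_le_mul' i₁ le_rfl

theorem good_gamSub : Good β γ (gamSub k p) where
  left := gamSub_mul_gamSub
  right := gamSub_mul_gamSub
  fg := ⟨1, by rw [Submodule.one_eq_span]; exact Submodule.fg_span_singleton 1, (one_mul _).symm⟩
  move J hJ := ⟨J, hJ, (gamSub_mul_comm (le_gamSub_of_mem_prods hJ) le_rfl).le⟩
  move' J hJ := ⟨J, hJ, (gamSub_mul_comm le_rfl (le_gamSub_of_mem_prods hJ)).le⟩

/-- It suffices to move a single ideal. -/
theorem move_of_single {S : Submodule k (Y k p)}
    (h : ∀ a, ∃ J' ∈ prods β γ, J' * S ≤ S * img (wtIdeal β γ a))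
    {J : Submodule k (Y k p)} (hJ : J ∈ prods β γ) : ∃ J' ∈ prods β γ, J' * S ≤ S * J := by
  induction hJ using Submonoid.closure_induction with
  | mem J hJ => obtain ⟨a, rfl⟩ := hJ; exact h a
  | one => exact ⟨1, one_mem _, by rw [one_mul, mul_one]⟩
  | mul J₁ J₂ _ _ h₁ h₂ =>
    obtain ⟨J₁', m₁, i₁⟩ := h₁
    obtain ⟨J₂', m₂, i₂⟩ := h₂
    refine ⟨J₂' * J₁', mul_mem m₂ m₁, ?_⟩
    rw [gamSub_mul_comm (le_gamSub_of_mem_prods m₂) (le_gamSub_of_mem_prods m₁), mul_assoc]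
    refine (mul_le_mul' le_rfl i₂).trans ?_
    rw [← mul_assoc]
    refine (mul_le_mul' i₁ le_rfl).trans (mul_assoc _ _ _).le

theorem move'_of_single {S : Submodule k (Y k p)}
    (h : ∀ a, ∃ J' ∈ prods β γ, S * J' ≤ img (wtIdeal β γ a) * S)
    {J : Submodule k (Y k p)} (hJ : J ∈ prods β γ) : ∃ J' ∈ prods β γ, S * J' ≤ J * S := by
  induction hJ using Submonoid.closure_induction with
  | mem J hJ => obtain ⟨a, rfl⟩ := hJ; exact h a
  | one => exact ⟨1, one_mem _, by rw [one_mul, mul_one]⟩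
  | mul J₁ J₂ _ _ h₁ h₂ =>
    obtain ⟨J₁', m₁, i₁⟩ := h₁
    obtain ⟨J₂', m₂, i₂⟩ := h₂
    refine ⟨J₁' * J₂', mul_mem m₁ m₂, ?_⟩
    rw [← mul_assoc]
    refine (mul_le_mul' i₁ le_rfl).trans ?_
    rw [mul_assoc, mul_assoc]
    exact mul_le_mul' le_rfl i₂

/-- The eigenvalue equation for the values at the nodes of a polynomial function that is shifted by
`T₂₂(u)`. -/
theorem shift_eigen {M : Type*} [AddCommGroup M] [Module k M] {a : Fin p → ℤ} {ε : ℤ}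
    {g : k → k → M} {w : k → M} {n : ℕ} (hg : ∀ v, IsPoly n fun u => g u v)
    (h : ∀ u v, (u - v) • g u v =
      (u - v) • eig β a u • w v + (ε : k) • (eig β a u • w v - eig β a v • w u))
    (i : Fin p) (u : k) :
    g u (- shift β a i) = eig β (a + Pi.single i ε) u • w (- shift β a i) := by
  rw [← sub_eq_zero]
  have hpoly : IsPoly (p + 1) fun u : k => eig β (a + Pi.single i ε) u • w (- shift β a i) := by
    have h1 := (isPoly_ev (k := k) p fun r =>
      (Finset.univ.val.map (shift β (a + Pi.single i ε))).esymm r).map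
      (LinearMap.toSpanSingleton k M (w (- shift β a i)))
    simpa only [ev_esymm, LinearMap.toSpanSingleton_apply] using h1
  refine (((hg (- shift β a i)).mono (le_max_left n (p + 1))).sub
    (hpoly.mono (le_max_right n (p + 1)))).eq_zero_of_ne (- shift β a i) (fun u hu => ?_) u
  have h1 := h u (- shift β a i)
  -- At the node the term with `w u` drops out, leaving the eigenvalue times `u - v + ε`; cancelling
  -- `u - v` replaces the `i`-th factor by its shift.
  rw [eig_node, zero_smul, sub_zero] at h1
  rw [eig_add_single]
  have hu' : u - - shift β a i ≠ 0 := sub_ne_zero.2 hu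
  rw [eig_eq a i, sub_neg_eq_add] at h1
  rw [sub_neg_eq_add] at hu'
  refine smul_right_injective M hu' ?_
  dsimp only
  rw [smul_sub, h1]
  module

theorem n_sub_eig_mem (a : Fin p → ℤ) (u : k) :
    ev p (t k p 1 1) u - algebraMap k (Y k p) (eig β a u) ∈ img (wtIdeal β γ a) := by
  have e : ev p (t k p 1 1) u - algebraMap k (Y k p) (eig β a u) =
      ev p (fun r => t k p 1 1 r - algebraMap k (Y k p)
        ((Finset.univ.val.map (shift β a)).esymm r)) u := by
    rw [ev_sub, ← ev_esymm]
    congr 1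
    exact (ev_map p _ (Algebra.linearMap k (Y k p)) u).symm
  rw [e, ev]
  refine Submodule.sum_mem _ fun r hr => Submodule.smul_mem _ _ ?_
  have hr := Finset.mem_range.1 hr
  rcases Nat.eq_zero_or_pos r with rfl | h0
  · rw [isLevel_t.zero, Multiset.esymm, Multiset.powersetCard_zero_left]; simp
  · exact ⟨⟨t k p 1 1 r, t_mem_Gam r⟩ - algebraMap k (Gam k p) _,
      Ideal.subset_span (Or.inl ⟨r, Finset.mem_Icc.2 ⟨h0, by omega⟩, rfl⟩), rfl⟩

theorem d_sub_mem (a : Fin p → ℤ) {i : ℕ} (hi : i ∈ Finset.Icc 1 (2 * p)) :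
    d k p i - algebraMap k (Y k p) ((Finset.univ.val.map γ).esymm i) ∈ img (wtIdeal β γ a) :=
  ⟨⟨d k p i, d_mem_Gam i⟩ - algebraMap k (Gam k p) _,
    Ideal.subset_span (Or.inr ⟨i, hi, rfl⟩), rfl⟩

theorem coeff_eq_of_ev {M N : Type*} [AddCommGroup M] [Module k M] [AddCommGroup N] [Module k N]
    (φ : M →ₗ[k] N) (w : N) (x : ℕ → M) (c : Fin p → k)
    (h : ∀ u : k, φ (ev p x u) = (∏ i, (u + c i)) • w) {r : ℕ} (hr : r ≤ p) :
    φ (x r) = (Finset.univ.val.map c).esymm r • w := by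
  rw [← sub_eq_zero]
  refine ev_coeff_eq_zero (k := k) (p := p)
    (x := fun r => φ (x r) - (Finset.univ.val.map c).esymm r • w) (fun u => ?_) hr
  have e := ev_map p (fun r => (Finset.univ.val.map c).esymm r) (LinearMap.toSpanSingleton k N w) u
  simp only [LinearMap.toSpanSingleton_apply] at e
  rw [ev_sub, ev_map, h, e, ev_esymm_map, sub_self]

/-- The bilinear map `m` stands for left or right multiplication, so that both sides of a bimodule
are treated at once. -/
theorem gen_induction {m : Y k p →ₗ[k] Y k p →ₗ[k] Y k p} {Z : Submodule k (Y k p)}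
    (hm : ∀ (g h : Gam k p) x, m ((g * h : Gam k p) : Y k p) x = m g (m h x))
    (hZ : ∀ (g : Gam k p), ∀ z ∈ Z, m g z ∈ Z) {s : Set (Gam k p)} {y : Y k p}
    (h : ∀ g ∈ s, m (g : Y k p) y ∈ Z) {g : Gam k p} (hg : g ∈ Ideal.span s) :
    m (g : Y k p) y ∈ Z := by
  induction hg using Submodule.span_induction with
  | mem g hg => exact h g hg
  | zero => rw [ZeroMemClass.coe_zero, map_zero]; exact zero_mem Z
  | add g h _ _ hg hh =>
    rw [AddMemClass.coe_add, map_add]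
    exact add_mem hg hh
  | smul c g _ hg =>
    rw [smul_eq_mul, hm]
    exact hZ _ _ hg

theorem shift_coeff_mem {S : Type*} [Ring S] [Algebra k S] {m : S →ₗ[k] S →ₗ[k] S}
    {Z : Submodule k S} {n : ℕ → S}
    (hm1 : ∀ (c : k) x, m (algebraMap k S c) x = c • x)
    {a : Fin p → ℤ} {ε : ℤ} {x : ℕ → S}
    (hN : ∀ u v : k, m (ev p x v) (ev p n u) - eig β a u • ev p x v ∈ Z)
    (h : ∀ u v : k, (u - v) • (m (ev p n u) (ev p x v) - m (ev p x v) (ev p n u)) =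
      (ε : k) • (m (ev p x v) (ev p n u) - m (ev p x u) (ev p n v)))
    (i : Fin p) {r : ℕ} (hr : r ≤ p) :
    m (n r - algebraMap k S ((Finset.univ.val.map (shift β (a + Pi.single i ε))).esymm r))
      (ev p x (- shift β a i)) ∈ Z := by
  have hN' : ∀ u v : k, Z.mkQ (m (ev p x v) (ev p n u)) = eig β a u • Z.mkQ (ev p x v) := by
    intro u v
    rw [← map_smul, ← sub_eq_zero, ← map_sub]
    exact (Submodule.Quotient.mk_eq_zero Z).2 (hN u v)
  have h1 := shift_eigen (β := β) (a := a) (ε := ε)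
    (g := fun u v => Z.mkQ (m (ev p n u) (ev p x v)))
    (w := fun v => Z.mkQ (ev p x v)) (n := p + 1)
    (fun v => ((isPoly_ev p n).map (m.flip (ev p x v))).map Z.mkQ) (fun u v => by
      have h2 := congrArg Z.mkQ (h u v)
      simp only [map_smul, map_sub, hN'] at h2
      linear_combination (norm := module) h2) i
  have h2 := coeff_eq_of_ev (Z.mkQ ∘ₗ m.flip (ev p x (- shift β a i)))
    (Z.mkQ (ev p x (- shift β a i))) n (shift β (a + Pi.single i ε)) (fun u => by
      rw [LinearMap.comp_apply, LinearMap.flip_apply, ← eig]; exact h1 u) hr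
  rw [LinearMap.comp_apply, LinearMap.flip_apply] at h2
  rw [← Submodule.Quotient.mk_eq_zero, ← Submodule.mkQ_apply, map_sub, LinearMap.sub_apply, hm1,
    map_sub, map_smul, sub_eq_zero]
  exact h2

/-- The action of `Γ` from one side, by the product `m`, on an element that is shifted by
`T₂₂(u)`, modulo a subspace `Z` for which the action from the other side is scalar. -/
theorem shift_mem {m : Y k p →ₗ[k] Y k p →ₗ[k] Y k p} {Z : Submodule k (Y k p)}
    (hm1 : ∀ (c : k) x, m (algebraMap k (Y k p) c) x = c • x)
    (hm : ∀ (g h : Gam k p) x, m ((g * h : Gam k p) : Y k p) x = m g (m h x))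
    (hZ : ∀ (g : Gam k p), ∀ z ∈ Z, m g z ∈ Z) {a : Fin p → ℤ} {ε : ℤ} {x : ℕ → Y k p}
    (hN : ∀ u v : k, m (ev p x v) (ev p (t k p 1 1) u) - eig β a u • ev p x v ∈ Z)
    (hd : ∀ (v : k), ∀ i ∈ Finset.Icc 1 (2 * p),
      m (d k p i - algebraMap k (Y k p) ((Finset.univ.val.map γ).esymm i)) (ev p x v) ∈ Z)
    (h : ∀ u v : k, (u - v) • (m (ev p (t k p 1 1) u) (ev p x v) -
      m (ev p x v) (ev p (t k p 1 1) u)) =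
      (ε : k) • (m (ev p x v) (ev p (t k p 1 1) u) - m (ev p x u) (ev p (t k p 1 1) v)))
    (i : Fin p) {g : Gam k p} (hg : g ∈ wtIdeal β γ (a + Pi.single i ε)) :
    m g (ev p x (- shift β a i)) ∈ Z := by
  refine gen_induction hm hZ ?_ hg
  rintro g (⟨r, hr, hg⟩ | ⟨j, hj, hg⟩)
  · rw [hg]
    exact shift_coeff_mem hm1 hN h i (Finset.mem_Icc.1 hr).2
  · rw [hg]
    exact hd _ j hj

end Bimodules

end Yangian

/-! ## Every element of the Yangian lies in a good bimodule -/

namespace Yangian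

set_option linter.unusedSectionVars false

section GoodBimodules
variable {k : Type u} [Field k] [CharZero k] {p : ℕ} {β : Fin p → k} {γ : Fin (2 * p) → k}

/-- The coefficients of a polynomial function are spanned by its values at the nodes. -/
theorem coeff_mem_of_nodes {S : Type*} [AddCommGroup S] [Module k S] (hβ : Generic β) (a : Fin p → ℤ)
    {x : ℕ → S} (hx : x 0 = 0) {P : Submodule k S} (h : ∀ i, ev p x (- shift β a i) ∈ P) {r : ℕ}
    (hr : r ≤ p) : x r ∈ P := by
  rw [← Submodule.Quotient.mk_eq_zero, ← Submodule.mkQ_apply]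
  refine ev_coeff_eq_zero (k := k) (p := p) (x := fun r => P.mkQ (x r)) (fun u => ?_) hr
  rw [ev_map, eq_sum_lag hβ a (isPoly_ev_of_zero hx) u, map_sum]
  refine Finset.sum_eq_zero fun i _ => ?_
  rw [map_smul, Submodule.mkQ_apply, (Submodule.Quotient.mk_eq_zero P).2 (h i), smul_zero]

/-- Only the generators `t₂₂^(s)` of `Γ` need a hypothesis, since the `d_i` are central. -/
theorem gamSub_mul_le {x : ℕ → Y k p}
    (h : ∀ r s, t k p 1 1 s * x r ∈ Submodule.span k (Set.range x) * gamSub k p) :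
    gamSub k p * Submodule.span k (Set.range x) ≤ Submodule.span k (Set.range x) * gamSub k p := by
  set P := Submodule.span k (Set.range x)
  have key : ∀ g ∈ Gam k p, ∀ y ∈ P * gamSub k p, g * y ∈ P * gamSub k p := by
    intro g hg
    rw [Gam] at hg
    have hstep : ∀ g : Y k p, (∀ r, g * x r ∈ P * gamSub k p) →
        ∀ y ∈ P * gamSub k p, g * y ∈ P * gamSub k p := by
      intro g hg y hy
      induction hy using Submodule.mul_induction_on' with
      | mem_mul_mem m hm n hn =>
        have h1 : P ≤ (P * gamSub k p).comap (LinearMap.mulLeft k g) := by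
          refine Submodule.span_le.2 ?_
          rintro _ ⟨r, rfl⟩
          exact hg r
        rw [← mul_assoc]
        have h2 := Submodule.mul_mem_mul (show g * m ∈ P * gamSub k p from h1 hm) hn
        rw [mul_assoc] at h2
        exact mul_le_mul' le_rfl gamSub_mul_gamSub h2
      | add a _ b _ ha hb => rw [mul_add]; exact add_mem ha hb
    induction hg using Algebra.adjoin_induction with
    | mem g hg =>
      refine hstep g fun r => ?_
      rcases hg with ⟨s, -, rfl⟩ | ⟨i, -, rfl⟩
      · exact h r s
      · rw [d_commute]
        exact Submodule.mul_mem_mul (Submodule.subset_span ⟨r, rfl⟩) (d_mem_Gam i)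
    | algebraMap c => intro y hy; rw [← Algebra.smul_def]; exact Submodule.smul_mem _ c hy
    | add a b _ _ ha hb => intro y hy; rw [add_mul]; exact add_mem (ha y hy) (hb y hy)
    | mul a b _ _ ha hb => intro y hy; rw [mul_assoc]; exact ha _ (hb y hy)
  refine Submodule.mul_le.2 fun g hg y hy => key g hg y ?_
  rw [← mul_one y]
  exact Submodule.mul_mem_mul hy (one_mem (Gam k p))

theorem le_gamSub_mul {x : ℕ → Y k p}
    (h : ∀ r s, x r * t k p 1 1 s ∈ gamSub k p * Submodule.span k (Set.range x)) :
    Submodule.span k (Set.range x) * gamSub k p ≤ gamSub k p * Submodule.span k (Set.range x) := by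
  set P := Submodule.span k (Set.range x)
  have key : ∀ g ∈ Gam k p, ∀ y ∈ gamSub k p * P, y * g ∈ gamSub k p * P := by
    intro g hg
    rw [Gam] at hg
    have hstep : ∀ g : Y k p, (∀ r, x r * g ∈ gamSub k p * P) →
        ∀ y ∈ gamSub k p * P, y * g ∈ gamSub k p * P := by
      intro g hg y hy
      induction hy using Submodule.mul_induction_on' with
      | mem_mul_mem m hm n hn =>
        have h1 : P ≤ (gamSub k p * P).comap (LinearMap.mulRight k g) := by
          refine Submodule.span_le.2 ?_
          rintro _ ⟨r, rfl⟩
          exact hg r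
        rw [mul_assoc]
        have h2 := Submodule.mul_mem_mul hm (show n * g ∈ gamSub k p * P from h1 hn)
        rw [← mul_assoc] at h2
        exact mul_le_mul' gamSub_mul_gamSub le_rfl h2
      | add a _ b _ ha hb => rw [add_mul]; exact add_mem ha hb
    induction hg using Algebra.adjoin_induction with
    | mem g hg =>
      refine hstep g fun r => ?_
      rcases hg with ⟨s, -, rfl⟩ | ⟨i, -, rfl⟩
      · exact h r s
      · rw [← d_commute]
        exact Submodule.mul_mem_mul (d_mem_Gam i) (Submodule.subset_span ⟨r, rfl⟩)
    | algebraMap c =>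
      intro y hy; rw [← Algebra.commutes, ← Algebra.smul_def]; exact Submodule.smul_mem _ c hy
    | add a b _ _ ha hb => intro y hy; rw [mul_add]; exact add_mem (ha y hy) (hb y hy)
    | mul a b _ _ ha hb => intro y hy; rw [← mul_assoc]; exact hb _ (ha y hy)
  refine Submodule.mul_le.2 fun y hy g hg => key g hg y ?_
  rw [← one_mul y]
  exact Submodule.mul_mem_mul (one_mem (Gam k p)) hy

theorem ev_mem_span (x : ℕ → Y k p) (v : k) : ev p x v ∈ Submodule.span k (Set.range x) :=
  Submodule.sum_mem _ fun r _ => Submodule.smul_mem _ _ (Submodule.subset_span ⟨r, rfl⟩)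

/-- A family of elements that commutes with `Γ` up to shifts spans a good bimodule. -/
theorem good_of_shift (hβ : Generic β) {x : ℕ → Y k p} (hx : x 0 = 0) (hx' : ∀ r, p < r → x r = 0)
    (hl : ∀ r s, t k p 1 1 s * x r ∈ Submodule.span k (Set.range x) * gamSub k p)
    (hr : ∀ r s, x r * t k p 1 1 s ∈ gamSub k p * Submodule.span k (Set.range x))
    (ε ε' : ℤ)
    (h : ∀ u v : k, (u - v) • (ev p (t k p 1 1) u * ev p x v - ev p x v * ev p (t k p 1 1) u) =
      (ε : k) • (ev p x v * ev p (t k p 1 1) u - ev p x u * ev p (t k p 1 1) v))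
    (h' : ∀ u v : k, (u - v) • (ev p x v * ev p (t k p 1 1) u - ev p (t k p 1 1) u * ev p x v) =
      (ε' : k) • (ev p (t k p 1 1) u * ev p x v - ev p (t k p 1 1) v * ev p x u)) :
    Good β γ (Submodule.span k (Set.range x) * gamSub k p) := by
  set P := Submodule.span k (Set.range x) with hP
  have hcomm : P * gamSub k p = gamSub k p * P := le_antisymm (le_gamSub_mul hr) (gamSub_mul_le hl)
  have hleft : gamSub k p * (P * gamSub k p) ≤ P * gamSub k p := by
    rw [hcomm, ← mul_assoc]; exact mul_le_mul' gamSub_mul_gamSub le_rfl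
  have hright : P * gamSub k p * gamSub k p ≤ P * gamSub k p := by
    rw [mul_assoc]; exact mul_le_mul' le_rfl gamSub_mul_gamSub
  have hPS : P ≤ P * gamSub k p := (mul_one P).ge.trans (mul_le_mul' le_rfl one_le_gamSub)
  have hPle : ∀ (a : Fin p → ℤ) (Q : Submodule k (Y k p)),
      (∀ i, ev p x (- shift β a i) ∈ Q) → P ≤ Q := by
    intro a Q h
    refine Submodule.span_le.2 ?_
    rintro _ ⟨r, rfl⟩
    by_cases hr : r ≤ p
    · exact coeff_mem_of_nodes hβ a hx h hr
    · rw [hx' r (not_le.1 hr)]; exact zero_mem Q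
  refine ⟨hleft, hright, ⟨P, ?_, rfl⟩, fun J hJ => move_of_single (fun a => ?_) hJ,
    fun J hJ => move'_of_single (fun a => ?_) hJ⟩
  · have e : P = Submodule.span k (x '' (Finset.range (p + 1) : Set ℕ)) := by
      refine le_antisymm (Submodule.span_le.2 ?_) (Submodule.span_mono (Set.image_subset_range _ _))
      rintro _ ⟨r, rfl⟩
      by_cases hr : r ≤ p
      · exact Submodule.subset_span ⟨r, by simpa using Nat.lt_succ_of_le hr, rfl⟩
      · rw [hx' r (not_le.1 hr)]; exact zero_mem _
    rw [e]
    exact Submodule.fg_span ((Finset.finite_toSet _).image x)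
  -- `J'` lies in the ideals of all the weights `a + ε δ_i`. The `i`-th of these carries the value
  -- at the `i`-th node into `S 𝐦_a`, and the values at the nodes span all coefficients.
  · obtain ⟨J', hJ', hle⟩ := exists_prods_le (β := β) (γ := γ) fun i => a + Pi.single i ε
    refine ⟨J', hJ', ?_⟩
    have hZ : gamSub k p * (P * gamSub k p * img (wtIdeal β γ a)) ≤
        P * gamSub k p * img (wtIdeal β γ a) := by
      rw [← mul_assoc]; exact mul_le_mul' hleft le_rfl
    have key : J' * P ≤ P * gamSub k p * img (wtIdeal β γ a) := by
      refine Submodule.mul_le.2 fun j hj y hy => ?_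
      refine hPle a ((P * gamSub k p * img (wtIdeal β γ a)).comap (LinearMap.mulLeft k j))
        (fun i => ?_) hy
      obtain ⟨g, hg, rfl⟩ := hle i hj
      refine shift_mem (m := LinearMap.mul k (Y k p)) (fun c x => (Algebra.smul_def c x).symm)
        (fun g h x => mul_assoc _ _ _) (fun g z hz => hZ (Submodule.mul_mem_mul g.2 hz)) (ε := ε)
        (fun u v => ?_) (fun v i hi => ?_) h i hg
      · rw [LinearMap.mul_apply', Algebra.smul_def, Algebra.commutes, ← mul_sub]
        exact Submodule.mul_mem_mul (hPS (ev_mem_span x v)) (n_sub_eig_mem a u)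
      · rw [LinearMap.mul_apply', sub_mul, d_commute, Algebra.commutes, ← mul_sub]
        exact Submodule.mul_mem_mul (hPS (ev_mem_span x v)) (d_sub_mem a hi)
    rw [← mul_assoc]
    refine (mul_le_mul' key le_rfl).trans ?_
    rw [mul_assoc (P * gamSub k p)]
    exact mul_le_mul' le_rfl (img_mul_gamSub _)
  -- The same with left and right exchanged; the shift is now `ε'`.
  · obtain ⟨J', hJ', hle⟩ := exists_prods_le (β := β) (γ := γ) fun i => a + Pi.single i ε'
    refine ⟨J', hJ', ?_⟩
    have hZ : img (wtIdeal β γ a) * (P * gamSub k p) * gamSub k p ≤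
        img (wtIdeal β γ a) * (P * gamSub k p) := by
      rw [mul_assoc]; exact mul_le_mul' le_rfl hright
    have key : P * J' ≤ img (wtIdeal β γ a) * (P * gamSub k p) := by
      refine Submodule.mul_le.2 fun y hy j hj => ?_
      refine hPle a ((img (wtIdeal β γ a) * (P * gamSub k p)).comap (LinearMap.mulRight k j))
        (fun i => ?_) hy
      obtain ⟨g, hg, rfl⟩ := hle i hj
      refine shift_mem (m := (LinearMap.mul k (Y k p)).flip)
        (fun c x => by
          rw [LinearMap.flip_apply, LinearMap.mul_apply', ← Algebra.commutes, ← Algebra.smul_def])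
        (fun g h x => by
          rw [gam_mul_comm]
          exact (mul_assoc x (h : Y k p) (g : Y k p)).symm)
        (fun g z hz => hZ (Submodule.mul_mem_mul hz g.2)) (ε := ε')
        (fun u v => ?_) (fun v i hi => ?_) h' i hg
      · rw [LinearMap.flip_apply, LinearMap.mul_apply', Algebra.smul_def, ← sub_mul]
        exact Submodule.mul_mem_mul (n_sub_eig_mem a u) (hPS (ev_mem_span x v))
      · rw [LinearMap.flip_apply, LinearMap.mul_apply', mul_sub, ← d_commute, ← Algebra.commutes,
          ← sub_mul]
        exact Submodule.mul_mem_mul (d_sub_mem a hi) (hPS (ev_mem_span x v))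
    rw [hcomm, mul_assoc, ← hcomm]
    refine (mul_le_mul' le_rfl key).trans ?_
    rw [← mul_assoc]
    exact mul_le_mul' (gamSub_mul_img _) le_rfl

theorem exists_good_zero_one (hβ : Generic β) :
    ∃ S, Good β γ S ∧ t k p 0 1 1 ∈ S := by
  have hmem : ∀ r, t k p 0 1 r ∈ Submodule.span k (Set.range (t k p 0 1)) := fun r =>
    Submodule.subset_span ⟨r, rfl⟩
  refine ⟨_, good_of_shift hβ (x := t k p 0 1) (by simp [isLevel_t.zero])
    (fun r hr => isLevel_t.high _ _ r hr) (fun r s => ?_) (fun r s => ?_) (-1) 1 (fun u v => ?_)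
    (fun u v => ?_), mul_one (t k p 0 1 1) ▸ Submodule.mul_mem_mul (hmem 1) (one_mem (Gam k p))⟩
  · rw [← sub_add_cancel (t k p 1 1 s * t k p 0 1 r) (t k p 0 1 r * t k p 1 1 s), presented_t]
    exact add_mem (Submodule.sum_mem _ fun a _ => sub_mem
      (Submodule.mul_mem_mul (hmem _) (t_mem_Gam _)) (Submodule.mul_mem_mul (hmem _) (t_mem_Gam _)))
      (Submodule.mul_mem_mul (hmem _) (t_mem_Gam _))
  · rw [← sub_add_cancel (t k p 0 1 r * t k p 1 1 s) (t k p 1 1 s * t k p 0 1 r), presented_t]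
    exact add_mem (Submodule.sum_mem _ fun a _ => sub_mem
      (Submodule.mul_mem_mul (t_mem_Gam _) (hmem _)) (Submodule.mul_mem_mul (t_mem_Gam _) (hmem _)))
      (Submodule.mul_mem_mul (t_mem_Gam _) (hmem _))
  · rw [rtt_t 1 1 0 1 u v]; push_cast; module
  · have := rtt_t (k := k) (p := p) 0 1 1 1 v u
    push_cast
    linear_combination (norm := module) -this

theorem exists_good_one_zero (hβ : Generic β) :
    ∃ S, Good β γ S ∧ t k p 1 0 1 ∈ S := by
  have hmem : ∀ r, t k p 1 0 r ∈ Submodule.span k (Set.range (t k p 1 0)) := fun r =>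
    Submodule.subset_span ⟨r, rfl⟩
  refine ⟨_, good_of_shift hβ (x := t k p 1 0) (by simp [isLevel_t.zero])
    (fun r hr => isLevel_t.high _ _ r hr) (fun r s => ?_) (fun r s => ?_) 1 (-1) (fun u v => ?_)
    (fun u v => ?_), mul_one (t k p 1 0 1) ▸ Submodule.mul_mem_mul (hmem 1) (one_mem (Gam k p))⟩
  · rw [← sub_sub_cancel (t k p 1 0 r * t k p 1 1 s) (t k p 1 1 s * t k p 1 0 r), presented_t]
    exact sub_mem (Submodule.mul_mem_mul (hmem _) (t_mem_Gam _)) (Submodule.sum_mem _ fun a _ => sub_mem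
      (Submodule.mul_mem_mul (hmem _) (t_mem_Gam _)) (Submodule.mul_mem_mul (hmem _) (t_mem_Gam _)))
  · rw [← sub_sub_cancel (t k p 1 1 s * t k p 1 0 r) (t k p 1 0 r * t k p 1 1 s), presented_t]
    exact sub_mem (Submodule.mul_mem_mul (t_mem_Gam _) (hmem _)) (Submodule.sum_mem _ fun a _ => sub_mem
      (Submodule.mul_mem_mul (t_mem_Gam _) (hmem _)) (Submodule.mul_mem_mul (t_mem_Gam _) (hmem _)))
  · have := rtt_t (k := k) (p := p) 1 0 1 1 v u
    push_cast
    linear_combination (norm := module) this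
  · have := rtt_t (k := k) (p := p) 1 1 1 0 u v
    push_cast
    linear_combination (norm := module) -this

/-- Good bimodules are closed under sums and products, so it suffices to place the algebra
generators in them. -/
theorem exists_good (hβ : Generic β) (y : Y k p) : ∃ S, Good β γ S ∧ y ∈ S := by
  have hy : y ∈ Algebra.adjoin k (gens k p) := by rw [adjoin_gens]; trivial
  induction hy using Algebra.adjoin_induction with
  | mem g hg =>
    rcases hg with ⟨r, rfl⟩ | rfl | rfl
    · exact ⟨_, good_gamSub, t_mem_Gam r⟩
    · exact exists_good_one_zero hβ
    · exact exists_good_zero_one hβ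
  | algebraMap c => exact ⟨_, good_gamSub, Subalgebra.algebraMap_mem _ c⟩
  | add a b _ _ ha hb =>
    obtain ⟨S, hS, ha⟩ := ha
    obtain ⟨S', hS', hb⟩ := hb
    exact ⟨_, hS.sup hS', add_mem (Submodule.mem_sup_left ha) (Submodule.mem_sup_right hb)⟩
  | mul a b _ _ ha hb =>
    obtain ⟨S, hS, ha⟩ := ha
    obtain ⟨S', hS', hb⟩ := hb
    exact ⟨_, hS.mul hS', Submodule.mul_mem_mul ha hb⟩

end GoodBimodules

end Yangian

/-! ## The `Δ`-class of a generic maximal ideal -/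

namespace Yangian

set_option linter.unusedSectionVars false

open HarishChandra TensorProduct

/-- Nakayama's lemma for a vector space `V` with a left and a right action of a commutative algebra
`A`: if a finitely generated sub-bimodule `S` satisfies `S = n S + S m`, then each `a ∈ S`
satisfies `g a ∈ A a m` for some `g` that is congruent to `1` modulo `n`. -/
theorem exists_mem_span_of_le {k A V : Type*} [Field k] [CommRing A] [Algebra k A] [AddCommGroup V]
    [Module k V] (L R : A →ₐ[k] Module.End k V) (hcomm : ∀ g h, L g * R h = R h * L g)
    {m n : Ideal A} (hm : ∀ g, ∃ c : k, g - algebraMap k A c ∈ m) {S T : Submodule k V}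
    (hl : ∀ g, ∀ y ∈ S, L g y ∈ S) (hr : ∀ g, ∀ y ∈ S, R g y ∈ S) (hT : T.FG)
    (hST : ∀ y ∈ S, y ∈ Submodule.span k {y | ∃ g, ∃ x ∈ T, y = R g x}) (hTS : ∀ x ∈ T, x ∈ S)
    (h : S ≤ Submodule.span k {y | ∃ g ∈ n, ∃ x ∈ S, y = L g x} ⊔
      Submodule.span k {y | ∃ g ∈ m, ∃ x ∈ S, y = R g x}) {a : V} (ha : a ∈ S) :
    ∃ g : A, g - 1 ∈ n ∧ L g a ∈ Submodule.span k {y | ∃ g, ∃ h ∈ m, y = L g (R h a)} := by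
  -- The commuting left and right actions become one module structure over the commutative ring `A ⊗
  -- A`, where the usual Nakayama lemma applies with the ideal `n ⊗ A + A ⊗ m`.
  let φ : A ⊗[k] A →ₐ[k] Module.End k V := Algebra.TensorProduct.lift L R fun g h => hcomm g h
  let : Module (A ⊗[k] A) V := Module.compHom V φ.toRingHom
  have hsmul : ∀ (g h : A) (y : V), (g ⊗ₜ[k] h) • y = L g (R h y) := fun g h y =>
    LinearMap.congr_fun (Algebra.TensorProduct.lift_tmul L R (fun g h => hcomm g h) g h) y
  have hsc : ∀ (c : k) (y : V), algebraMap k (A ⊗[k] A) c • y = c • y := by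
    intro c y
    change φ (algebraMap k _ c) y = _
    rw [AlgHom.commutes]
    rfl
  have hcomm' : ∀ g h x, L g (R h x) = R h (L g x) := fun g h x =>
    LinearMap.congr_fun (hcomm g h) x
  let N : Submodule (A ⊗[k] A) V :=
    { S.toAddSubmonoid with
      smul_mem' := by
        intro r y hy
        change y ∈ S at hy
        change r • y ∈ S
        induction r using TensorProduct.induction_on with
        | zero => rw [zero_smul]; exact zero_mem S
        | tmul g h => rw [hsmul]; exact hl g _ (hr h _ hy)
        | add r s hr hs => rw [add_smul]; exact add_mem hr hs }
  have hres : ∀ (P : Submodule (A ⊗[k] A) V) (s : Set V), (∀ y ∈ s, y ∈ P) →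
      ∀ y ∈ Submodule.span k s, y ∈ P := by
    intro P s hs y hy
    induction hy using Submodule.span_induction with
    | mem x hx => exact hs x hx
    | zero => exact zero_mem _
    | add x y _ _ hx hy => exact add_mem hx hy
    | smul c x _ hx => rw [← hsc]; exact Submodule.smul_mem _ _ hx
  have hfg : N.FG := by
    obtain ⟨s, hs⟩ := hT
    refine ⟨s, le_antisymm (Submodule.span_le.2 fun y hy => ?_) fun y hy => ?_⟩
    · exact hTS y (hs ▸ Submodule.subset_span hy)
    · refine hres _ _ ?_ y (hST y hy)
      rintro _ ⟨g, x, hx, rfl⟩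
      have h1 := Submodule.smul_mem _ ((1 : A) ⊗ₜ[k] g)
        (hres (Submodule.span (A ⊗[k] A) (s : Set V)) s (fun y hy => Submodule.subset_span hy) x
          (hs ▸ hx))
      rwa [hsmul, map_one] at h1
  let I : Ideal (A ⊗[k] A) := Ideal.span
    ({x | ∃ g ∈ n, x = g ⊗ₜ[k] 1} ∪ {x | ∃ g ∈ m, x = 1 ⊗ₜ[k] g})
  have hle : N ≤ I • N := by
    intro y hy
    obtain ⟨b, hb, c, hc, rfl⟩ := Submodule.mem_sup.1 (h hy)
    refine add_mem (hres _ _ ?_ b hb) (hres _ _ ?_ c hc)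
    · rintro _ ⟨g, hg, x, hx, rfl⟩
      have h1 := Submodule.smul_mem_smul (N := N)
        (show g ⊗ₜ[k] (1 : A) ∈ I from Ideal.subset_span (Or.inl ⟨g, hg, rfl⟩)) hx
      rwa [hsmul, map_one] at h1
    · rintro _ ⟨g, hg, x, hx, rfl⟩
      have h1 := Submodule.smul_mem_smul (N := N)
        (show (1 : A) ⊗ₜ[k] g ∈ I from Ideal.subset_span (Or.inr ⟨g, hg, rfl⟩)) hx
      rwa [hsmul, map_one] at h1
  obtain ⟨r, hr1, hr0⟩ := Submodule.exists_sub_one_mem_and_smul_eq_zero_of_fg_of_le_smul I N hfg hle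
  set Q := Submodule.span k {y | ∃ g, ∃ h ∈ m, y = L g (R h a)} with hQ
  have hLQ : ∀ g, ∀ y ∈ Q, L g y ∈ Q := by
    intro g y hy
    refine (Submodule.span_le (p := Q.comap (L g))).2 ?_ hy
    rintro _ ⟨g', h, hh, rfl⟩
    exact Submodule.subset_span ⟨g * g', h, hh, by rw [map_mul]; rfl⟩
  have hRQ : ∀ g, ∀ y ∈ Q, R g y ∈ Q := by
    intro g y hy
    refine (Submodule.span_le (p := Q.comap (R g))).2 ?_ hy
    rintro _ ⟨g', h, hh, rfl⟩
    refine Submodule.subset_span ⟨g', g * h, m.mul_mem_left _ hh, ?_⟩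
    rw [map_mul, Module.End.mul_apply, hcomm' g' g]
  -- Modulo `Q = A a m` the right action on multiples of `a` is by scalars, because `A / m` is
  -- spanned by `1`; hence `n a + Q` is stable under `A ⊗ A`.
  have hstab : ∀ (z : A ⊗[k] A) (y : V), (∃ g ∈ n, y - L g a ∈ Q) →
      ∃ g ∈ n, z • y - L g a ∈ Q := by
    intro z y hy
    induction z using TensorProduct.induction_on with
    | zero => exact ⟨0, zero_mem n, by rw [zero_smul]; simp⟩
    | tmul g h =>
      obtain ⟨g', hg', h'⟩ := hy
      obtain ⟨c, hc⟩ := hm h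
      refine ⟨algebraMap k A c * (g * g'), n.mul_mem_left _ (n.mul_mem_left _ hg'), ?_⟩
      have h1 := hLQ g _ (hRQ h _ h')
      have h2 : L (g * g') (R (h - algebraMap k A c) a) ∈ Q :=
        Submodule.subset_span ⟨g * g', _, hc, rfl⟩
      have h3 := add_mem h1 h2
      rw [hsmul]
      convert h3 using 1
      simp only [map_mul, map_sub, AlgHom.commutes, LinearMap.sub_apply, Module.End.mul_apply,
        Module.algebraMap_end_apply, map_smul, hcomm' g' h]
      abel
    | add z w hz hw =>
      obtain ⟨g, hg, h1⟩ := hz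
      obtain ⟨g', hg', h2⟩ := hw
      refine ⟨g + g', add_mem hg hg', ?_⟩
      have h3 := add_mem h1 h2
      rw [add_smul]
      convert h3 using 1
      rw [map_add, LinearMap.add_apply]
      abel
  have hI : ∀ z ∈ I, ∃ g ∈ n, z • a - L g a ∈ Q := by
    intro z hz
    induction hz using Submodule.span_induction with
    | mem z hz =>
      rcases hz with ⟨g, hg, rfl⟩ | ⟨g, hg, rfl⟩
      · refine ⟨g, hg, ?_⟩
        rw [hsmul, map_one, Module.End.one_apply, sub_self]
        exact zero_mem _
      · refine ⟨0, zero_mem n, ?_⟩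
        rw [hsmul, map_zero, LinearMap.zero_apply, sub_zero]
        exact Submodule.subset_span ⟨1, g, hg, rfl⟩
    | zero => exact ⟨0, zero_mem n, by rw [zero_smul]; simp⟩
    | add z w _ _ hz hw =>
      obtain ⟨g, hg, h1⟩ := hz
      obtain ⟨g', hg', h2⟩ := hw
      refine ⟨g + g', add_mem hg hg', ?_⟩
      have h3 := add_mem h1 h2
      rw [add_smul]
      convert h3 using 1
      rw [map_add, LinearMap.add_apply]
      abel
    | smul c z _ hz =>
      rw [smul_eq_mul, mul_smul]
      exact hstab c _ hz
  obtain ⟨g, hg, h1⟩ := hI _ hr1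
  refine ⟨1 + g, by rwa [add_sub_cancel_left], ?_⟩
  rw [sub_smul, one_smul, hr0 a ha] at h1
  have h2 := neg_mem h1
  convert h2 using 1
  rw [map_add, LinearMap.add_apply, map_one, Module.End.one_apply]
  abel

/-- Such a `g` annihilates the subquotient, hence also the class of `1` in `A / n`. -/
theorem mem_of_subquotient {A V : Type*} [Ring A] [AddCommGroup V] [Module A V]
    {P Q : Submodule A V} {n : Ideal A} (e : (↥Q ⧸ P.submoduleOf Q) ≃ₗ[A] (A ⧸ n)) {g : A}
    (h : ∀ y ∈ Q, g • y ∈ P) : g ∈ n := by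
  obtain ⟨z, hz⟩ := e.surjective (Submodule.Quotient.mk (1 : A))
  obtain ⟨b, rfl⟩ := Submodule.Quotient.mk_surjective _ z
  have h0 := (Submodule.Quotient.mk_eq_zero (P.submoduleOf Q) (x := g • b)).2 (h b b.2)
  rw [Submodule.Quotient.mk_smul] at h0
  have h1 := congrArg e h0
  rw [map_smul, hz, map_zero, ← Submodule.Quotient.mk_smul, Submodule.Quotient.mk_eq_zero,
    smul_eq_mul, mul_one] at h1
  exact h1

/-! ### Links between maximal ideals of `Γ` stay inside the integral family -/

section Links
variable {k : Type u} [Field k] {p : ℕ} {β : Fin p → k} {γ : Fin (2 * p) → k}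

/-- The Nullstellensatz: `Γ` is a finitely generated commutative algebra over an algebraically
closed field. -/
theorem exists_scalar_of_isMaximal [IsAlgClosed k] {m : Ideal (Gam k p)} (hm : m.IsMaximal)
    (g : Gam k p) : ∃ c : k, g - algebraMap k (Gam k p) c ∈ m := by
  have hinf : Infinite k := IsAlgClosed.instInfinite
  let : Field (Gam k p ⧸ m) := Ideal.Quotient.field m
  have hfg : (Gam k p).FG := by
    refine Subalgebra.fg_def.2 ⟨_, ?_, rfl⟩
    refine Set.Finite.union ?_ ?_
    · exact ((Finset.Icc 1 p).finite_toSet.image (t k p 1 1)).subset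
        fun x ⟨r, hr, h⟩ => ⟨r, hr, h.symm⟩
    · exact ((Finset.Icc 1 (2 * p)).finite_toSet.image (d k p)).subset
        fun x ⟨r, hr, h⟩ => ⟨r, hr, h.symm⟩
  have hft : Algebra.FiniteType k (Gam k p) := (Subalgebra.fg_iff_finiteType _).1 hfg
  have hft' : Algebra.FiniteType k (Gam k p ⧸ m) :=
    hft.of_surjective (Ideal.Quotient.mkₐ k m) (Ideal.Quotient.mkₐ_surjective k m)
  have hfin : Module.Finite k (Gam k p ⧸ m) := finite_of_finite_type_of_isJacobsonRing k _
  have hint : Algebra.IsIntegral k (Gam k p ⧸ m) := Algebra.IsIntegral.of_finite k _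
  obtain ⟨c, hc⟩ := (IsAlgClosed.algebraMap_bijective_of_isIntegral (k := k)
    (K := Gam k p ⧸ m)).2 (Ideal.Quotient.mk m g)
  refine ⟨c, ?_⟩
  rw [← Ideal.Quotient.eq]
  exact hc.symm

variable [CharZero k]

theorem leftRight_mul_mem {a : Y k p} {m : Ideal (Gam k p)} {y : Y k p}
    (hy : y ∈ leftRight (Gam k p) a m) (h : Gam k p) :
    y * (h : Y k p) ∈ leftRight (Gam k p) a m := by
  induction hy using Submodule.span_induction with
  | mem y hy =>
    obtain ⟨g, hg, rfl⟩ := hy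
    refine Submodule.subset_span ⟨g * h, ?_, mul_assoc _ _ _⟩
    rw [gam_mul_comm]
    exact m.mul_mem_left h hg
  | zero => rw [zero_mul]; exact zero_mem _
  | add x y _ _ hx hy => rw [add_mul]; exact add_mem hx hy
  | smul c x _ hx => rw [smul_mul_assoc]; exact Submodule.smul_mem _ c hx

/-- By commutativity of `Γ`, such a `g` sends all of `Γ a Γ` into `Γ a 𝐦` and so acts by zero on
every subquotient, while it acts nontrivially on `Γ / 𝐧`. -/
theorem not_X_of_mul_mem {a : Y k p} {m n : Ideal (Gam k p)} {g : Gam k p} (hg : g ∉ n)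
    (h : (g : Y k p) * a ∈ leftRight (Gam k p) a m) : ¬ X (Gam k p) a m n := by
  rintro ⟨-, -, A, B, hA, -, hB, ⟨e⟩⟩
  have key : ∀ y ∈ leftRight (Gam k p) a ⊤, (g : Y k p) * y ∈ A := by
    intro y hy
    induction hy using Submodule.span_induction with
    | mem y hy =>
      obtain ⟨g', -, rfl⟩ := hy
      rw [← mul_assoc]
      exact hA (leftRight_mul_mem h g')
    | zero => rw [mul_zero]; exact zero_mem _
    | add x y _ _ hx hy => rw [mul_add]; exact add_mem hx hy
    | smul c x _ hx =>
      have e : (g : Y k p) * (c • x) = c • ((g : Y k p) * x) := by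
        change (g : Y k p) * ((c : Y k p) * x) = (c : Y k p) * ((g : Y k p) * x)
        rw [← mul_assoc, ← mul_assoc]
        exact congrArg (fun z : Gam k p => (z : Y k p) * x) (gam_mul_comm g c)
      rw [e]
      exact A.smul_mem c hx
  exact hg (mem_of_subquotient e fun y hy => key y (hB hy))

theorem exists_mul_mem_leftRight [IsAlgClosed k] {m n : Ideal (Gam k p)} (hm : m.IsMaximal)
    {S T : Submodule k (Y k p)} (hl : gamSub k p * S ≤ S) (hr : S * gamSub k p ≤ S) (hT : T.FG)
    (hST : S = T * gamSub k p) (h : S ≤ img n * S ⊔ S * img m) {a : Y k p} (ha : a ∈ S) :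
    ∃ g : Gam k p, g - 1 ∈ n ∧ (g : Y k p) * a ∈ leftRight (Gam k p) a m := by
  obtain ⟨g, hg, h1⟩ := exists_mem_span_of_le
    ((Algebra.lmul k (Y k p)).comp (Gam k p).val)
    (AlgHom.ofLinearMap ((LinearMap.mul k (Y k p)).flip ∘ₗ (Gam k p).val.toLinearMap)
      (by ext x; exact mul_one x)
      (fun g h => by
        ext x
        rw [gam_mul_comm]
        exact (mul_assoc x (h : Y k p) (g : Y k p)).symm))
    (fun g h => by
      ext x
      exact (mul_assoc (g : Y k p) x (h : Y k p)).symm)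
    (fun g => exists_scalar_of_isMaximal hm g) (n := n) (S := S) (T := T)
    (fun g y hy => hl (Submodule.mul_mem_mul g.2 hy))
    (fun g y hy => hr (Submodule.mul_mem_mul hy g.2)) hT
    (fun y hy => by
      rw [hST] at hy
      refine (Submodule.mul_le.2 (fun x hx g hg => ?_) : T * gamSub k p ≤ _) hy
      exact Submodule.subset_span ⟨⟨g, hg⟩, x, hx, rfl⟩)
    (fun x hx => by
      rw [hST, ← mul_one x]
      exact Submodule.mul_mem_mul hx (one_mem (Gam k p)))
    (h.trans (sup_le_sup (Submodule.mul_le.2 (by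
        rintro _ ⟨g, hg, rfl⟩ y hy
        exact Submodule.subset_span ⟨g, hg, y, hy, rfl⟩))
      (Submodule.mul_le.2 (by
        rintro y hy _ ⟨g, hg, rfl⟩
        exact Submodule.subset_span ⟨g, hg, y, hy, rfl⟩)))) ha
  refine ⟨g, hg, ?_⟩
  have h2 : Submodule.span k {y | ∃ g : Gam k p, ∃ h ∈ m, y = (g : Y k p) * (a * (h : Y k p))} ≤
      (leftRight (Gam k p) a m).restrictScalars k := by
    refine Submodule.span_le.2 ?_
    rintro _ ⟨g, h, hh, rfl⟩
    exact Submodule.smul_mem _ g (Submodule.subset_span ⟨h, hh, rfl⟩)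
  exact h2 h1

theorem sup_eq_top_of_ne {m n : Ideal (Gam k p)} (hm : m.IsMaximal) (hn : n.IsMaximal)
    (h : m ≠ n) : m ⊔ n = ⊤ := Ideal.IsMaximal.coprime_of_ne hm hn h

/-- Say `𝐦` is in the family and `𝐧` is not. Some product `J` of family ideals satisfies `J S ≤ S
𝐦`, and `𝐧 + J = Γ`, so `S = 𝐧 S + S 𝐦`. The other direction is symmetric. -/
theorem mem_range_of_X [IsAlgClosed k] (hp : 0 < p) (hβ : Generic β) {a : Y k p}
    {m n : Ideal (Gam k p)} (h : X (Gam k p) a m n) :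
    m ∈ Set.range (wtIdeal β γ) ↔ n ∈ Set.range (wtIdeal β γ) := by
  have hm : m.IsMaximal := h.1
  have hn : n.IsMaximal := h.2.1
  obtain ⟨S, hS, ha⟩ := exists_good (β := β) (γ := γ) hβ a
  -- Otherwise Nakayama yields `g ≡ 1` modulo `𝐧` with `g a ∈ Γ a 𝐦`, and this is incompatible with
  -- the link.
  have key : ¬ S ≤ img n * S ⊔ S * img m := by
    intro hle
    obtain ⟨T, hT, hST⟩ := hS.fg
    obtain ⟨g, hg, h1⟩ := exists_mul_mem_leftRight hm hS.left hS.right hT hST hle ha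
    refine not_X_of_mul_mem (fun hg' => hn.ne_top ?_) h1 h
    rw [Ideal.eq_top_iff_one]
    have h2 := sub_mem hg' hg
    rwa [sub_sub_cancel] at h2
  constructor
  · rintro ⟨b, rfl⟩
    by_contra hn'
    refine key ?_
    obtain ⟨J, hJ, hle⟩ := hS.move _ (img_mem_prods b)
    have h1 := one_le_sup_of_mem_prods (n := n) (fun b' => sup_eq_top_of_ne
      (wtIdeal_isMaximal hp hβ b') hn fun e => hn' ⟨b', e⟩) hJ
    calc S = 1 * S := (one_mul S).symm
      _ ≤ (img n ⊔ J) * S := mul_le_mul' h1 le_rfl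
      _ ≤ img n * S ⊔ S * img _ := by
        rw [Submodule.sup_mul]; exact sup_le_sup le_rfl hle
  · rintro ⟨b, rfl⟩
    by_contra hm'
    refine key ?_
    obtain ⟨J, hJ, hle⟩ := hS.move' _ (img_mem_prods b)
    have h1 := one_le_sup_of_mem_prods (n := m) (fun b' => sup_eq_top_of_ne
      (wtIdeal_isMaximal hp hβ b') hm fun e => hm' ⟨b', e⟩) hJ
    calc S = S * 1 := (mul_one S).symm
      _ ≤ S * (img m ⊔ J) := mul_le_mul' le_rfl h1
      _ ≤ img _ * S ⊔ S * img m := by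
        rw [Submodule.mul_sup, sup_comm]; exact sup_le_sup hle le_rfl

/-- The `Δ`-class of a generic maximal ideal. -/
theorem block_eq [IsAlgClosed k] (hp : 0 < p) (hβ : Generic β) :
    block (Gam k p) (iotaStar β γ) = Set.range (wtIdeal β γ) := by
  apply Set.Subset.antisymm
  · intro n hn
    have key : ∀ m n, Relation.EqvGen (fun m' n' => ∃ a : Y k p, X (Gam k p) a m' n') m n →
        (m ∈ Set.range (wtIdeal β γ) ↔ n ∈ Set.range (wtIdeal β γ)) := by
      intro m n h
      induction h with
      | rel m n h => obtain ⟨a, h⟩ := h; exact mem_range_of_X hp hβ h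
      | refl => exact Iff.rfl
      | symm _ _ _ h => exact h.symm
      | trans _ _ _ _ _ h h' => exact h.trans h'
    exact (key _ _ hn).1 ⟨0, wtIdeal_zero β γ⟩
  · rintro _ ⟨a, rfl⟩
    exact wtIdeal_mem_block hp hβ a

end Links

end Yangian

/-! ## Linear functors on the category `K_ℓ` -/

namespace Yangian

section FreeLinear
variable {k : Type u} [Field k] {C : Type} [Category.{0} C]

theorem free_hom_induction {X Y : C}
    {P : ((Free.embedding k C).obj X ⟶ (Free.embedding k C).obj Y) → Prop}
    (zero : P 0) (add : ∀ f g, P f → P g → P (f + g)) (smul : ∀ (c : k) f, P f → P (c • f))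
    (emb : ∀ f : X ⟶ Y, P ((Free.embedding k C).map f))
    (f : (Free.embedding k C).obj X ⟶ (Free.embedding k C).obj Y) : P f :=
  Finsupp.induction_linear (ι := X ⟶ Y) (M := k) (motive := P) f zero add fun g c =>
    (congrArg P (show c • (Free.embedding k C).map g = (Finsupp.single g c : (X ⟶ Y) →₀ k) from
      (Finsupp.smul_single c g (1 : k)).trans
        (congrArg (Finsupp.single g) (mul_one c)))).mp (smul c _ (emb g))

variable {D : Type*} [Category.{v} D] [Preadditive D] [Linear k D] (F : C ⥤ D)

/-- The linear extension of a functor, on morphisms. -/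
def freeLiftMap (X Y : C) :
    ((Free.embedding k C).obj X ⟶ (Free.embedding k C).obj Y) →ₗ[k] (F.obj X ⟶ F.obj Y) :=
  Finsupp.linearCombination k (fun f : X ⟶ Y => F.map f)

theorem freeLiftMap_emb {X Y : C} (f : X ⟶ Y) :
    freeLiftMap F X Y ((Free.embedding k C).map f) = F.map f :=
  (Finsupp.linearCombination_single k 1 f).trans (one_smul k _)

theorem freeLiftMap_comp {X Y Z : C}
    (f : (Free.embedding k C).obj X ⟶ (Free.embedding k C).obj Y)
    (g : (Free.embedding k C).obj Y ⟶ (Free.embedding k C).obj Z) :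
    freeLiftMap F X Z (f ≫ g) = freeLiftMap F X Y f ≫ freeLiftMap F Y Z g := by
  induction f using free_hom_induction with
  | zero => rw [Limits.zero_comp, map_zero, map_zero, Limits.zero_comp]
  | add f f' h h' => rw [Preadditive.add_comp, map_add, map_add, Preadditive.add_comp, h, h']
  | smul c f h => rw [Linear.smul_comp, map_smul, map_smul, Linear.smul_comp, h]
  | emb f =>
    induction g using free_hom_induction with
    | zero => rw [Limits.comp_zero, map_zero, map_zero, Limits.comp_zero]
    | add g g' h h' => rw [Preadditive.comp_add, map_add, map_add, Preadditive.comp_add, h, h']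
    | smul c g h => rw [Linear.comp_smul, map_smul, map_smul, Linear.comp_smul, h]
    | emb g =>
      rw [freeLiftMap_emb, freeLiftMap_emb, ← F.map_comp, ← Functor.map_comp, freeLiftMap_emb]

/-- The linear extension of a functor. -/
def freeLift : Free k C ⥤ D where
  obj := F.obj
  map f := freeLiftMap F _ _ f
  map_id _ := (freeLiftMap_emb (C := C) F (𝟙 _)).trans (F.map_id _)
  map_comp f g := freeLiftMap_comp F f g

end FreeLinear

/-! ### Functors and natural transformations on `K_ℓ` from generators -/

section KCategory
variable {k : Type u} [Field k] {p : ℕ} (β : Fin p → k) (γ : Fin (2 * p) → k)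

/-- The object `a ∈ ℤ^p` of `K_ℓ`. -/
def kob (a : Ob p) : K β γ := (Quotient.functor (KRel β γ)).obj (ob k a)

/-- The morphism `f_i(a)` of `K_ℓ`. -/
def kf (i : Fin p) {a b : Ob p} (h : b = up i a) : kob β γ a ⟶ kob β γ b :=
  (Quotient.functor (KRel β γ)).map (fHom k i h)

/-- The morphism `e_i(a)` of `K_ℓ`. -/
def ke (i : Fin p) {a b : Ob p} (h : b = down i a) : kob β γ a ⟶ kob β γ b :=
  (Quotient.functor (KRel β γ)).map (eHom k i h)

variable {β γ}

/-- The morphisms of `K_ℓ` are generated by the `f_i` and the `e_i`. -/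
theorem k_hom_induction {a : Ob p} {P : ∀ b : Ob p, (kob β γ a ⟶ kob β γ b) → Prop}
    (id : P a (𝟙 _)) (zero : ∀ b, P b 0) (add : ∀ b g h, P b g → P b h → P b (g + h))
    (smul : ∀ b (c : k) g, P b g → P b (c • g))
    (f : ∀ i {b c : Ob p} (h : c = up i b) g, P b g → P c (g ≫ kf β γ i h))
    (e : ∀ i {b c : Ob p} (h : c = down i b) g, P b g → P c (g ≫ ke β γ i h))
    {b : Ob p} (g : kob β γ a ⟶ kob β γ b) : P b g := by
  obtain ⟨g, rfl⟩ := (Quotient.functor (KRel β γ)).map_surjective g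
  refine free_hom_induction (C := Paths (Ob p)) (X := a) (Y := b)
    (P := fun g => P b ((Quotient.functor (KRel β γ)).map g)) ?_ ?_ ?_ ?_ g
  · exact (congrArg (P b) ((Quotient.functor (KRel β γ)).map_zero (ob k a) (ob k b))).mpr (zero b)
  · intro (g : ob k a ⟶ ob k b) (h : ob k a ⟶ ob k b) hg hh
    exact (congrArg (P b) ((Quotient.functor (KRel β γ)).map_add (f := g) (g := h))).mpr
      (add b _ _ hg hh)
  · intro c g hg
    exact smul b c _ hg
  · clear g
    intro (g : Quiver.Path (V := Ob p) a b)
    induction g with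
    | nil => exact id
    | @cons b c g s ih =>
      have key : (Quotient.functor (KRel β γ)).map
          ((Free.embedding k (Paths (Ob p))).map (Quiver.Path.cons g s)) =
          (Quotient.functor (KRel β γ)).map ((Free.embedding k (Paths (Ob p))).map g) ≫
          (Quotient.functor (KRel β γ)).map
            ((Free.embedding k (Paths (Ob p))).map ((Paths.of (Ob p)).map s)) :=
        (congrArg (Quotient.functor (KRel β γ)).map
          ((Free.embedding k (Paths (Ob p))).map_comp g ((Paths.of (Ob p)).map s))).trans
            (Functor.map_comp _ _ _)
      refine (congrArg (P c) key).mpr ?_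
      change Arrow b c at s
      cases s with
      | f i h => exact f i h _ ih
      | e i h => exact e i h _ ih

/-- A representation of the generators and relations of `K_ℓ`. -/
structure KRep (β : Fin p → k) (γ : Fin (2 * p) → k) where
  W : Ob p → ModuleCat.{u} k
  F : ∀ (i : Fin p) {a b : Ob p}, b = up i a → (W a ⟶ W b)
  E : ∀ (i : Fin p) {a b : Ob p}, b = down i a → (W a ⟶ W b)
  ff : ∀ (i j : Fin p) {a b b' c : Ob p} (h₁ : b = up i a) (h₂ : c = up j b)
      (h₃ : b' = up j a) (h₄ : c = up i b'), F i h₁ ≫ F j h₂ = F j h₃ ≫ F i h₄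
  ee : ∀ (i j : Fin p) {a b b' c : Ob p} (h₁ : b = down i a) (h₂ : c = down j b)
      (h₃ : b' = down j a) (h₄ : c = down i b'), E i h₁ ≫ E j h₂ = E j h₃ ≫ E i h₄
  ef : ∀ (i j : Fin p) (_ : i ≠ j) {a b b' c : Ob p} (h₁ : b = up j a) (h₂ : c = down i b)
      (h₃ : b' = down i a) (h₄ : c = up j b'), F j h₁ ≫ E i h₂ = E i h₃ ≫ F j h₄
  ef_same : ∀ (i : Fin p) {a b : Ob p} (h₁ : b = up i a) (h₂ : a = down i b),
      F i h₁ ≫ E i h₂ = (-gam γ (-β i - ((a i : ℤ) : k))) • 𝟙 (W a)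
  fe_same : ∀ (i : Fin p) {a b : Ob p} (h₁ : b = down i a) (h₂ : a = up i b),
      E i h₁ ≫ F i h₂ = (-gam γ (-β i - ((a i : ℤ) : k) + 1)) • 𝟙 (W a)

namespace KRep
variable (ρ : KRep β γ)

/-- The functor on paths given by a representation. -/
def pathFunctor : Paths (Ob p) ⥤ ModuleCat.{u} k :=
  Paths.lift
    { obj := ρ.W
      map := fun s => match s with
        | Arrow.f i h => ρ.F i h
        | Arrow.e i h => ρ.E i h }

theorem pathFunctor_f (i : Fin p) {a b : Ob p} (h : b = up i a) :
    (freeLift (k := k) ρ.pathFunctor).map (fHom k i h) = ρ.F i h :=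
  (freeLiftMap_emb ρ.pathFunctor _).trans (Paths.lift_toPath _ _)

theorem pathFunctor_e (i : Fin p) {a b : Ob p} (h : b = down i a) :
    (freeLift (k := k) ρ.pathFunctor).map (eHom k i h) = ρ.E i h :=
  (freeLiftMap_emb ρ.pathFunctor _).trans (Paths.lift_toPath _ _)

theorem rel_map {X Y : FreeK k p} {g h : X ⟶ Y} (hr : KRel β γ g h) :
    (freeLift (k := k) ρ.pathFunctor).map g = (freeLift ρ.pathFunctor).map h := by
  induction hr with
  | ff i j h₁ h₂ h₃ h₄ =>
    simp only [Functor.map_comp, pathFunctor_f]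
    exact ρ.ff i j h₁ h₂ h₃ h₄
  | ee i j h₁ h₂ h₃ h₄ =>
    simp only [Functor.map_comp, pathFunctor_e]
    exact ρ.ee i j h₁ h₂ h₃ h₄
  | ef i j hij h₁ h₂ h₃ h₄ =>
    simp only [Functor.map_comp, pathFunctor_e, pathFunctor_f]
    exact ρ.ef i j hij h₁ h₂ h₃ h₄
  | @ef_same i a b h₁ h₂ =>
    rw [Functor.map_comp, pathFunctor_e, pathFunctor_f]
    refine (ρ.ef_same i h₁ h₂).trans ?_
    refine Eq.trans ?_ (map_smul (freeLiftMap (k := k) ρ.pathFunctor a a) _ _).symm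
    congr 1
    exact ((freeLift (k := k) ρ.pathFunctor).map_id (ob k a)).symm
  | @fe_same i a b h₁ h₂ =>
    rw [Functor.map_comp, pathFunctor_e, pathFunctor_f]
    refine (ρ.fe_same i h₁ h₂).trans ?_
    refine Eq.trans ?_ (map_smul (freeLiftMap (k := k) ρ.pathFunctor a a) _ _).symm
    congr 1
    exact ((freeLift (k := k) ρ.pathFunctor).map_id (ob k a)).symm
  | refl g => rfl
  | symm _ h => exact h.symm
  | trans _ _ h h' => exact h.trans h'
  | precomp l _ h => rw [Functor.map_comp, Functor.map_comp, h]
  | postcomp l _ h => rw [Functor.map_comp, Functor.map_comp, h]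
  | @add x y g₁ g₂ h₁ h₂ _ _ h h' =>
    exact (map_add (freeLiftMap (k := k) ρ.pathFunctor x y) g₁ h₁).trans
      ((congrArg₂ _ h h').trans (map_add (freeLiftMap (k := k) ρ.pathFunctor x y) g₂ h₂).symm)
  | @smul c x y g h _ hr =>
    exact (map_smul (freeLiftMap (k := k) ρ.pathFunctor x y) c g).trans
      ((congrArg _ hr).trans (map_smul (freeLiftMap (k := k) ρ.pathFunctor x y) c h).symm)

/-- The functor on `K_ℓ` given by a representation. -/
def functor : K β γ ⥤ ModuleCat.{u} k :=
  CategoryTheory.Quotient.lift _ (freeLift (k := k) ρ.pathFunctor) fun _ _ _ _ h => ρ.rel_map h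

theorem functor_kf (i : Fin p) {a b : Ob p} (h : b = up i a) :
    ρ.functor.map (kf β γ i h) = ρ.F i h := ρ.pathFunctor_f i h

theorem functor_ke (i : Fin p) {a b : Ob p} (h : b = down i a) :
    ρ.functor.map (ke β γ i h) = ρ.E i h := ρ.pathFunctor_e i h

instance : ρ.functor.Additive where
  map_add {X Y g h} := by
    obtain ⟨g, rfl⟩ := (Quotient.functor (KRel β γ)).map_surjective g
    obtain ⟨h, rfl⟩ := (Quotient.functor (KRel β γ)).map_surjective h
    rw [← (Quotient.functor (KRel β γ)).map_add]
    exact map_add (freeLiftMap (k := k) ρ.pathFunctor X.as Y.as) g h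

instance : ρ.functor.Linear k where
  map_smul {X Y} g c := by
    obtain ⟨g, rfl⟩ := (Quotient.functor (KRel β γ)).map_surjective g
    exact map_smul (freeLiftMap (k := k) ρ.pathFunctor X.as Y.as) c g

end KRep

/-- A family of maps that is compatible with the generators is a natural transformation. -/
theorem k_natural {V W : K β γ ⥤ ModuleCat.{u} k} [V.Additive] [V.Linear k] [W.Additive]
    [W.Linear k] (η : ∀ a : Ob p, V.obj (kob β γ a) ⟶ W.obj (kob β γ a))
    (hf : ∀ i {a b : Ob p} (h : b = up i a), V.map (kf β γ i h) ≫ η b = η a ≫ W.map (kf β γ i h))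
    (he : ∀ i {a b : Ob p} (h : b = down i a),
      V.map (ke β γ i h) ≫ η b = η a ≫ W.map (ke β γ i h))
    {a b : Ob p} (g : kob β γ a ⟶ kob β γ b) : V.map g ≫ η b = η a ≫ W.map g := by
  induction g using k_hom_induction with
  | id => rw [V.map_id, W.map_id, Category.id_comp, Category.comp_id]
  | zero b => rw [V.map_zero, W.map_zero, Limits.zero_comp, Limits.comp_zero]
  | add b g h hg hh =>
    rw [V.map_add, W.map_add, Preadditive.add_comp, Preadditive.comp_add, hg, hh]
  | smul b c g hg => rw [V.map_smul, W.map_smul, Linear.smul_comp, Linear.comp_smul, hg]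
  | f i h g hg =>
    rw [V.map_comp, W.map_comp, Category.assoc, hf, ← Category.assoc, hg, Category.assoc]
  | e i h g hg =>
    rw [V.map_comp, W.map_comp, Category.assoc, he, ← Category.assoc, hg, Category.assoc]

/-- A natural transformation defined on the generators. -/
def kNatTrans {V W : K β γ ⥤ ModuleCat.{u} k} [V.Additive] [V.Linear k] [W.Additive]
    [W.Linear k] (η : ∀ a : Ob p, V.obj (kob β γ a) ⟶ W.obj (kob β γ a))
    (hf : ∀ i {a b : Ob p} (h : b = up i a), V.map (kf β γ i h) ≫ η b = η a ≫ W.map (kf β γ i h))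
    (he : ∀ i {a b : Ob p} (h : b = down i a),
      V.map (ke β γ i h) ≫ η b = η a ≫ W.map (ke β γ i h)) : V ⟶ W where
  app X := η X.as
  naturality X Y g := k_natural η hf he (a := X.as) (b := Y.as) g

end KCategory

end Yangian

/-! ## Weight modules -/

namespace Yangian

set_option linter.unusedSectionVars false

open HarishChandra

section WeightModules
variable {k : Type u} [Field k] [CharZero k] {p : ℕ} {β : Fin p → k} {γ : Fin (2 * p) → k}
variable {M : Type*} [AddCommGroup M] [Module k M] [Module (Y k p) M] [IsScalarTower k (Y k p) M]

/-- The projections to the weight spaces. -/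
theorem exists_proj (hβ : Generic β) (hM : IsWt β γ M) (a : Fin p → ℤ) :
    ∃ ψ : M →ₗ[k] M, (∀ b, ∀ x ∈ wtSpace β γ M b, ψ x = if b = a then x else 0) ∧
      ∀ (g : Gam k p) x, ψ ((g : Y k p) • x) = (g : Y k p) • ψ x := by
  obtain ⟨ψ, hψ⟩ := exists_diag hβ hM fun b => if b = a then 1 else 0
  refine ⟨ψ, fun b x hx => ?_, diag_smul_gam hM hψ⟩
  rw [hψ b x hx]
  split_ifs
  · exact one_smul k x
  · exact zero_smul k x

theorem proj_sum {a : Fin p → ℤ} {ψ : M →ₗ[k] M}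
    (hψ : ∀ b, ∀ x ∈ wtSpace β γ M b, ψ x = if b = a then x else 0)
    {f : (Fin p → ℤ) →₀ M} (hf : ∀ b, f b ∈ wtSpace β γ M b) :
    ψ (f.sum fun _ x => x) = f a := by
  rw [Finsupp.sum, map_sum, Finset.sum_congr rfl fun b _ => hψ b _ (hf b), Finset.sum_ite_eq']
  split_ifs with h
  · rfl
  · exact (Finsupp.notMem_support_iff.1 h).symm

theorem IsWt.exists_decomp (hM : IsWt β γ M) (x : M) :
    ∃ f : (Fin p → ℤ) →₀ M, (∀ b, f b ∈ wtSpace β γ M b) ∧ (f.sum fun _ x => x) = x := by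
  rw [← Submodule.mem_iSup_iff_exists_finsupp]
  rw [show ⨆ a, wtSpace β γ M a = ⊤ from hM]
  trivial

theorem pow_sup_eq_top {m n : Ideal (Gam k p)} (h : m ⊔ n = ⊤) (i : ℕ) : m ^ i ⊔ n = ⊤ :=
  Ideal.pow_sup_eq_top h

/-- An element of a weight module that is killed by a power of a maximal ideal. -/
theorem eq_zero_or_mem_wtSpace (hp : 0 < p) (hβ : Generic β) (hM : IsWt β γ M)
    {m : Ideal (Gam k p)} (hm : m.IsMaximal) {x : M} {i : ℕ}
    (hx : ∀ g ∈ m ^ i, (g : Y k p) • x = 0) :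
    x = 0 ∨ ∃ a, m = wtIdeal β γ a ∧ x ∈ wtSpace β γ M a := by
  obtain ⟨f, hf, rfl⟩ := hM.exists_decomp x
  -- For `𝐦` different from the ideal of `b`, a power of `𝐦` is comaximal with that ideal. So `1` is
  -- a sum of two elements that both kill the component of weight `b`.
  have key : ∀ b, m ≠ wtIdeal β γ b → f b = 0 := by
    intro b hb
    obtain ⟨ψ, hψ, hψ'⟩ := exists_proj hβ hM b
    have h1 : m ^ i ⊔ wtIdeal β γ b = ⊤ :=
      pow_sup_eq_top (sup_eq_top_of_ne hm (wtIdeal_isMaximal hp hβ b) hb) i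
    obtain ⟨g, hg, g', hg', h2⟩ := Submodule.mem_sup.1 ((Ideal.eq_top_iff_one _).1 h1)
    have h3 := hψ' g (f.sum fun _ x => x)
    rw [hx g hg, map_zero, proj_sum hψ hf] at h3
    have h4 := mem_wtSpace_iff.1 (hf b) g' hg'
    calc f b = ((1 : Gam k p) : Y k p) • f b := by rw [OneMemClass.coe_one, one_smul]
      _ = (g : Y k p) • f b + (g' : Y k p) • f b := by rw [← h2, AddMemClass.coe_add, add_smul]
      _ = 0 := by rw [← h3, h4, add_zero]
  by_cases h : ∃ a, m = wtIdeal β γ a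
  · obtain ⟨a, rfl⟩ := h
    refine Or.inr ⟨a, rfl, ?_⟩
    rw [Finsupp.sum]
    refine Submodule.sum_mem _ fun b _ => ?_
    by_cases hab : b = a
    · exact hab ▸ hf b
    · rw [key b fun h => hab (wtIdeal_injective hp hβ h).symm]
      exact zero_mem _
  · push Not at h
    left
    rw [Finsupp.sum]
    exact Finset.sum_eq_zero fun b _ => key b (h b)

theorem mem_component_wtIdeal (hp : 0 < p) (hβ : Generic β) (hM : IsWt β γ M) {a : Fin p → ℤ}
    {x : M} : x ∈ component (Gam k p) M (wtIdeal β γ a) ↔ x ∈ wtSpace β γ M a := by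
  constructor
  · rintro ⟨i, hi⟩
    rcases eq_zero_or_mem_wtSpace hp hβ hM (wtIdeal_isMaximal hp hβ a) hi with rfl | ⟨b, hb, hx⟩
    · exact zero_mem _
    · rwa [wtIdeal_injective hp hβ hb]
  · intro hx
    refine ⟨1, fun g hg => mem_wtSpace_iff.1 hx g ?_⟩
    rwa [pow_one] at hg

theorem component_eq_bot (hp : 0 < p) (hβ : Generic β) (hM : IsWt β γ M) {m : Ideal (Gam k p)}
    (hm : m.IsMaximal) (h : m ∉ Set.range (wtIdeal β γ)) : component (Gam k p) M m = ⊥ := by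
  rw [eq_bot_iff]
  rintro x ⟨i, hi⟩
  rcases eq_zero_or_mem_wtSpace hp hβ hM hm hi with rfl | ⟨b, hb, -⟩
  · exact zero_mem _
  · exact (h ⟨b, hb.symm⟩).elim

/-- Every nonzero component is a weight space of the integral family, so directness over all of `Sp
Γ` reduces to the projections onto these weight spaces. -/
theorem isInternal_component (hp : 0 < p) (hβ : Generic β) (hM : IsWt β γ M) :
    DirectSum.IsInternal (fun m : Sp (Gam k p) => component (Gam k p) M m.1) := by
  have hind : iSupIndep (fun m : Sp (Gam k p) => component (Gam k p) M m.1) := by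
    intro m
    rw [AddSubgroup.disjoint_def]
    rintro x ⟨i, hi⟩ hx'
    rcases eq_zero_or_mem_wtSpace hp hβ hM m.2 hi with rfl | ⟨a, ha, hx⟩
    · rfl
    obtain ⟨ψ, hψ, -⟩ := exists_proj hβ hM a
    have hle : ⨆ (n : Sp (Gam k p)) (_ : n ≠ m), component (Gam k p) M n.1 ≤
        ψ.toAddMonoidHom.ker := by
      refine iSup₂_le fun n hn => ?_
      rintro y ⟨j, hj⟩
      rcases eq_zero_or_mem_wtSpace hp hβ hM n.2 hj with rfl | ⟨b, hb, hy⟩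
      · exact zero_mem _
      · refine (hψ b y hy).trans (if_neg ?_)
        rintro rfl
        exact hn (Subtype.ext (hb.trans ha.symm))
    have h1 : ψ x = 0 := hle hx'
    rwa [hψ a x hx, if_pos rfl] at h1
  refine ⟨hind.dfinsuppSumAddHom_injective, ?_⟩
  rw [← AddMonoidHom.mrange_eq_top, eq_top_iff]
  intro x _
  obtain ⟨f, hf, rfl⟩ := hM.exists_decomp x
  rw [Finsupp.sum]
  refine sum_mem fun b _ => ?_
  refine ⟨DirectSum.of (fun m : Sp (Gam k p) => component (Gam k p) M m.1)
    ⟨wtIdeal β γ b, wtIdeal_isMaximal hp hβ b⟩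
    ⟨f b, (mem_component_wtIdeal hp hβ hM).2 (hf b)⟩, ?_⟩
  rw [DirectSum.coeAddMonoidHom_of]

/-- The objects of the category `R_ℓ`. -/
theorem isWeight_iff [IsAlgClosed k] (hp : 0 < p) (hβ : Generic β) :
    (IsHarishChandra (Gam k p) M ∧ IsWeight (Gam k p) M ∧
      support (Gam k p) M ⊆ block (Gam k p) (iotaStar β γ)) ↔
      Module.Finite (Y k p) M ∧ IsWt β γ M := by
  rw [block_eq hp hβ]
  constructor
  · rintro ⟨⟨hfin, hint⟩, hw, hs⟩
    refine ⟨hfin, ?_⟩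
    rw [IsWt, eq_top_iff]
    rintro x -
    obtain ⟨y, rfl⟩ := hint.2 x
    induction y using DirectSum.induction_on with
    | zero => rw [map_zero]; exact zero_mem _
    | of m y =>
      rw [DirectSum.coeAddMonoidHom_of]
      by_cases h0 : component (Gam k p) M m.1 = ⊥
      · have : (y : M) ∈ (⊥ : AddSubgroup M) := h0 ▸ y.2
        rw [AddSubgroup.mem_bot.1 this]
        exact zero_mem _
      · obtain ⟨a, ha⟩ := hs ⟨m.2, h0⟩
        refine Submodule.mem_iSup_of_mem a (mem_wtSpace_iff.2 fun g hg => ?_)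
        exact hw m.1 m.2 y y.2 g (ha ▸ hg)
    | add x y hx hy => rw [map_add]; exact add_mem hx hy
  · rintro ⟨hfin, hM⟩
    refine ⟨⟨hfin, isInternal_component hp hβ hM⟩, fun m hm x hx g hg => ?_, ?_⟩
    · obtain ⟨i, hi⟩ := hx
      rcases eq_zero_or_mem_wtSpace hp hβ hM hm hi with rfl | ⟨b, rfl, hx⟩
      · exact smul_zero _
      · exact mem_wtSpace_iff.1 hx g hg
    · rintro m ⟨hm, hm'⟩
      by_contra h
      exact hm' (component_eq_bot hp hβ hM hm h)

/-! ### The operators `e_i` and `f_i` -/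

theorem lower_shift (u v : k) :
    (u - v) • (ev p (t k p 1 1) u * ev p (t k p 1 0) v - ev p (t k p 1 0) v * ev p (t k p 1 1) u) =
      ((1 : ℤ) : k) • (ev p (t k p 1 0) v * ev p (t k p 1 1) u -
        ev p (t k p 1 0) u * ev p (t k p 1 1) v) := by
  have := rtt_t (k := k) (p := p) 1 0 1 1 v u
  push_cast
  linear_combination (norm := module) this

theorem upper_shift (u v : k) :
    (u - v) • (ev p (t k p 1 1) u * ev p (t k p 0 1) v - ev p (t k p 0 1) v * ev p (t k p 1 1) u) =
      ((-1 : ℤ) : k) • (ev p (t k p 0 1) v * ev p (t k p 1 1) u -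
        ev p (t k p 0 1) u * ev p (t k p 1 1) v) := by
  rw [rtt_t 1 1 0 1 u v]
  push_cast
  module

/-- The abstract eigenvalue computation applied to `T₂₂(u) x(v) w`; the quantum determinant is
central, so its eigenvalue is unchanged. -/
theorem shift_smul_mem {x : ℕ → Y k p} {ε : ℤ}
    (h : ∀ u v : k, (u - v) • (ev p (t k p 1 1) u * ev p x v - ev p x v * ev p (t k p 1 1) u) =
      (ε : k) • (ev p x v * ev p (t k p 1 1) u - ev p x u * ev p (t k p 1 1) v))
    (i : Fin p) {a : Fin p → ℤ} {w : M} (hw : w ∈ wtSpace β γ M a) :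
    ev p x (- shift β a i) • w ∈ wtSpace β γ M (a + Pi.single i ε) := by
  refine ⟨shift_eigen (β := β) (a := a) (ε := ε)
    (g := fun u v => ev p (t k p 1 1) u • ev p x v • w) (w := fun v => ev p x v • w) (n := p + 1)
    (fun v => ?_) (fun u v => ?_) i, fun u => ?_⟩
  · simp only [ev_smul _ _ (_ • w)]
    exact isPoly_ev _ _
  · have h2 := congrArg (· • w) (h u v)
    simp only [smul_assoc, sub_smul, mul_smul, hw.1, smul_comm_scalar (ev p x _)] at h2
    generalize ev p (t k p 1 1) u • ev p x v • w = y₁ at h2 ⊢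
    generalize ev p x v • w = y₂ at h2 ⊢
    generalize ev p x u • w = y₃ at h2 ⊢
    linear_combination (norm := module) h2
  · rw [← mul_smul, qD_commute, mul_smul, hw.2, smul_comm_scalar]

theorem lower_smul_mem (i : Fin p) {a : Fin p → ℤ} {w : M} (hw : w ∈ wtSpace β γ M a) :
    ev p (t k p 1 0) (- shift β a i) • w ∈ wtSpace β γ M (a + Pi.single i 1) :=
  shift_smul_mem lower_shift i hw

theorem upper_smul_mem (i : Fin p) {a : Fin p → ℤ} {w : M} (hw : w ∈ wtSpace β γ M a) :
    ev p (t k p 0 1) (- shift β a i) • w ∈ wtSpace β γ M (a - Pi.single i 1) := by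
  rw [sub_eq_add_neg, ← Pi.single_neg]
  exact shift_smul_mem upper_shift i hw

/-- In the RTT relation of `T₂₁` and `T₁₂` at two nodes, both products on the right end with `T₂₂`
at a node of `w` and vanish; the factor `u - v` is nonzero at distinct nodes. -/
theorem upper_lower_comm (hβ : Generic β) {i j : Fin p} (hij : i ≠ j) {a : Fin p → ℤ} {w : M}
    (hw : w ∈ wtSpace β γ M a) :
    ev p (t k p 0 1) (- shift β a i) • ev p (t k p 1 0) (- shift β a j) • w =
      ev p (t k p 1 0) (- shift β a j) • ev p (t k p 0 1) (- shift β a i) • w := by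
  have h := congrArg (· • w) (rtt_t (k := k) (p := p) 1 0 0 1 (- shift β a j) (- shift β a i))
  simp only [smul_assoc, sub_smul, mul_smul, hw.1, eig_node, zero_smul, smul_zero, sub_zero] at h
  rw [← sub_smul] at h
  have hne : - shift β a j - - shift β a i ≠ 0 := sub_ne_zero.2 fun e => hij (hβ.injective a e.symm)
  exact (sub_eq_zero.1 ((smul_eq_zero.1 h).resolve_left hne)).symm

/-- The second expression of `D(u)` is used because its diagonal term ends with `T₂₂(u)`, which
kills `w` at the node. -/
theorem upper_lower_same (i : Fin p) {a : Fin p → ℤ} {w : M} (hw : w ∈ wtSpace β γ M a) :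
    ev p (t k p 0 1) (- shift β a i - 1) • ev p (t k p 1 0) (- shift β a i) • w =
      (-gam γ (- shift β a i)) • w := by
  have h := congrArg (· • w) ((rtt_t (k := k) (p := p) 1 0 0 1).qD_eq (- shift β a i))
  simp only [sub_smul, mul_smul, hw.1, hw.2, eig_node, zero_smul, smul_zero, zero_sub] at h
  rw [neg_smul, h, neg_neg]

/-- Evaluating the definition of `D(u)` one step above the node makes its diagonal term end with
`T₂₂` at the node. -/
theorem lower_upper_same (i : Fin p) {a : Fin p → ℤ} {w : M} (hw : w ∈ wtSpace β γ M a) :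
    ev p (t k p 1 0) (- shift β a i + 1) • ev p (t k p 0 1) (- shift β a i) • w =
      (-gam γ (- shift β a i + 1)) • w := by
  have h := hw.2 (- shift β a i + 1)
  rw [qD] at h
  simp only [sub_smul, mul_smul, add_sub_cancel_right, hw.1, eig_node, zero_smul, smul_zero,
    zero_sub] at h
  rw [neg_smul, ← h, neg_neg]

end WeightModules

end Yangian

/-! ## From weight modules to modules over `K_ℓ` -/

namespace Yangian

set_option linter.unusedSectionVars false

section Generic
variable {k : Type u} [Field k] [CharZero k] {p : ℕ} {β : Fin p → k} {γ : Fin (2 * p) → k}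
variable {M : Type*} [AddCommGroup M] [Module k M] [Module (Y k p) M] [IsScalarTower k (Y k p) M]
variable {N : Type*} [AddCommGroup N] [Module k N] [Module (Y k p) N] [IsScalarTower k (Y k p) N]

variable (β γ M) in
/-- The operator `f_i` on the weight spaces. -/
def wtF (i : Fin p) {a b : Ob p} (h : b = up i a) : wtSpace β γ M a →ₗ[k] wtSpace β γ M b :=
  (Algebra.lsmul k k M (ev p (t k p 1 0) (- shift β a i))).restrict fun _ hw =>
    h ▸ lower_smul_mem i hw

variable (β γ M) in
/-- The operator `e_i` on the weight spaces. -/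
def wtE (i : Fin p) {a b : Ob p} (h : b = down i a) : wtSpace β γ M a →ₗ[k] wtSpace β γ M b :=
  (Algebra.lsmul k k M (ev p (t k p 0 1) (- shift β a i))).restrict fun _ hw =>
    h ▸ upper_smul_mem i hw

theorem shift_up_of_ne {i j : Fin p} (hij : j ≠ i) {a b : Ob p} (h : b = up i a) :
    shift β b j = shift β a j := by
  subst h
  exact shift_add_single_of_ne a hij 1

theorem shift_down_of_ne {i j : Fin p} (hij : j ≠ i) {a b : Ob p} (h : b = down i a) :
    shift β b j = shift β a j := by
  subst h
  exact shift_sub_single_of_ne a hij 1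

theorem shift_up (i : Fin p) {a b : Ob p} (h : b = up i a) : shift β b i = shift β a i + 1 := by
  subst h
  exact (shift_add_single a i i 1).trans (by simp)

theorem shift_down (i : Fin p) {a b : Ob p} (h : b = down i a) : shift β b i = shift β a i - 1 := by
  subst h
  change β i + ((a i - (Pi.single i 1 : Fin p → ℤ) i : ℤ) : k) = _
  simp [shift, add_sub_assoc]

theorem smul_mem_of_nodes (hβ : Generic β) {x : ℕ → Y k p} (hx : x 0 = 0) (a : Fin p → ℤ) {w : M}
    {P : Submodule k M} (h : ∀ i, ev p x (- shift β a i) • w ∈ P) {r : ℕ} (hr : r ≤ p) :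
    x r • w ∈ P := by
  refine coeff_mem_of_nodes hβ a (x := fun r => x r • w) (by simp [hx]) (fun i => ?_) hr
  rw [← ev_smul]
  exact h i

/-- A linear map that is compatible with the weight spaces and the operators `e_i`, `f_i` commutes
with the Yangian. -/
theorem map_smul_of_wtSpace (hp : 0 < p) (hβ : Generic β) (hM : IsWt β γ M) {ψ : M →ₗ[k] N}
    (h : ∀ a, ∀ x ∈ wtSpace β γ M a, ψ x ∈ wtSpace β γ N a)
    (hf : ∀ i a, ∀ x ∈ wtSpace β γ M a, ψ (ev p (t k p 1 0) (- shift β a i) • x) =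
      ev p (t k p 1 0) (- shift β a i) • ψ x)
    (he : ∀ i a, ∀ x ∈ wtSpace β γ M a, ψ (ev p (t k p 0 1) (- shift β a i) • x) =
      ev p (t k p 0 1) (- shift β a i) • ψ x) (y : Y k p) (x : M) : ψ (y • x) = y • ψ x := by
  -- Compatibility with the values at the nodes passes to the coefficient `z 1` by interpolation,
  -- one weight at a time because the nodes depend on the weight.
  have key : ∀ (z : ℕ → Y k p), z 0 = 0 →
      (∀ i a, ∀ x ∈ wtSpace β γ M a, ψ (ev p z (- shift β a i) • x) =
        ev p z (- shift β a i) • ψ x) → ∀ x, ψ (z 1 • x) = z 1 • ψ x := by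
    intro z hz h1 x
    have h2 : ψ ∘ₗ Algebra.lsmul k k M (z 1) = Algebra.lsmul k k N (z 1) ∘ₗ ψ := by
      refine hM.hom_ext fun a w hw => ?_
      rw [← sub_eq_zero, ← Submodule.mem_bot k]
      refine coeff_mem_of_nodes hβ a (x := fun r => ψ (z r • w) - z r • ψ w) (by simp [hz])
        (fun i => ?_) hp
      rw [Submodule.mem_bot, ev_sub, ev_map p (fun r => z r • w) ψ, ← ev_smul, ← ev_smul,
        h1 i a w hw, sub_self]
    exact LinearMap.congr_fun h2 x
  have hy : y ∈ Algebra.adjoin k (gens k p) := by rw [adjoin_gens]; trivial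
  induction hy using Algebra.adjoin_induction generalizing x with
  | mem g hg =>
    rcases hg with ⟨r, rfl⟩ | rfl | rfl
    · have h2 : ψ ∘ₗ Algebra.lsmul k k M (t k p 1 1 r) = Algebra.lsmul k k N (t k p 1 1 r) ∘ₗ ψ := by
        refine hM.hom_ext fun a w hw => ?_
        obtain ⟨c, hc⟩ := exists_scalar (β := β) (γ := γ) a ⟨t k p 1 1 r, t_mem_Gam r⟩
        have h3 := mem_wtSpace_iff.1 hw _ hc
        have h4 := mem_wtSpace_iff.1 (h a w hw) _ hc
        change (t k p 1 1 r - algebraMap k (Y k p) c) • w = 0 at h3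
        change (t k p 1 1 r - algebraMap k (Y k p) c) • ψ w = 0 at h4
        rw [sub_smul, algebraMap_smul, sub_eq_zero] at h3 h4
        change ψ (t k p 1 1 r • w) = t k p 1 1 r • ψ w
        rw [h3, h4, map_smul]
      exact LinearMap.congr_fun h2 x
    · exact key (t k p 1 0) (by simp [isLevel_t.zero]) hf x
    · exact key (t k p 0 1) (by simp [isLevel_t.zero]) he x
  | algebraMap c => rw [algebraMap_smul, algebraMap_smul, map_smul]
  | add a b _ _ ha hb => rw [add_smul, map_add, ha, hb, add_smul]
  | mul a b _ _ ha hb => rw [mul_smul, ha, hb, mul_smul]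

theorem map_mem_wtSpace (φ : M →ₗ[Y k p] N) {a : Fin p → ℤ} {x : M} (hx : x ∈ wtSpace β γ M a) :
    φ x ∈ wtSpace β γ N a := by
  rw [mem_wtSpace_iff] at hx ⊢
  intro g hg
  rw [← map_smul, hx g hg, map_zero]

variable (β γ) in
/-- The maps on the weight spaces that are induced by a homomorphism. -/
def wtMap (φ : M →ₗ[Y k p] N) (a : Fin p → ℤ) : wtSpace β γ M a →ₗ[k] wtSpace β γ N a :=
  (φ.restrictScalars k).restrict fun _ hx => map_mem_wtSpace φ hx

end Generic

/-! ### The functor to `K_ℓ`-modules and its full faithfulness -/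

section Functor
variable {k : Type u} [Field k] [CharZero k] {p : ℕ} {β : Fin p → k} {γ : Fin (2 * p) → k}

/-- The representation of `K_ℓ` on the weight spaces of a module over the Yangian. -/
def wtRep (hβ : Generic β) (γ : Fin (2 * p) → k) (M : Type u) [AddCommGroup M] [Module k M]
    [Module (Y k p) M] [IsScalarTower k (Y k p) M] : KRep β γ where
  W a := ModuleCat.of k (wtSpace β γ M a)
  F i _ _ h := ModuleCat.ofHom (wtF β γ M i h)
  E i _ _ h := ModuleCat.ofHom (wtE β γ M i h)
  ff i j a b b' c h₁ h₂ h₃ h₄ := by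
    ext w
    change ev p (t k p 1 0) (- shift β b j) • ev p (t k p 1 0) (- shift β a i) • (w : M) =
      ev p (t k p 1 0) (- shift β b' i) • ev p (t k p 1 0) (- shift β a j) • (w : M)
    by_cases hij : i = j
    · subst hij
      rw [h₁, h₃]
    · rw [shift_up_of_ne (Ne.symm hij) h₁, shift_up_of_ne hij h₃, ← mul_smul, rtt_t.commute_same,
        mul_smul]
  ee i j a b b' c h₁ h₂ h₃ h₄ := by
    ext w
    change ev p (t k p 0 1) (- shift β b j) • ev p (t k p 0 1) (- shift β a i) • (w : M) =
      ev p (t k p 0 1) (- shift β b' i) • ev p (t k p 0 1) (- shift β a j) • (w : M)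
    by_cases hij : i = j
    · subst hij
      rw [h₁, h₃]
    · rw [shift_down_of_ne (Ne.symm hij) h₁, shift_down_of_ne hij h₃, ← mul_smul,
        rtt_t.commute_same, mul_smul]
  ef i j hij a b b' c h₁ h₂ h₃ h₄ := by
    ext w
    change ev p (t k p 0 1) (- shift β b i) • ev p (t k p 1 0) (- shift β a j) • (w : M) =
      ev p (t k p 1 0) (- shift β b' j) • ev p (t k p 0 1) (- shift β a i) • (w : M)
    rw [shift_up_of_ne hij h₁, shift_down_of_ne (Ne.symm hij) h₃]
    exact upper_lower_comm hβ hij w.2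
  ef_same i a b h₁ h₂ := by
    ext w
    change ev p (t k p 0 1) (- shift β b i) • ev p (t k p 1 0) (- shift β a i) • (w : M) =
      (-gam γ (-β i - ((a i : ℤ) : k))) • (w : M)
    rw [shift_up i h₁, neg_add']
    refine (upper_lower_same i w.2).trans ?_
    rw [show - shift β a i = -β i - ((a i : ℤ) : k) from neg_add' _ _]
  fe_same i a b h₁ h₂ := by
    ext w
    change ev p (t k p 1 0) (- shift β b i) • ev p (t k p 0 1) (- shift β a i) • (w : M) =
      (-gam γ (-β i - ((a i : ℤ) : k) + 1)) • (w : M)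
    rw [shift_down i h₁, neg_sub', sub_neg_eq_add]
    refine (lower_upper_same i w.2).trans ?_
    rw [show - shift β a i = -β i - ((a i : ℤ) : k) from neg_add' _ _]

/-- Weight vectors generate the module, so finitely many of them do; the sum of the spaces they
generate under `K_ℓ` is a `Y`-submodule and hence everything. -/
theorem wtRep_isFinitelyGenerated (hp : 0 < p) (hβ : Generic β) {M : Type u} [AddCommGroup M]
    [Module k M] [Module (Y k p) M] [IsScalarTower k (Y k p) M] [hfin : Module.Finite (Y k p) M]
    (hM : IsWt β γ M) : IsFinitelyGenerated (wtRep hβ γ M).functor := by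
  have htop : Submodule.span (Y k p) {x : M | ∃ a, x ∈ wtSpace β γ M a} = ⊤ := by
    rw [eq_top_iff]
    rintro x -
    obtain ⟨f, hf, rfl⟩ := hM.exists_decomp x
    exact Submodule.sum_mem _ fun b _ => Submodule.subset_span ⟨b, hf b⟩
  obtain ⟨s, hs, hs'⟩ := Submodule.fg_span_iff_fg_span_finset_subset _ |>.1 (htop ▸ hfin.fg_top)
  rw [htop] at hs'
  choose c hc using fun x : s => hs x.2
  let e := s.equivFin.symm
  refine ⟨s.card, fun j => kob β γ (c (e j)), fun j => (⟨e j, hc (e j)⟩ : wtSpace β γ M (c (e j))),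
    fun ⟨b⟩ => ?_⟩
  change Ob p at b
  let S : ∀ b : Ob p, Submodule k (wtSpace β γ M b) := fun b => Submodule.span k
    {y : (wtRep hβ γ M).functor.obj (kob β γ b) | ∃ (j : Fin s.card)
      (φ : kob β γ (c (e j)) ⟶ kob β γ b),
      y = ((wtRep hβ γ M).functor.map φ).hom (⟨e j, hc (e j)⟩ : wtSpace β γ M (c (e j)))}
  have hSF : ∀ i {a b : Ob p} (h : b = up i a) (w : wtSpace β γ M a), w ∈ S a →
      wtF β γ M i h w ∈ S b := by
    intro i a b h w hw
    refine (Submodule.span_le (p := (S b).comap (wtF β γ M i h))).2 ?_ hw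
    rintro _ ⟨j, φ, rfl⟩
    refine Submodule.subset_span ⟨j, φ ≫ kf β γ i h, ?_⟩
    rw [Functor.map_comp, KRep.functor_kf]
    rfl
  have hSE : ∀ i {a b : Ob p} (h : b = down i a) (w : wtSpace β γ M a), w ∈ S a →
      wtE β γ M i h w ∈ S b := by
    intro i a b h w hw
    refine (Submodule.span_le (p := (S b).comap (wtE β γ M i h))).2 ?_ hw
    rintro _ ⟨j, φ, rfl⟩
    refine Submodule.subset_span ⟨j, φ ≫ ke β γ i h, ?_⟩
    rw [Functor.map_comp, KRep.functor_ke]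
    rfl
  -- `U` is stable under `Y`: `t₂₂^(r)` acts by scalars on each piece, and `t₂₁^(1)`, `t₁₂^(1)` act
  -- on it by combinations of the `f_i` and `e_i`.
  let U : Submodule k M := ⨆ a : Ob p, (S a).map (wtSpace β γ M a).subtype
  have hSU : ∀ a (w : wtSpace β γ M a), w ∈ S a → (w : M) ∈ U := fun a w hw =>
    Submodule.mem_iSup_of_mem (p := fun a : Ob p => (S a).map (wtSpace β γ M a).subtype) a
      ⟨w, hw, rfl⟩
  have hU : ∀ (y : Y k p) (x : M), x ∈ U → y • x ∈ U := by
    have hstep : ∀ y : Y k p, (∀ a (w : wtSpace β γ M a), w ∈ S a → y • (w : M) ∈ U) →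
        ∀ x ∈ U, y • x ∈ U := by
      intro y hy x hx
      refine (iSup_le fun a => ?_ : U ≤ U.comap (Algebra.lsmul k k M y)) hx
      rintro _ ⟨w, hw, rfl⟩
      exact hy a w hw
    intro y x hx
    refine gens_induction (P := (· ∈ U)) (fun x y => add_mem) (fun c x hx => ?_) (fun g hg => ?_) y hx
    · rw [algebraMap_smul]
      exact U.smul_mem c hx
    · refine hstep g fun a w hw => ?_
      rcases hg with ⟨r, rfl⟩ | rfl | rfl
      · obtain ⟨c, -, hc⟩ := exists_scalar_smul (M := M) (β := β) (γ := γ) a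
          ⟨t k p 1 1 r, t_mem_Gam r⟩
        have h1 := hc w w.2
        change t k p 1 1 r • (w : M) = c • (w : M) at h1
        rw [h1]
        exact U.smul_mem c (hSU a w hw)
      · exact smul_mem_of_nodes hβ (by simp [isLevel_t.zero]) a
          (fun i => hSU _ _ (hSF i rfl w hw)) hp
      · exact smul_mem_of_nodes hβ (by simp [isLevel_t.zero]) a
          (fun i => hSU _ _ (hSE i rfl w hw)) hp
  let U' : Submodule (Y k p) M := { U with smul_mem' := fun y x hx => hU y x hx }
  have hU' : U' = ⊤ := by
    rw [eq_top_iff, hs']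
    refine Submodule.span_le.2 fun x hx => ?_
    have h1 : (⟨x, hc ⟨x, hx⟩⟩ : wtSpace β γ M (c ⟨x, hx⟩)) ∈ S (c ⟨x, hx⟩) := by
      have h2 : ∀ z : s, (⟨z, hc z⟩ : wtSpace β γ M (c z)) ∈ S (c z) := by
        intro z
        obtain ⟨j, rfl⟩ := e.surjective z
        exact Submodule.subset_span ⟨j, 𝟙 _, (congrArg (fun z => z.hom
          (⟨e j, hc (e j)⟩ : wtSpace β γ M (c (e j))))
          ((wtRep hβ γ M).functor.map_id (kob β γ (c (e j))))).symm⟩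
      exact h2 ⟨x, hx⟩
    exact hSU _ _ h1
  change S b = ⊤
  rw [eq_top_iff]
  rintro w -
  have hw : (w : M) ∈ U := by
    have : (w : M) ∈ U' := hU' ▸ trivial
    exact this
  obtain ⟨ψ, hψ, -⟩ := exists_proj hβ hM b
  -- Projection to weight `b` extracts the statement about `S b` from the one about the whole sum.
  have hle : U ≤ ((S b).map (wtSpace β γ M b).subtype).comap ψ := by
    refine iSup_le fun a => ?_
    rintro _ ⟨z, hz, rfl⟩
    have h1 := hψ a z z.2
    rw [Submodule.mem_comap, Submodule.subtype_apply, h1]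
    split_ifs with hab
    · subst hab
      exact ⟨z, hz, rfl⟩
    · exact zero_mem _
  have h1 := hle hw
  rw [Submodule.mem_comap, (hψ b w w.2).trans (if_pos rfl)] at h1
  obtain ⟨z, hz, hzw⟩ := h1
  rwa [Subtype.ext hzw] at hz

instance instModuleOfY (M : ModuleCat.{u} (Y k p)) : Module k M :=
  ModuleCat.moduleOfAlgebraModule M

instance instTowerOfY (M : ModuleCat.{u} (Y k p)) : IsScalarTower k (Y k p) M :=
  ModuleCat.isScalarTower_of_algebra_moduleCat M

variable [IsAlgClosed k]

theorem R_isWt (hp : 0 < p) (hβ : Generic β) (M : R β γ) :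
    Module.Finite (Y k p) M.obj ∧ IsWt β γ M.obj :=
  (isWeight_iff hp hβ).1 M.property

/-- The functor from weight modules to `K_ℓ`-modules. -/
def wtFunctor (hp : 0 < p) (hβ : Generic β) (γ : Fin (2 * p) → k) : R β γ ⥤ KMod β γ where
  obj M := ⟨(wtRep hβ γ M.obj).functor, inferInstance, inferInstance,
    have := (R_isWt hp hβ M).1
    wtRep_isFinitelyGenerated hp hβ (R_isWt hp hβ M).2⟩
  map {M N} φ := ObjectProperty.homMk
    (kNatTrans (fun a => ModuleCat.ofHom (wtMap β γ φ.hom.hom a))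
      (fun i {a b} h => by
        rw [KRep.functor_kf, KRep.functor_kf]
        refine ModuleCat.hom_ext (LinearMap.ext fun (w : wtSpace β γ M.obj a) => Subtype.ext ?_)
        exact map_smul φ.hom.hom (ev p (t k p 1 0) (- shift β a i)) (w : M.obj))
      (fun i {a b} h => by
        rw [KRep.functor_ke, KRep.functor_ke]
        refine ModuleCat.hom_ext (LinearMap.ext fun (w : wtSpace β γ M.obj a) => Subtype.ext ?_)
        exact map_smul φ.hom.hom (ev p (t k p 0 1) (- shift β a i)) (w : M.obj)))
  map_id M := rfl
  map_comp φ ψ := rfl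

theorem wtFunctor_faithful (hp : 0 < p) (hβ : Generic β) : (wtFunctor hp hβ γ).Faithful where
  map_injective {M N} φ ψ h := by
    have h1 : φ.hom.hom.restrictScalars k = ψ.hom.hom.restrictScalars k := by
      refine (R_isWt hp hβ M).2.hom_ext fun a w hw => ?_
      have h2 := congrArg (fun η => ((η.hom.app (kob β γ a)).hom
        (⟨w, hw⟩ : wtSpace β γ M.obj a) : wtSpace β γ N.obj a)) h
      exact congrArg Subtype.val h2
    refine ObjectProperty.hom_ext _ (ModuleCat.hom_ext (LinearMap.ext fun x => ?_))
    exact LinearMap.congr_fun h1 x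

/-- The components of a natural transformation glue along the weight decomposition. Naturality at
`f_i` and `e_i` is exactly what makes the glued map `Y`-linear. -/
theorem wtFunctor_full (hp : 0 < p) (hβ : Generic β) : (wtFunctor hp hβ γ).Full where
  map_surjective {M N} η := by
    let θ : ∀ a : Ob p, wtSpace β γ M.obj a →ₗ[k] wtSpace β γ N.obj a := fun a =>
      (η.hom.app (kob β γ a)).hom
    have hf : ∀ i (a : Ob p) (w : wtSpace β γ M.obj a),
        θ (up i a) (wtF β γ M.obj i rfl w) = wtF β γ N.obj i rfl (θ a w) := by
      intro i a w
      have h1 : (wtRep hβ γ M.obj).functor.map (kf β γ i (a := a) rfl) ≫ η.hom.app _ =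
        η.hom.app _ ≫ (wtRep hβ γ N.obj).functor.map (kf β γ i (a := a) rfl) :=
        η.hom.naturality _
      rw [KRep.functor_kf, KRep.functor_kf] at h1
      have h2 := congrArg (fun z => z.hom w) h1
      exact h2
    have he : ∀ i (a : Ob p) (w : wtSpace β γ M.obj a),
        θ (down i a) (wtE β γ M.obj i rfl w) = wtE β γ N.obj i rfl (θ a w) := by
      intro i a w
      have h1 : (wtRep hβ γ M.obj).functor.map (ke β γ i (a := a) rfl) ≫ η.hom.app _ =
        η.hom.app _ ≫ (wtRep hβ γ N.obj).functor.map (ke β γ i (a := a) rfl) :=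
        η.hom.naturality _
      rw [KRep.functor_ke, KRep.functor_ke] at h1
      have h2 := congrArg (fun z => z.hom w) h1
      exact h2
    have hM := (R_isWt hp hβ M).2
    obtain ⟨ψ, hψ⟩ := exists_glue hβ hM fun a => (wtSpace β γ N.obj a).subtype ∘ₗ θ a
    have hψ' : ∀ a (w : M.obj) (hw : w ∈ wtSpace β γ M.obj a), ψ w = θ a ⟨w, hw⟩ :=
      fun a w hw => hψ a ⟨w, hw⟩
    have hlin := map_smul_of_wtSpace hp hβ hM (ψ := ψ)
      (fun a x hx => by rw [hψ' a x hx]; exact (θ a _).2)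
      (fun i a x hx => by
        rw [hψ' _ _ (lower_smul_mem i hx), hψ' a x hx]
        exact congrArg Subtype.val (hf i a ⟨x, hx⟩))
      (fun i a x hx => by
        rw [hψ' _ _ (upper_smul_mem i hx), hψ' a x hx]
        exact congrArg Subtype.val (he i a ⟨x, hx⟩))
    let Ψ : M.obj →ₗ[Y k p] N.obj := { ψ with map_smul' := hlin }
    refine ⟨ObjectProperty.homMk (ModuleCat.ofHom Ψ), ObjectProperty.hom_ext _ ?_⟩
    ext X w
    exact Subtype.ext (hψ' X.as w.1 w.2)

end Functor

end Yangian

/-! ## From modules over `K_ℓ` to weight modules -/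

namespace Yangian

set_option linter.unusedSectionVars false

section Relations
variable {k : Type u} [Field k] {p : ℕ} {β : Fin p → k} {γ : Fin (2 * p) → k}

/-- The representation of the generators and relations of `K_ℓ` given by a functor. -/
def repOf (V : K β γ ⥤ ModuleCat.{u} k) [V.Additive] [V.Linear k] : KRep β γ where
  W a := V.obj (kob β γ a)
  F i _ _ h := V.map (kf β γ i h)
  E i _ _ h := V.map (ke β γ i h)
  ff i j _ _ _ _ h₁ h₂ h₃ h₄ := by
    rw [← V.map_comp, ← V.map_comp]
    exact congrArg V.map (CategoryTheory.Quotient.sound _ (KRel.ff i j h₁ h₂ h₃ h₄))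
  ee i j _ _ _ _ h₁ h₂ h₃ h₄ := by
    rw [← V.map_comp, ← V.map_comp]
    exact congrArg V.map (CategoryTheory.Quotient.sound _ (KRel.ee i j h₁ h₂ h₃ h₄))
  ef i j hij _ _ _ _ h₁ h₂ h₃ h₄ := by
    rw [← V.map_comp, ← V.map_comp]
    exact congrArg V.map (CategoryTheory.Quotient.sound _ (KRel.ef i j hij h₁ h₂ h₃ h₄))
  ef_same i a _ h₁ h₂ := by
    have h : kf β γ i h₁ ≫ ke β γ i h₂ = (-gam γ (-β i - ((a i : ℤ) : k))) • 𝟙 (kob β γ a) :=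
      CategoryTheory.Quotient.sound _ (KRel.ef_same i h₁ h₂)
    rw [← V.map_comp, h, V.map_smul, V.map_id]
  fe_same i a _ h₁ h₂ := by
    have h : ke β γ i h₁ ≫ kf β γ i h₂ = (-gam γ (-β i - ((a i : ℤ) : k) + 1)) • 𝟙 (kob β γ a) :=
      CategoryTheory.Quotient.sound _ (KRel.fe_same i h₁ h₂)
    rw [← V.map_comp, h, V.map_smul, V.map_id]

end Relations

instance (p : ℕ) : DecidableEq (Ob p) := inferInstanceAs (DecidableEq (Fin p → ℤ))

/-! ### The `Y`-module on the direct sum of the values of a representation of `K_ℓ` -/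

namespace KRep

open scoped DirectSum

section Sum
variable {k : Type u} [Field k] {p : ℕ} {β : Fin p → k} {γ : Fin (2 * p) → k} (ρ : KRep β γ)

/-- The sum of the values of a representation. -/
abbrev Total : Type u := ⨁ a : Ob p, ρ.W a

/-- The inclusion of a value. -/
def inc (a : Ob p) : ρ.W a →ₗ[k] ρ.Total := DirectSum.lof k (Ob p) (fun a => ρ.W a) a

/-- The operator `f_i` on the sum. -/
def totalF (i : Fin p) : ρ.Total →ₗ[k] ρ.Total :=
  DirectSum.toModule k (Ob p) ρ.Total fun a => ρ.inc (up i a) ∘ₗ (ρ.F i (a := a) rfl).hom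

/-- The operator `e_i` on the sum. -/
def totalE (i : Fin p) : ρ.Total →ₗ[k] ρ.Total :=
  DirectSum.toModule k (Ob p) ρ.Total fun a => ρ.inc (down i a) ∘ₗ (ρ.E i (a := a) rfl).hom

theorem totalF_inc (i : Fin p) {a b : Ob p} (h : b = up i a) (x : ρ.W a) :
    ρ.totalF i (ρ.inc a x) = ρ.inc b ((ρ.F i h).hom x) := by
  subst h
  exact DirectSum.toModule_lof k (M := fun a : Ob p => ρ.W a) a x

theorem totalE_inc (i : Fin p) {a b : Ob p} (h : b = down i a) (x : ρ.W a) :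
    ρ.totalE i (ρ.inc a x) = ρ.inc b ((ρ.E i h).hom x) := by
  subst h
  exact DirectSum.toModule_lof k (M := fun a : Ob p => ρ.W a) a x

theorem inc_injective (a : Ob p) : Function.Injective (ρ.inc a) :=
  DirectSum.of_injective (β := fun a : Ob p => ρ.W a) a

/-- The operator that acts on the values by scalars. -/
def totalDiag (φ : (Fin p → ℤ) → k) : ρ.Total →ₗ[k] ρ.Total :=
  DirectSum.toModule k (Ob p) ρ.Total fun a => φ a • ρ.inc a

theorem total_induction {P : ρ.Total → Prop} (zero : P 0) (inc : ∀ a x, P (ρ.inc a x))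
    (add : ∀ x y, P x → P y → P (x + y)) (x : ρ.Total) : P x :=
  DirectSum.induction_on x zero inc add

theorem total_ff (i j : Fin p) {a : Ob p} (x : ρ.W a) :
    ρ.totalF i (ρ.totalF j (ρ.inc a x)) = ρ.totalF j (ρ.totalF i (ρ.inc a x)) := by
  have h : up i (up j a) = up j (up i a) := add_right_comm (G := Fin p → ℤ) a _ _
  rw [ρ.totalF_inc j rfl, ρ.totalF_inc i rfl, ρ.totalF_inc i rfl, ρ.totalF_inc j h]
  exact congrArg (fun z => ρ.inc _ (z.hom x)) (ρ.ff j i (a := a) rfl rfl rfl h)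

theorem total_ee (i j : Fin p) {a : Ob p} (x : ρ.W a) :
    ρ.totalE i (ρ.totalE j (ρ.inc a x)) = ρ.totalE j (ρ.totalE i (ρ.inc a x)) := by
  have h : down i (down j a) = down j (down i a) := sub_right_comm (α := Fin p → ℤ) a _ _
  rw [ρ.totalE_inc j rfl, ρ.totalE_inc i rfl, ρ.totalE_inc i rfl, ρ.totalE_inc j h]
  exact congrArg (fun z => ρ.inc _ (z.hom x)) (ρ.ee j i (a := a) rfl rfl rfl h)

theorem total_ef {i j : Fin p} (hij : i ≠ j) {a : Ob p} (x : ρ.W a) :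
    ρ.totalE i (ρ.totalF j (ρ.inc a x)) = ρ.totalF j (ρ.totalE i (ρ.inc a x)) := by
  have h : down i (up j a) = up j (down i a) :=
    (sub_add_eq_add_sub (α := Fin p → ℤ) a _ _).symm
  rw [ρ.totalF_inc j rfl, ρ.totalE_inc i rfl, ρ.totalE_inc i rfl, ρ.totalF_inc j h]
  exact congrArg (fun z => ρ.inc _ (z.hom x)) (ρ.ef i j hij (a := a) rfl rfl rfl h)

theorem total_ef_same (i : Fin p) {a : Ob p} (x : ρ.W a) :
    ρ.totalE i (ρ.totalF i (ρ.inc a x)) = (-gam γ (-β i - ((a i : ℤ) : k))) • ρ.inc a x := by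
  have h : a = down i (up i a) := (add_sub_cancel_right (G := Fin p → ℤ) a _).symm
  rw [ρ.totalF_inc i rfl, ρ.totalE_inc i h, ← map_smul]
  exact congrArg (fun z => ρ.inc _ (z.hom x)) (ρ.ef_same i (a := a) rfl h)

theorem total_fe_same (i : Fin p) {a : Ob p} (x : ρ.W a) :
    ρ.totalF i (ρ.totalE i (ρ.inc a x)) =
      (-gam γ (-β i - ((a i : ℤ) : k) + 1)) • ρ.inc a x := by
  have h : a = up i (down i a) := (sub_add_cancel (G := Fin p → ℤ) a _).symm
  rw [ρ.totalE_inc i rfl, ρ.totalF_inc i h, ← map_smul]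
  exact congrArg (fun z => ρ.inc _ (z.hom x)) (ρ.fe_same i (a := a) rfl h)

/-- The datum given by a representation. -/
def datum : Datum β γ ρ.Total where
  wt a := LinearMap.range (ρ.inc a)
  span := by
    rw [eq_top_iff]
    rintro x -
    induction x using ρ.total_induction with
    | zero => exact zero_mem _
    | inc a x => exact Submodule.mem_iSup_of_mem (p := fun a : Fin p → ℤ =>
        LinearMap.range (ρ.inc a)) a ⟨x, rfl⟩
    | add x y hx hy => exact add_mem hx hy
  diag := ρ.totalDiag
  diag_apply := by
    rintro φ a _ ⟨x, rfl⟩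
    exact DirectSum.toModule_lof k (M := fun a : Ob p => ρ.W a) a x
  f := ρ.totalF
  e := ρ.totalE
  f_mem := by
    rintro i a _ ⟨x, rfl⟩
    exact ⟨_, (ρ.totalF_inc i rfl x).symm⟩
  e_mem := by
    rintro i a _ ⟨x, rfl⟩
    exact ⟨_, (ρ.totalE_inc i rfl x).symm⟩
  ff := by
    rintro i j a _ ⟨x, rfl⟩
    exact ρ.total_ff i j x
  ee := by
    rintro i j a _ ⟨x, rfl⟩
    exact ρ.total_ee i j x
  ef := by
    rintro i j a _ ⟨x, rfl⟩ hij
    exact ρ.total_ef hij x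
  ef_same := by
    rintro i a _ ⟨x, rfl⟩
    exact ρ.total_ef_same i x
  fe_same := by
    rintro i a _ ⟨x, rfl⟩
    exact ρ.total_fe_same i x

variable [CharZero k] (hp : 0 < p) (hβ : Generic β)

/-- The module over the Yangian given by a representation. -/
abbrev YMod : Type u := ρ.datum.Carrier hp hβ

/-- The inclusion of a value into the module over the Yangian. -/
def incY (a : Ob p) : ρ.W a →ₗ[k] ρ.YMod hp hβ := (ρ.datum.of hp hβ).toLinearMap ∘ₗ ρ.inc a

theorem incY_mem (a : Ob p) (x : ρ.W a) : ρ.incY hp hβ a x ∈ wtSpace β γ (ρ.YMod hp hβ) a :=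
  ρ.datum.of_mem hp hβ ⟨x, rfl⟩

theorem incY_F (i : Fin p) {a b : Ob p} (h : b = up i a) (x : ρ.W a) :
    ρ.incY hp hβ b ((ρ.F i h).hom x) =
      ev p (t k p 1 0) (- shift β a i) • ρ.incY hp hβ a x := by
  have h1 := ρ.datum.ev_smul_of hp hβ 1 0 (- shift β a i) (ρ.inc a x)
  rw [Datum.t_one_zero, ρ.datum.ev_c_node hβ (a := a) ⟨x, rfl⟩ i rfl] at h1
  exact (congrArg (ρ.datum.of hp hβ) (ρ.totalF_inc i h x).symm).trans h1.symm

theorem incY_E (i : Fin p) {a b : Ob p} (h : b = down i a) (x : ρ.W a) :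
    ρ.incY hp hβ b ((ρ.E i h).hom x) =
      ev p (t k p 0 1) (- shift β a i) • ρ.incY hp hβ a x := by
  have h1 := ρ.datum.ev_smul_of hp hβ 0 1 (- shift β a i) (ρ.inc a x)
  rw [Datum.t_zero_one, ρ.datum.ev_b_node hβ (a := a) ⟨x, rfl⟩ i rfl] at h1
  exact (congrArg (ρ.datum.of hp hβ) (ρ.totalE_inc i h x).symm).trans h1.symm

theorem yMod_induction {P : ρ.YMod hp hβ → Prop} (zero : P 0)
    (inc : ∀ a x, P (ρ.incY hp hβ a x)) (add : ∀ x y, P x → P y → P (x + y))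
    (x : ρ.YMod hp hβ) : P x :=
  ρ.total_induction (P := P) zero inc add x

/-- The values of a representation are the weight spaces of its module. -/
def toWt (a : Ob p) : ρ.W a →ₗ[k] wtSpace β γ (ρ.YMod hp hβ) a :=
  (ρ.incY hp hβ a).codRestrict _ (ρ.incY_mem hp hβ a)

/-- Surjectivity is the absence of further weight vectors: projecting a sum of values to weight `a`
leaves only the value at `a`. -/
theorem toWt_bijective (a : Ob p) : Function.Bijective (ρ.toWt hp hβ a) := by
  refine ⟨fun x y h => ρ.inc_injective a (congrArg Subtype.val h), fun z => ?_⟩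
  obtain ⟨ψ, hψ, -⟩ := exists_proj hβ (ρ.datum.isWt hp hβ) a
  have h : ∀ z : ρ.YMod hp hβ, ∃ x, ψ z = ρ.incY hp hβ a x := by
    intro z
    induction z using ρ.yMod_induction hp hβ with
    | zero => exact ⟨0, by rw [map_zero, map_zero]⟩
    | inc b x =>
      rw [hψ b _ (ρ.incY_mem hp hβ b x)]
      split_ifs with hab
      · subst hab
        exact ⟨x, rfl⟩
      · exact ⟨0, (map_zero _).symm⟩
    | add x y hx hy =>
      obtain ⟨x', hx⟩ := hx
      obtain ⟨y', hy⟩ := hy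
      exact ⟨x' + y', by rw [map_add, map_add, hx, hy]⟩
  obtain ⟨x, hx⟩ := h z
  rw [(hψ a z z.2).trans (if_pos rfl)] at hx
  exact ⟨x, Subtype.ext hx.symm⟩

end Sum

end KRep

/-! ### Essential surjectivity and the equivalence -/

section Equivalence
variable {k : Type u} [Field k] [CharZero k] {p : ℕ} {β : Fin p → k} {γ : Fin (2 * p) → k}

theorem yMod_finite (hp : 0 < p) (hβ : Generic β) (V : K β γ ⥤ ModuleCat.{u} k) [V.Additive]
    [V.Linear k] (hV : IsFinitelyGenerated V) :
    Module.Finite (Y k p) ((repOf V).YMod hp hβ) := by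
  obtain ⟨n, c, x, hx⟩ := hV
  let ι : ∀ b : Ob p, V.obj (kob β γ b) →ₗ[k] (repOf V).YMod hp hβ := (repOf V).incY hp hβ
  let S : Submodule (Y k p) ((repOf V).YMod hp hβ) :=
    Submodule.span (Y k p) (Set.range fun j => ι (c j).as (x j))
  refine ⟨⟨(Set.finite_range fun j => ι (c j).as (x j)).toFinset, ?_⟩⟩
  rw [Set.Finite.coe_toFinset, eq_top_iff]
  rintro z -
  change z ∈ S
  induction z using (repOf V).yMod_induction hp hβ with
  | zero => exact zero_mem _
  | add x y hx hy => exact add_mem hx hy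
  | inc b y =>
    have hle : (⊤ : Submodule k (V.obj (kob β γ b))) ≤ (S.restrictScalars k).comap (ι b) := by
      rw [← hx (kob β γ b)]
      refine Submodule.span_le.2 ?_
      rintro _ ⟨j, φ, rfl⟩
      change ι b ((V.map φ).hom (x j)) ∈ S
      -- Morphisms of `K_ℓ` are built from `f_i` and `e_i`, which act as elements of `Y` on weight
      -- vectors, so they stay inside the `Y`-span of the generators.
      refine k_hom_induction (a := (c j).as) (P := fun b φ => ι b ((V.map φ).hom (x j)) ∈ S)
        ?_ ?_ ?_ ?_ ?_ ?_ φ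
      · rw [V.map_id]
        exact Submodule.subset_span ⟨j, rfl⟩
      · intro b
        rw [V.map_zero]
        exact (map_zero (ι b)).symm ▸ zero_mem S
      · intro b g h hg hh
        rw [V.map_add]
        exact (map_add (ι b) _ _).symm ▸ add_mem hg hh
      · intro b c g hg
        rw [V.map_smul]
        exact (map_smul (ι b) c _).symm ▸ (S.restrictScalars k).smul_mem c hg
      · intro i b c h g hg
        rw [V.map_comp]
        exact ((repOf V).incY_F hp hβ i h _).symm ▸ S.smul_mem _ hg
      · intro i b c h g hg
        rw [V.map_comp]
        exact ((repOf V).incY_E hp hβ i h _).symm ▸ S.smul_mem _ hg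
    exact hle (Submodule.mem_top (x := y))

/-- A `K_ℓ`-module is recovered from the weight spaces of its module over the Yangian. -/
def toWtRep (hp : 0 < p) (hβ : Generic β) (V : K β γ ⥤ ModuleCat.{u} k) [V.Additive]
    [V.Linear k] : V ⟶ (wtRep hβ γ ((repOf V).YMod hp hβ)).functor :=
  kNatTrans (fun a => ModuleCat.ofHom ((repOf V).toWt hp hβ a))
    (fun i {a b} h => by
      rw [KRep.functor_kf]
      exact ModuleCat.hom_ext (LinearMap.ext fun x =>
        Subtype.ext ((repOf V).incY_F hp hβ i h x)))
    (fun i {a b} h => by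
      rw [KRep.functor_ke]
      exact ModuleCat.hom_ext (LinearMap.ext fun x =>
        Subtype.ext ((repOf V).incY_E hp hβ i h x)))

instance (hp : 0 < p) (hβ : Generic β) (V : K β γ ⥤ ModuleCat.{u} k) [V.Additive]
    [V.Linear k] : IsIso (toWtRep hp hβ V) := by
  have : ∀ X, IsIso ((toWtRep hp hβ V).app X) := fun X =>
    (ConcreteCategory.isIso_iff_bijective _).2 ((repOf V).toWt_bijective hp hβ X.as)
  exact NatIso.isIso_of_isIso_app _

variable [IsAlgClosed k]

/-- The preimage is the direct sum of the values with its interpolated `Y`-action; its weight spaces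
are the original values. -/
theorem wtFunctor_essSurj (hp : 0 < p) (hβ : Generic β) : (wtFunctor hp hβ γ).EssSurj where
  mem_essImage V := by
    have := V.property.1
    have := V.property.2.1
    have hY : HarishChandra.weightProperty (Gam k p)
        (HarishChandra.block (Gam k p) (iotaStar β γ))
        (ModuleCat.of (Y k p) ((repOf V.obj).YMod hp hβ)) :=
      (isWeight_iff hp hβ).2 ⟨yMod_finite hp hβ V.obj V.property.2.2,
        (repOf V.obj).datum.isWt hp hβ⟩
    exact ⟨⟨_, hY⟩, ⟨ObjectProperty.isoMk _ (asIso (toWtRep hp hβ V.obj)).symm⟩⟩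

theorem wtFunctor_isEquivalence (hp : 0 < p) (hβ : Generic β) :
    (wtFunctor hp hβ γ).IsEquivalence where
  faithful := wtFunctor_faithful hp hβ
  full := wtFunctor_full hp hβ
  essSurj := wtFunctor_essSurj hp hβ

theorem wtFunctor_linear (hp : 0 < p) (hβ : Generic β) : (wtFunctor hp hβ γ).Linear k where
  map_smul φ c := by
    refine ObjectProperty.hom_ext _ ?_
    ext X w
    exact Subtype.ext rfl

end Equivalence

end Yangian

end

theorem proposition7 {k : Type u} [Field k] [IsAlgClosed k] [CharZero k] {p : ℕ} (hp : 0 < p)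
    (β : Fin p → k) (γ : Fin (2 * p) → k)
    (hβ : ∀ i j : Fin p, i ≠ j → ∀ m : ℤ, β i - β j ≠ (m : k)) :
    ∃ E : Yangian.R β γ ≌ Yangian.KMod β γ, E.functor.Linear k :=
  have := Yangian.wtFunctor_isEquivalence (γ := γ) hp hβ
  ⟨(Yangian.wtFunctor hp hβ γ).asEquivalence,
    Yangian.wtFunctor_linear hp hβ⟩
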